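/- Let $V:S^1\times\mathbb R\to\mathbb R$, $S^1=\mathbb R/2\pi\mathbb Z$, be given by $V(x,y)=-\exp(-1/y^2)\,\sin(x+1/y)$ for $y\ne0$ and $V(x,0)=0$. Then $dx^2+dy^2+(2-V(x,y))\,dz^2$, where $dz^2$ is the round metric of the unit sphere $S^2\subset\mathbb R^3$, is a $C^\infty$ Riemannian metric on the $4$-manifold $N=S^1\times\mathbb R\times S^2$, and there is a harmonic map $f:B^3\to N$ of the unit ball of $\mathbb R^3$ (a finite energy $W^{1,2}$ map that is smooth away from its finite set of discontinuities and satisfies there the Euler–Lagrange equations of the energy $\int|Df|^2$) with an isolated singularity at $0$ and a continuum of distinct tangent maps at $0$. (A tangent map of $f$ at $0$ is a map $\mathbb R^3\to N$ that is constant on rays through the origin and is the weak $W^{1,2}_{\mathrm{loc}}$ limit of $y\mapsto f(r_iy)$ for some sequence of positive numbers $r_i\to0$.) More precisely, $f$ can be chosen so that $0$ is its only singularity, it is smooth on $\overline{B^3}\setminus\{0\}$, its image lies in a compact subset of $N$, and for every $c\in S^1$ the map $p\mapsto(c,0,p/|p|)$ is a tangent map of $f$ at $0$. Moreover $f(p)=(u(\log|p|),\,p/|p|)$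 for $0<|p|\le1$, where $u=(x,y):\mathbb R\to S^1\times\mathbb R$ is a smooth solution of $\ddot u+\dot u+\nabla V(u)=0$ whose physical energy $\tfrac12|\dot u|^2+V(u)$ is negative and strictly decreasing in $t$, for which $y(t)\to0$ as $t\to-\infty$, and for which every point of $S^1\times\{0\}$ is an accumulation point of $u(t)$ as $t\to-\infty$. -/

import Mathlib

open MeasureTheory Set Filter
open scoped Manifold ContDiff Topology

namespace NonuniqueTangent

section General

/-! ### Sobolev functions and weak convergence in `W^{1,2}` -/

/-- `G` is the weak (distributional) gradient of `w` on `Ω ⊆ ℝ^m`, and `w` and `G` are square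
integrable on `Ω`; that is, `w ∈ W^{1,2}(Ω)` with weak gradient `G`. -/
structure IsW12 {m : ℕ} (Ω : Set (EuclideanSpace ℝ (Fin m)))
    (w : EuclideanSpace ℝ (Fin m) → ℝ)
    (G : EuclideanSpace ℝ (Fin m) → EuclideanSpace ℝ (Fin m)) : Prop where
  memLp : MemLp w 2 (volume.restrict Ω)
  memLp_grad : MemLp G 2 (volume.restrict Ω)
  weak : ∀ ψ : EuclideanSpace ℝ (Fin m) → ℝ, ContDiff ℝ ∞ ψ → HasCompactSupport ψ →
    tsupport ψ ⊆ Ω → ∀ e : EuclideanSpace ℝ (Fin m),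
      ∫ x in Ω, w x * fderiv ℝ ψ x e = -∫ x in Ω, inner ℝ (G x) e * ψ x

/-- The sequence `w i` (whose terms lie in `W^{1,2}(Ω)` for all large `i`) converges weakly in
`W^{1,2}(Ω)` to `w'`. -/
def TendstoWeaklyW12 {m : ℕ} (Ω : Set (EuclideanSpace ℝ (Fin m)))
    (w : ℕ → EuclideanSpace ℝ (Fin m) → ℝ) (w' : EuclideanSpace ℝ (Fin m) → ℝ) : Prop :=
  ∃ (G : ℕ → EuclideanSpace ℝ (Fin m) → EuclideanSpace ℝ (Fin m))
    (G' : EuclideanSpace ℝ (Fin m) → EuclideanSpace ℝ (Fin m)),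
    (∀ᶠ i in atTop, IsW12 Ω (w i) (G i)) ∧ IsW12 Ω w' G' ∧
    (∀ ψ : EuclideanSpace ℝ (Fin m) → ℝ, MemLp ψ 2 (volume.restrict Ω) →
      Tendsto (fun i => ∫ x in Ω, w i x * ψ x) atTop (𝓝 (∫ x in Ω, w' x * ψ x))) ∧
    (∀ Ψ : EuclideanSpace ℝ (Fin m) → EuclideanSpace ℝ (Fin m),
      MemLp Ψ 2 (volume.restrict Ω) →
      Tendsto (fun i => ∫ x in Ω, inner ℝ (G i x) (Ψ x)) atTop
        (𝓝 (∫ x in Ω, inner ℝ (G' x) (Ψ x))))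

/-! ### Harmonic maps into a Riemannian manifold -/

variable {E : Type*} [NormedAddCommGroup E] [NormedSpace ℝ E]
  {H : Type*} [TopologicalSpace H] {I : ModelWithCorners ℝ E H}
  {N : Type*} [TopologicalSpace N] [ChartedSpace H N] [IsManifold I ∞ N]

/-- The metric `g` read in the chart `φ`: the bilinear form `g_{ij}(q) a^i b^j`. -/
noncomputable def metricInChart
    (g : Bundle.ContMDiffRiemannianMetric I ∞ E (fun p : N => TangentSpace I p))
    (φ : OpenPartialHomeomorph N H) (q a b : E) : ℝ :=
  g.inner ((φ.extend I).symm q)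
    (mfderiv 𝓘(ℝ, E) I (φ.extend I).symm q a)
    (mfderiv 𝓘(ℝ, E) I (φ.extend I).symm q b)

/-- The Euler-Lagrange equations at `x` of the energy `∫ ∑_α g_{ij}(h) ∂_α h^i ∂_α h^j`, where
`h` is `f` read in the chart `φ`:
`∑_α ∂_α (g_{kj}(h) ∂_α h^j) = 1/2 ∑_α (∂_k g_{ij})(h) ∂_α h^i ∂_α h^j` for each direction `k`. -/
def EulerLagrangeAt {m : ℕ}
    (g : Bundle.ContMDiffRiemannianMetric I ∞ E (fun p : N => TangentSpace I p))
    (φ : OpenPartialHomeomorph N H) (f : EuclideanSpace ℝ (Fin m) → N)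
    (x : EuclideanSpace ℝ (Fin m)) : Prop :=
  let h : EuclideanSpace ℝ (Fin m) → E := fun x' => φ.extend I (f x')
  let ε : Fin m → EuclideanSpace ℝ (Fin m) := fun α => EuclideanSpace.single α 1
  ∀ k : E,
    ∑ α, fderiv ℝ (fun x' => metricInChart g φ (h x') k (fderiv ℝ h x' (ε α))) x (ε α) =
      (1 / 2) * ∑ α, fderiv ℝ
        (fun q => metricInChart g φ q (fderiv ℝ h x (ε α)) (fderiv ℝ h x (ε α))) (h x) k

/-- The energy density `|Df|² = ∑_α g(∂_α f, ∂_α f)`. -/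
noncomputable def energyDensity {m : ℕ}
    (g : Bundle.ContMDiffRiemannianMetric I ∞ E (fun p : N => TangentSpace I p))
    (f : EuclideanSpace ℝ (Fin m) → N) (x : EuclideanSpace ℝ (Fin m)) : ℝ :=
  ∑ α : Fin m,
    g.inner (f x)
      (mfderiv 𝓘(ℝ, EuclideanSpace ℝ (Fin m)) I f x (EuclideanSpace.single α (1 : ℝ)))
      (mfderiv 𝓘(ℝ, EuclideanSpace ℝ (Fin m)) I f x (EuclideanSpace.single α (1 : ℝ)))

/-- `f : Ω → N` is a harmonic map whose set of singularities is the finite set `S ⊆ Ω`: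
a finite energy Sobolev map that is smooth on `Ω \ S`, has a (non-removable) discontinuity at each
point of `S`, and satisfies the Euler-Lagrange equations of the energy on `Ω \ S`, in every chart
of `N`. The Sobolev condition is tested on the compactly supported smooth functions on `N`; for
maps with relatively compact image in `N` this is the same as testing it on the coordinates of an
embedding of `N` in a Euclidean space. -/
structure IsHarmonicMap {m : ℕ}
    (g : Bundle.ContMDiffRiemannianMetric I ∞ E (fun p : N => TangentSpace I p))
    (Ω : Set (EuclideanSpace ℝ (Fin m))) (S : Finset (EuclideanSpace ℝ (Fin m)))
    (f : EuclideanSpace ℝ (Fin m) → N) : Prop where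
  isOpen : IsOpen Ω
  sing_subset : ↑S ⊆ Ω
  smooth : ContMDiffOn 𝓘(ℝ, EuclideanSpace ℝ (Fin m)) I ∞ f (Ω \ ↑S)
  discontinuous : ∀ p ∈ S, ¬ ∃ q : N, Tendsto f (𝓝[≠] p) (𝓝 q)
  sobolev : ∀ η : N → ℝ, ContMDiff I 𝓘(ℝ, ℝ) ∞ η → HasCompactSupport η →
    ∃ G, IsW12 Ω (fun x => η (f x)) G
  finite_energy : ∫⁻ x in Ω, ENNReal.ofReal (energyDensity g f x) < ⊤
  eulerLagrange : ∀ x ∈ Ω \ ↑S, ∀ φ ∈ IsManifold.maximalAtlas I ∞ N, f x ∈ φ.source →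
    EulerLagrangeAt g φ f x

/-- `T : ℝ^m → N` is a tangent map of `f` at `x`: it is constant on rays through the origin and
is the weak `W^{1,2}_loc` limit of the maps `y ↦ f (x + r_i y)` for some sequence `r_i ↓ 0` of
positive numbers. (Convergence is again tested on compactly supported smooth functions on `N`.) -/
def IsTangentMap (I : ModelWithCorners ℝ E H) {m : ℕ} (f : EuclideanSpace ℝ (Fin m) → N)
    (x : EuclideanSpace ℝ (Fin m)) (T : EuclideanSpace ℝ (Fin m) → N) : Prop :=
  (∀ (c : ℝ) (y : EuclideanSpace ℝ (Fin m)), 0 < c → T (c • y) = T y) ∧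
  ∃ r : ℕ → ℝ, (∀ i, 0 < r i) ∧ Tendsto r atTop (𝓝 0) ∧
    ∀ η : N → ℝ, ContMDiff I 𝓘(ℝ, ℝ) ∞ η → HasCompactSupport η → ∀ R : ℝ, 0 < R →
      TendstoWeaklyW12 (Metric.ball 0 R) (fun i y => η (f (x + r i • y))) (fun y => η (T y))

end General

section Target

/-! ### The target manifold `S¹ × ℝ × S²` -/

/-- Euclidean three-space. -/
abbrev R3 : Type := EuclideanSpace ℝ (Fin 3)

/-- The unit sphere in Euclidean three-space. -/
abbrev S2 : Type := Metric.sphere (0 : R3) 1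

/-- The manifold `S¹ × ℝ × S²`. -/
abbrev Target : Type := Circle × ℝ × S2

/-- The model of `S¹ × ℝ × S²`, on `ℝ¹ × ℝ × ℝ²`. -/
noncomputable abbrev targetModel :
    ModelWithCorners ℝ (EuclideanSpace ℝ (Fin 1) × ℝ × EuclideanSpace ℝ (Fin 2))
      (ModelProd (EuclideanSpace ℝ (Fin 1)) (ModelProd ℝ (EuclideanSpace ℝ (Fin 2)))) :=
  (𝓡 1).prod (𝓘(ℝ, ℝ).prod (𝓡 2))

/-- `V(x, y) = - exp (-1 / y²) sin (x + 1 / y)`, extended by `0` to `y = 0`. -/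
noncomputable def V (x y : ℝ) : ℝ :=
  if y = 0 then 0 else -(Real.exp (-1 / y ^ 2) * Real.sin (x + 1 / y))

/-- `V` as a function on `S¹ × ℝ`, where the point `e^{ix}` of the circle has coordinate `x`. -/
noncomputable def circleV (c : Circle) (y : ℝ) : ℝ := V (Complex.arg (c : ℂ)) y

theorem circleV_exp (x y : ℝ) : circleV (Circle.exp x) y = V x y := by
  obtain ⟨n, hn⟩ := Circle.exp_eq_exp.1 (Circle.exp_arg (Circle.exp x))
  unfold circleV V
  rw [hn, show x + n * (2 * Real.pi) + 1 / y = x + 1 / y + n * (2 * Real.pi) by ring,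
    Real.sin_add_int_mul_two_pi]

/-- The differential at `p` of the projection of `S¹ × ℝ × S²` to the unit circle in `ℂ`. -/
noncomputable def dx (p : Target) : TangentSpace targetModel p →L[ℝ] ℂ :=
  mfderiv targetModel 𝓘(ℝ, ℂ) (fun q : Target => (q.1 : ℂ)) p

/-- The differential at `p` of the projection of `S¹ × ℝ × S²` to `ℝ`. -/
noncomputable def dy (p : Target) : TangentSpace targetModel p →L[ℝ] ℝ :=
  mfderiv targetModel 𝓘(ℝ, ℝ) (fun q : Target => q.2.1) p

/-- The differential at `p` of the projection of `S¹ × ℝ × S²` to the unit sphere in `ℝ³`. -/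
noncomputable def dz (p : Target) : TangentSpace targetModel p →L[ℝ] R3 :=
  mfderiv targetModel 𝓘(ℝ, R3) (fun q : Target => (q.2.2 : R3)) p

/-- The bilinear form `dx² + dy² + (2 - V(x, y)) dz²` on the tangent space of `S¹ × ℝ × S²` at
`p`, where `dx²` and `dz²` are the round metrics of the unit circle in `ℂ` and of the unit sphere
in `ℝ³`. -/
noncomputable def warpedForm (p : Target) (v w : TangentSpace targetModel p) : ℝ :=
  inner ℝ (dx p v) (dx p w) + dy p v * dy p w +
    (2 - circleV p.1 p.2.1) * inner ℝ (dz p v) (dz p w)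

/-- The physical energy `½|u'|² + V(u)` of a trajectory `u = (x, y)` at time `t`. -/
noncomputable def physicalEnergy (x y : ℝ → ℝ) (t : ℝ) : ℝ :=
  (1 / 2) * (deriv x t ^ 2 + deriv y t ^ 2) + V (x t) (y t)

/-- `u = (x, y)` is a smooth solution on the whole line of `u'' + u' + ∇V(u) = 0`. -/
structure IsTrajectory (x y : ℝ → ℝ) : Prop where
  smooth_x : ContDiff ℝ ∞ x
  smooth_y : ContDiff ℝ ∞ y
  eq_x : ∀ t, deriv (deriv x) t + deriv x t + deriv (fun s => V s (y t)) (x t) = 0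
  eq_y : ∀ t, deriv (deriv y) t + deriv y t + deriv (fun s => V (x t) s) (y t) = 0

end Target

end NonuniqueTangent

/-! For f(p) = (u(log|p|), p/|p|) and t = log|p|, the energy of f is, up to a factor, the integral
of e^t (|u'|² + 2(2 - V(u))) dt. Its Euler-Lagrange equation is u'' + u' + ∇V(u) = 0, a particle
with friction in the potential V. The origin corresponds to t → -∞, and dilating the ball translates
t. It therefore suffices to find an ancient trajectory that approaches the circle y = 0 of
equilibria while x winds around it infinitely often, with velocity tending to 0.

The potential forces the winding. It is negative for y > 0 only where sin(x + 1/y) > 0, that is, in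
valleys that spiral into the circle. A trajectory of negative energy with y > 0 cannot leave its
valley, so x + 1/y stays bounded above, and y → 0 forces x → -∞.

For existence, release the particle at rest in a valley at a small height δ. The energy decreases,
and the identity 2V = y³V_y + yV_x (`two_mul_V`) excludes that it stays below height 1: the
gradient, hence V, would tend to 0 although V is bounded above by the negative initial energy. By
Gronwall the time needed to reach height 1 is large when δ is small (`exists_long_solution`).
Restarting the clock at the hitting time and intersecting nested compact sets of states at height 1
gives an ancient solution (`exists_ancient_solution`). Its energy is strictly decreasing, hence
negative, and converges backwards in time. So the velocity and ∇V tend to 0, and V² + V_x² =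
exp(-2/y²) gives y → 0 (`exists_spiral`).

For c on the circle there are t_i → -∞ with x(t_i) = c modulo 2π. As the velocity tends to 0, the
dilations of f by e^{t_i} converge, with first derivatives, to (c, 0, p/|p|) away from the origin.
Bounds of order 1/|p| on the gradients make this weak W^{1,2} convergence (`tendstoWeaklyW12_ball`,
`isTangentMap_coneMap`). The Euler-Lagrange equations are verified in an arbitrary chart by writing
the metric as a sum of weighted pullbacks of inner products of ℂ, ℝ and ℝ³
(`exists_hasFDerivAt_weighted`, `eulerLagrangeAt_radialMap`). -/

namespace NonuniqueTangent

/-! ### The potential: smoothness, gradient identities, Lipschitz gradient. -/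

section Potential

open Polynomial

/-- The flat function `P(1/y) exp(-1/y² + i/y)`, extended by `0` to `y = 0`. -/
noncomputable def flat (P : ℂ[X]) (y : ℝ) : ℂ :=
  if y = 0 then 0 else P.eval ((y⁻¹ : ℝ) : ℂ) *
    Complex.exp (-((y⁻¹ : ℝ) : ℂ) ^ 2 + ((y⁻¹ : ℝ) : ℂ) * Complex.I)

/-- The polynomial of the derivative of a flat function. -/
noncomputable def flatDeriv (P : ℂ[X]) : ℂ[X] :=
  X ^ 2 * ((2 * X - C Complex.I) * P - derivative P)

@[simp] theorem flat_zero (P : ℂ[X]) : flat P 0 = 0 := by simp [flat]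

theorem norm_cexp_flat (s : ℝ) :
    ‖Complex.exp (-(s : ℂ) ^ 2 + (s : ℂ) * Complex.I)‖ = Real.exp (-s ^ 2) := by
  rw [Complex.norm_exp]
  congr 1
  simp [← Complex.ofReal_pow]

theorem pow_mul_exp_neg_sq_le (n : ℕ) (s : ℝ) :
    |s| ^ n * Real.exp (-s ^ 2) ≤ n.factorial * Real.exp 1 := by
  have h1 := Real.pow_div_factorial_le_exp |s| (abs_nonneg s) n
  have h2 : |s| ≤ 1 + s ^ 2 := by
    rw [← sq_abs]; nlinarith [sq_nonneg (|s| - 1), abs_nonneg s]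
  have h3 : Real.exp |s| * Real.exp (-s ^ 2) ≤ Real.exp 1 := by
    rw [← Real.exp_add]; exact Real.exp_le_exp.2 (by linarith)
  have hf : (0 : ℝ) < n.factorial := by exact_mod_cast n.factorial_pos
  rw [div_le_iff₀ hf] at h1
  calc |s| ^ n * Real.exp (-s ^ 2) ≤ Real.exp |s| * n.factorial * Real.exp (-s ^ 2) := by gcongr
    _ = n.factorial * (Real.exp |s| * Real.exp (-s ^ 2)) := by ring
    _ ≤ _ := by gcongr

theorem exists_bound_eval_mul_exp (P : ℂ[X]) :
    ∃ B, ∀ s : ℝ, ‖P.eval (s : ℂ)‖ * Real.exp (-s ^ 2) ≤ B := by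
  induction P using Polynomial.induction_on' with
  | add p q hp hq =>
    obtain ⟨a, ha⟩ := hp
    obtain ⟨b, hb⟩ := hq
    refine ⟨a + b, fun s => ?_⟩
    rw [eval_add]
    nlinarith [ha s, hb s, norm_add_le (p.eval (s : ℂ)) (q.eval (s : ℂ)), Real.exp_pos (-s ^ 2)]
  | monomial n a =>
    refine ⟨‖a‖ * (n.factorial * Real.exp 1), fun s => ?_⟩
    rw [eval_monomial, norm_mul, norm_pow, Complex.norm_real, Real.norm_eq_abs, mul_assoc]
    exact mul_le_mul_of_nonneg_left (pow_mul_exp_neg_sq_le n s) (norm_nonneg _)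

theorem norm_flat_of_ne (P : ℂ[X]) {y : ℝ} (hy : y ≠ 0) :
    ‖flat P y‖ = ‖P.eval ((y⁻¹ : ℝ) : ℂ)‖ * Real.exp (-(y⁻¹) ^ 2) := by
  rw [flat, if_neg hy, norm_mul, norm_cexp_flat]

theorem exists_bound_flat (P : ℂ[X]) : ∃ B, 0 ≤ B ∧ ∀ y, ‖flat P y‖ ≤ B := by
  obtain ⟨B, hB⟩ := exists_bound_eval_mul_exp P
  have hB0 : 0 ≤ B := le_trans (by positivity) (hB 0)
  refine ⟨B, hB0, fun y => ?_⟩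
  by_cases hy : y = 0
  · simpa [hy] using hB0
  · rw [norm_flat_of_ne P hy]; exact hB _

/-- Dividing a flat function by y only changes its polynomial. Hence boundedness of all flat
functions already gives their continuity and differentiability at 0. -/
theorem flat_X_mul (P : ℂ[X]) (y : ℝ) : (y : ℂ) * flat (X * P) y = flat P y := by
  by_cases hy : y = 0
  · simp [hy]
  · have : (y : ℂ) ≠ 0 := by exact_mod_cast hy
    simp only [flat, if_neg hy, eval_mul, eval_X]
    push_cast
    field_simp

theorem tendsto_flat_zero (P : ℂ[X]) : Tendsto (flat P) (𝓝 0) (𝓝 0) := by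
  obtain ⟨B, -, hB⟩ := exists_bound_flat (X * P)
  refine squeeze_zero_norm (a := fun y : ℝ => |y| * B) (fun y => ?_) ?_
  · rw [← flat_X_mul, norm_mul, Complex.norm_real, Real.norm_eq_abs]
    exact mul_le_mul_of_nonneg_left (hB y) (abs_nonneg y)
  · have : Continuous fun y : ℝ => |y| * B := by fun_prop
    simpa using this.tendsto 0

/-- The family of flat functions is closed under differentiation; at 0 the difference quotient is
the flat function of X * P, which tends to 0. Smoothness follows by induction over the whole family.
-/
theorem hasDerivAt_flat (P : ℂ[X]) (y : ℝ) : HasDerivAt (flat P) (flat (flatDeriv P) y) y := by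
  by_cases hy : y = 0
  · subst hy
    rw [flat_zero, hasDerivAt_iff_tendsto_slope]
    refine ((tendsto_flat_zero (X * P)).mono_left inf_le_left).congr' ?_
    filter_upwards [self_mem_nhdsWithin] with x hx
    have hx : x ≠ 0 := hx
    have : (x : ℂ) ≠ 0 := by exact_mod_cast hx
    rw [slope_def_module, flat_zero, sub_zero, sub_zero, ← flat_X_mul P, Complex.real_smul]
    push_cast
    field_simp
  · have hs : HasDerivAt (fun y : ℝ => ((y⁻¹ : ℝ) : ℂ)) (((-(y ^ 2)⁻¹ : ℝ)) : ℂ) y :=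
      (hasDerivAt_inv hy).ofReal_comp
    have hP := (P.hasDerivAt ((y⁻¹ : ℝ) : ℂ)).comp y hs
    have hE := (((hs.pow 2).neg).add (hs.mul_const Complex.I)).cexp
    have hm : HasDerivAt (fun y : ℝ => P.eval ((y⁻¹ : ℝ) : ℂ) *
        Complex.exp (-((y⁻¹ : ℝ) : ℂ) ^ 2 + ((y⁻¹ : ℝ) : ℂ) * Complex.I)) _ y := hP.mul hE
    refine (hm.congr_of_eventuallyEq ?_).congr_deriv ?_
    · filter_upwards [isOpen_ne.mem_nhds hy] with z hz
      exact if_neg hz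
    have hy' : (y : ℂ) ≠ 0 := by exact_mod_cast hy
    simp only [flat, if_neg hy, flatDeriv, eval_mul, eval_pow, eval_X, eval_sub, eval_C,
      eval_ofNat, Pi.add_apply, Pi.neg_apply, Pi.pow_apply, Function.comp_apply]
    push_cast
    field_simp
    ring

theorem contDiff_flat (P : ℂ[X]) : ContDiff ℝ ∞ (flat P) := by
  rw [contDiff_infty]
  intro n
  induction n generalizing P with
  | zero =>
    exact contDiff_zero.2 (continuous_iff_continuousAt.2 fun y =>
      (hasDerivAt_flat P y).continuousAt)
  | succ n ih =>
    push_cast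
    rw [contDiff_succ_iff_deriv]
    refine ⟨fun y => (hasDerivAt_flat P y).differentiableAt, by simp, ?_⟩
    rw [show deriv (flat P) = flat (flatDeriv P) from funext fun y => (hasDerivAt_flat P y).deriv]
    exact ih _

/-- `ζ(y) = exp(-1/y² + i/y)`. -/
noncomputable def zeta : ℝ → ℂ := flat 1

/-- The derivative of `ζ`. -/
noncomputable def zeta' : ℝ → ℂ := flat (flatDeriv 1)

theorem contDiff_zeta : ContDiff ℝ ∞ zeta := contDiff_flat _
theorem contDiff_zeta' : ContDiff ℝ ∞ zeta' := contDiff_flat _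
theorem hasDerivAt_zeta (y : ℝ) : HasDerivAt zeta (zeta' y) y := hasDerivAt_flat _ _
@[simp] theorem zeta_zero : zeta 0 = 0 := flat_zero _
@[simp] theorem zeta'_zero : zeta' 0 = 0 := flat_zero _

theorem zeta_of_ne {y : ℝ} (hy : y ≠ 0) : zeta y =
    (Real.exp (-1 / y ^ 2) * Real.cos (1 / y) : ℝ) +
    (Real.exp (-1 / y ^ 2) * Real.sin (1 / y) : ℝ) * Complex.I := by
  simp only [zeta, flat, if_neg hy, eval_one, one_mul, Complex.exp_add, Complex.exp_mul_I]
  push_cast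
  rw [show -((y : ℂ)⁻¹) ^ 2 = -1 / (y : ℂ) ^ 2 by field_simp, one_div]
  ring

theorem norm_zeta {y : ℝ} (hy : y ≠ 0) : ‖zeta y‖ = Real.exp (-1 / y ^ 2) := by
  rw [zeta, norm_flat_of_ne _ hy]
  simp [neg_div]

/-- The logarithmic derivative of exp(-1/y² + i/y) is 2/y³ - i/y². Clearing denominators makes the
identity valid at 0 as well. -/
theorem zeta'_eq (y : ℝ) : (y : ℂ) ^ 3 * zeta' y = (2 - y * Complex.I) * zeta y := by
  by_cases hy : y = 0
  · simp [hy]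
  · have hy' : (y : ℂ) ≠ 0 := by exact_mod_cast hy
    simp only [zeta', zeta, flat, if_neg hy, flatDeriv, derivative_one, eval_mul, eval_pow, eval_X,
      eval_sub, eval_C, eval_ofNat, eval_one, eval_zero]
    push_cast
    field_simp
    ring

/-- V is minus the imaginary part of e^{ix} ζ(y), so every property of V reduces to one of ζ.
Likewise `Vx` is minus the real part of e^{ix} ζ, and `Vy` minus the imaginary part of e^{ix} ζ'. -/
theorem V_eq (x y : ℝ) : V x y = -(Real.sin x * (zeta y).re + Real.cos x * (zeta y).im) := by
  unfold V
  split_ifs with hy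
  · simp [hy]
  · rw [zeta_of_ne hy, Real.sin_add]
    simp only [Complex.add_re, Complex.ofReal_re, Complex.re_ofReal_mul, Complex.I_re,
      Complex.add_im, Complex.ofReal_im, Complex.im_ofReal_mul, Complex.I_im]
    ring

/-- The partial derivative of `V` in `x`. -/
noncomputable def Vx (x y : ℝ) : ℝ := -(Real.cos x * (zeta y).re - Real.sin x * (zeta y).im)

/-- The partial derivative of `V` in `y`. -/
noncomputable def Vy (x y : ℝ) : ℝ := -(Real.sin x * (zeta' y).re + Real.cos x * (zeta' y).im)

theorem hasDerivAt_zeta_re (y : ℝ) : HasDerivAt (fun y => (zeta y).re) (zeta' y).re y :=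
  (Complex.reCLM.hasFDerivAt.comp_hasDerivAt y (hasDerivAt_zeta y))

theorem hasDerivAt_zeta_im (y : ℝ) : HasDerivAt (fun y => (zeta y).im) (zeta' y).im y :=
  (Complex.imCLM.hasFDerivAt.comp_hasDerivAt y (hasDerivAt_zeta y))

theorem hasDerivAt_V_left (x y : ℝ) : HasDerivAt (fun s => V s y) (Vx x y) x := by
  simp only [V_eq]
  have := (((Real.hasDerivAt_sin x).mul_const (zeta y).re).add
    ((Real.hasDerivAt_cos x).mul_const (zeta y).im)).neg
  convert! this using 1
  unfold Vx; ring

theorem hasDerivAt_V_right (x y : ℝ) : HasDerivAt (fun s => V x s) (Vy x y) y := by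
  simp only [V_eq]
  exact (((hasDerivAt_zeta_re y).const_mul _).add ((hasDerivAt_zeta_im y).const_mul _)).neg

theorem hasDerivAt_V_comp {x y : ℝ → ℝ} {x' y' t : ℝ} (hx : HasDerivAt x x' t)
    (hy : HasDerivAt y y' t) :
    HasDerivAt (fun t => V (x t) (y t)) (Vx (x t) (y t) * x' + Vy (x t) (y t) * y') t := by
  simp only [V_eq]
  have := ((hx.sin.mul ((hasDerivAt_zeta_re (y t)).comp t hy)).add
    (hx.cos.mul ((hasDerivAt_zeta_im (y t)).comp t hy))).neg
  convert! this using 1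
  simp only [Vx, Vy, Function.comp]; ring

/-- Multiply `zeta'_eq` by e^{ix} and take imaginary parts. For bounded y, a small gradient thus
forces V to be small. -/
theorem two_mul_V (x y : ℝ) : 2 * V x y = y ^ 3 * Vy x y + y * Vx x y := by
  have h := zeta'_eq y
  have hre := congrArg Complex.re h
  have him := congrArg Complex.im h
  rw [← Complex.ofReal_pow] at hre him
  simp [-Complex.ofReal_pow] at hre him
  rw [V_eq, Vx, Vy]
  linear_combination Real.sin x * hre + Real.cos x * him

/-- Both are parts of the one complex number -e^{ix} ζ(y). So small V and `Vx` force y to be small,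
whatever x is. -/
theorem V_sq_add_Vx_sq (x : ℝ) (y : ℝ) : V x y ^ 2 + Vx x y ^ 2 = ‖zeta y‖ ^ 2 := by
  rw [V_eq, Vx, ← Complex.normSq_eq_norm_sq, Complex.normSq_apply]
  linear_combination ((zeta y).re ^ 2 + (zeta y).im ^ 2) * Real.sin_sq_add_cos_sq x

theorem eq_zero_of_grad_eq_zero {x y : ℝ} (hx : Vx x y = 0) (hy : Vy x y = 0) : y = 0 := by
  by_contra h
  have h1 := two_mul_V x y
  have h2 := V_sq_add_Vx_sq x y
  rw [hx, hy] at h1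
  have h3 : V x y = 0 := by linarith
  rw [h3, hx, norm_zeta h] at h2
  have := Real.exp_pos (-1 / y ^ 2)
  nlinarith

@[simp] theorem V_zero (x : ℝ) : V x 0 = 0 := by simp [V]

theorem abs_V_le_one (x y : ℝ) : |V x y| ≤ 1 := by
  by_cases hy : y = 0
  · simp [hy]
  · rw [V, if_neg hy, abs_neg, abs_mul, abs_of_pos (Real.exp_pos _)]
    refine mul_le_one₀ (Real.exp_le_one_iff.2 ?_) (abs_nonneg _) (Real.abs_sin_le_one _)
    exact div_nonpos_of_nonpos_of_nonneg (by norm_num) (by positivity)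

theorem contDiff_V : ContDiff ℝ ∞ (fun p : ℝ × ℝ => V p.1 p.2) := by
  simp only [V_eq]
  have h := contDiff_zeta
  have h1 : ContDiff ℝ ∞ fun p : ℝ × ℝ => (zeta p.2).re :=
    Complex.reCLM.contDiff.comp (h.comp contDiff_snd)
  have h2 : ContDiff ℝ ∞ fun p : ℝ × ℝ => (zeta p.2).im :=
    Complex.imCLM.contDiff.comp (h.comp contDiff_snd)
  fun_prop

theorem contDiff_Vx : ContDiff ℝ ∞ (fun p : ℝ × ℝ => Vx p.1 p.2) := by
  unfold Vx
  have h := contDiff_zeta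
  have h1 : ContDiff ℝ ∞ fun p : ℝ × ℝ => (zeta p.2).re :=
    Complex.reCLM.contDiff.comp (h.comp contDiff_snd)
  have h2 : ContDiff ℝ ∞ fun p : ℝ × ℝ => (zeta p.2).im :=
    Complex.imCLM.contDiff.comp (h.comp contDiff_snd)
  fun_prop

theorem contDiff_Vy : ContDiff ℝ ∞ (fun p : ℝ × ℝ => Vy p.1 p.2) := by
  unfold Vy
  have h := contDiff_zeta'
  have h1 : ContDiff ℝ ∞ fun p : ℝ × ℝ => (zeta' p.2).re :=
    Complex.reCLM.contDiff.comp (h.comp contDiff_snd)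
  have h2 : ContDiff ℝ ∞ fun p : ℝ × ℝ => (zeta' p.2).im :=
    Complex.imCLM.contDiff.comp (h.comp contDiff_snd)
  fun_prop

theorem sub_le_of_hasDerivAt_le {f f' : ℝ → ℝ} {B : ℝ} (hf : ∀ x, HasDerivAt f (f' x) x)
    (hB : ∀ x, |f' x| ≤ B) (a b : ℝ) : |f a - f b| ≤ B * |a - b| := by
  have := Convex.norm_image_sub_le_of_norm_hasDerivWithin_le (s := univ) (f := f) (f' := f')
    (fun x _ => (hf x).hasDerivWithinAt) (fun x _ => hB x) convex_univ (mem_univ b) (mem_univ a)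
  simpa using this

/-- These are the imaginary and real parts of e^{ix} z; the factor 2 is crude but sufficient. -/
theorem trig_comb_le {z : ℂ} {B : ℝ} (hz : ‖z‖ ≤ B) (x : ℝ) :
    |Real.sin x * z.re + Real.cos x * z.im| ≤ 2 * B ∧
    |Real.cos x * z.re - Real.sin x * z.im| ≤ 2 * B := by
  have h1 := (Complex.abs_re_le_norm z).trans hz
  have h2 := (Complex.abs_im_le_norm z).trans hz
  have hs := Real.abs_sin_le_one x
  have hc := Real.abs_cos_le_one x
  have key : ∀ a b : ℝ, |a| ≤ 1 → |b| ≤ B → |a * b| ≤ B := fun a b ha hb => by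
    rw [abs_mul]; nlinarith [abs_nonneg a, abs_nonneg b]
  refine ⟨(abs_add_le _ _).trans ?_, (abs_sub _ _).trans ?_⟩
  · linarith [key _ _ hs h1, key _ _ hc h2]
  · linarith [key _ _ hc h1, key _ _ hs h2]

/-- The gradient of `V` is globally Lipschitz. -/
theorem exists_lipschitz_grad : ∃ K : ℝ, 0 < K ∧ ∀ x y a b : ℝ,
    |Vx x y - Vx a b| ≤ K * (|x - a| + |y - b|) ∧ |Vy x y - Vy a b| ≤ K * (|x - a| + |y - b|) := by
  obtain ⟨B0, h00, h0⟩ := exists_bound_flat 1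
  obtain ⟨B1, h10, h1⟩ := exists_bound_flat (flatDeriv 1)
  obtain ⟨B2, h20, h2⟩ := exists_bound_flat (flatDeriv (flatDeriv 1))
  have d2re : ∀ y, HasDerivAt (fun y => (zeta' y).re) (flat (flatDeriv (flatDeriv 1)) y).re y :=
    fun y => Complex.reCLM.hasFDerivAt.comp_hasDerivAt y (hasDerivAt_flat _ y)
  have d2im : ∀ y, HasDerivAt (fun y => (zeta' y).im) (flat (flatDeriv (flatDeriv 1)) y).im y :=
    fun y => Complex.imCLM.hasFDerivAt.comp_hasDerivAt y (hasDerivAt_flat _ y)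
  -- Up to sign, the second derivatives of V are real or imaginary parts of e^{ix} times ζ, ζ' or
  -- ζ'', so all are bounded. The variables are changed one at a time.
  have e1 : ∀ x y a : ℝ, |Vx x y - Vx a y| ≤ 2 * B0 * |x - a| := fun x y a => by
    refine sub_le_of_hasDerivAt_le (f := fun x => Vx x y)
      (f' := fun x => Real.sin x * (zeta y).re + Real.cos x * (zeta y).im) (fun x => ?_)
      (fun x => (trig_comb_le (h0 y) x).1) x a
    have := (((Real.hasDerivAt_cos x).mul_const (zeta y).re).sub
      ((Real.hasDerivAt_sin x).mul_const (zeta y).im)).neg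
    convert! this using 1; ring
  have e2 : ∀ x y b : ℝ, |Vx x y - Vx x b| ≤ 2 * B1 * |y - b| := fun x y b => by
    refine sub_le_of_hasDerivAt_le (f := fun y => Vx x y)
      (f' := fun y => -(Real.cos x * (zeta' y).re - Real.sin x * (zeta' y).im)) (fun y => ?_)
      (fun y => by rw [abs_neg]; exact (trig_comb_le (h1 y) x).2) y b
    exact (((hasDerivAt_zeta_re y).const_mul _).sub ((hasDerivAt_zeta_im y).const_mul _)).neg
  have e3 : ∀ x y a : ℝ, |Vy x y - Vy a y| ≤ 2 * B1 * |x - a| := fun x y a => by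
    refine sub_le_of_hasDerivAt_le (f := fun x => Vy x y)
      (f' := fun x => -(Real.cos x * (zeta' y).re - Real.sin x * (zeta' y).im)) (fun x => ?_)
      (fun x => by rw [abs_neg]; exact (trig_comb_le (h1 y) x).2) x a
    have := (((Real.hasDerivAt_sin x).mul_const (zeta' y).re).add
      ((Real.hasDerivAt_cos x).mul_const (zeta' y).im)).neg
    convert! this using 1; ring
  have e4 : ∀ x y b : ℝ, |Vy x y - Vy x b| ≤ 2 * B2 * |y - b| := fun x y b => by
    refine sub_le_of_hasDerivAt_le (f := fun y => Vy x y) (fun y =>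
      (((d2re y).const_mul (Real.sin x)).add ((d2im y).const_mul (Real.cos x))).neg)
      (fun y => by rw [abs_neg]; exact (trig_comb_le (h2 y) x).1) y b
  refine ⟨2 * B0 + 2 * B1 + 2 * B2 + 1, by positivity, fun x y a b => ⟨?_, ?_⟩⟩
  · have := abs_sub_le (Vx x y) (Vx a y) (Vx a b)
    nlinarith [e1 x y a, e2 a y b, abs_nonneg (x - a), abs_nonneg (y - b)]
  · have := abs_sub_le (Vy x y) (Vy a y) (Vy a b)
    nlinarith [e3 x y a, e4 a y b, abs_nonneg (x - a), abs_nonneg (y - b)]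

end Potential

/-! ### Global flows of Lipschitz vector fields. -/

section GlobalFlow

open scoped NNReal

variable {X : Type*} [NormedAddCommGroup X] [NormedSpace ℝ X]

/-- The existence time does not depend on the initial point, which is what permits extension to the
whole line. On the ball of radius ‖f x‖ + 1 the speed is at most ‖f x‖ + K(‖f x‖ + 1) ≤ (K + 1)(‖f
x‖ + 1), so the ball is not left before time 1/(K + 1). -/
theorem exists_local_solution [CompleteSpace X] {f : X → X} {K : ℝ≥0}
    (hf : LipschitzWith K f) (x : X) :
    ∃ γ : ℝ → X, γ 0 = x ∧ ∀ t ∈ Ioo (-(1 / (K + 1) : ℝ)) (1 / (K + 1)),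
      HasDerivAt γ (f (γ t)) t := by
  set ε : ℝ := 1 / (K + 1) with hε
  have hε0 : 0 < ε := by positivity
  have hP : IsPicardLindelof (fun _ => f) (tmin := -ε) (tmax := ε) ⟨0, by constructor <;> linarith⟩
      x (‖f x‖₊ + 1) 0 (‖f x‖₊ + K * (‖f x‖₊ + 1)) K := by
    refine IsPicardLindelof.of_time_independent (fun y hy => ?_) hf.lipschitzOnWith ?_
    · have h1 := hf.norm_sub_le y x
      have h2 : ‖y - x‖ ≤ ‖f x‖ + 1 := by simpa [dist_eq_norm] using hy
      have h3 : ‖f y‖ ≤ ‖f x‖ + ‖f y - f x‖ := by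
        simpa using norm_add_le (f x) (f y - f x)
      have h4 : (K : ℝ) * ‖y - x‖ ≤ K * (‖f x‖ + 1) := by gcongr
      push_cast
      linarith
    · simp only [sub_zero, zero_sub, neg_neg, max_self]
      push_cast
      rw [sub_zero, hε, mul_one_div, div_le_iff₀ (by positivity)]
      nlinarith [norm_nonneg (f x), K.2]
  obtain ⟨γ, h0, h⟩ := hP.exists_eq_forall_mem_Icc_hasDerivWithinAt₀
  exact ⟨γ, h0, fun t ht => (h t (Ioo_subset_Icc_self ht)).hasDerivAt (Icc_mem_nhds ht.1 ht.2)⟩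

/-- A globally Lipschitz `C¹` vector field has global integral curves. -/
theorem exists_global_solution [CompleteSpace X] {f : X → X} {K : ℝ≥0} (hf : LipschitzWith K f)
    (hc : ContDiff ℝ 1 f) (x : X) :
    ∃ γ : ℝ → X, γ 0 = x ∧ ∀ t, HasDerivAt γ (f (γ t)) t := by
  have key := exists_isMIntegralCurve_of_isMIntegralCurveOn (I := 𝓘(ℝ, X)) (M := X) (v := f)
    (fun x => contMDiffAt_vectorSpace_iff_contDiffAt.2 hc.contDiffAt)
    (ε := 1 / (K + 1)) (by positivity) (fun x => by
      obtain ⟨γ, h0, h⟩ := exists_local_solution hf x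
      exact ⟨γ, h0, fun t ht => (h t ht).hasFDerivAt.hasMFDerivAt.hasMFDerivWithinAt⟩) x
  obtain ⟨γ, h0, h⟩ := key
  refine ⟨γ, h0, fun t => ?_⟩
  have h' : HasFDerivAt γ (ContinuousLinearMap.smulRight (1 : ℝ →L[ℝ] ℝ) (f (γ t)) : ℝ →L[ℝ] X) t :=
    (h t).hasFDerivAt
  simpa using h'.hasDerivAt

theorem dist_solution_le {f : X → X} {K : ℝ≥0} (hf : LipschitzWith K f) {γ δ : ℝ → X}
    (hγ : ∀ t, HasDerivAt γ (f (γ t)) t) (hδ : ∀ t, HasDerivAt δ (f (δ t)) t) {t : ℝ} (ht : 0 ≤ t) :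
    dist (γ t) (δ t) ≤ dist (γ 0) (δ 0) * Real.exp (K * t) := by
  have := dist_le_of_trajectories_ODE (v := fun _ => f) (fun _ => hf) (a := 0) (b := t)
    (fun s _ => (hγ s).continuousAt.continuousWithinAt) (fun s _ => (hγ s).hasDerivWithinAt)
    (fun s _ => (hδ s).continuousAt.continuousWithinAt) (fun s _ => (hδ s).hasDerivWithinAt)
    le_rfl t ⟨ht, le_rfl⟩
  simpa using this

theorem dist_solution_le_abs {f : X → X} {K : ℝ≥0} (hf : LipschitzWith K f) {γ δ : ℝ → X}
    (hγ : ∀ t, HasDerivAt γ (f (γ t)) t) (hδ : ∀ t, HasDerivAt δ (f (δ t)) t) (t : ℝ) :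
    dist (γ t) (δ t) ≤ dist (γ 0) (δ 0) * Real.exp (K * |t|) := by
  rcases le_total 0 t with ht | ht
  · rw [abs_of_nonneg ht]; exact dist_solution_le hf hγ hδ ht
  · rw [abs_of_nonpos ht]
    have hr : ∀ {η : ℝ → X}, (∀ t, HasDerivAt η (f (η t)) t) →
        ∀ t, HasDerivAt (fun s => η (-s)) ((fun x => -f x) (η (-t))) t := fun h t => by
      simpa [Function.comp_def] using (h (-t)).scomp t (hasDerivAt_neg t)
    have := dist_solution_le (f := fun x => -f x) (K := K) hf.neg (hr hγ) (hr hδ)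
      (t := -t) (by linarith)
    simpa using this

theorem solution_unique {f : X → X} {K : ℝ≥0} (hf : LipschitzWith K f) {γ δ : ℝ → X}
    (hγ : ∀ t, HasDerivAt γ (f (γ t)) t) (hδ : ∀ t, HasDerivAt δ (f (δ t)) t) {t₀ : ℝ}
    (h : γ t₀ = δ t₀) : γ = δ :=
  ODE_solution_unique_univ (v := fun _ => f) (s := fun _ => univ) (fun _ => hf.lipschitzOnWith)
    (fun t => ⟨hγ t, trivial⟩) (fun t => ⟨hδ t, trivial⟩) h

theorem contDiff_of_solution {f : X → X} (hf : ContDiff ℝ ∞ f) {γ : ℝ → X}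
    (hγ : ∀ t, HasDerivAt γ (f (γ t)) t) : ContDiff ℝ ∞ γ := by
  rw [contDiff_infty]
  intro n
  induction n with
  | zero =>
    exact contDiff_zero.2 (continuous_iff_continuousAt.2 fun t => (hγ t).continuousAt)
  | succ n ih =>
    push_cast
    rw [contDiff_succ_iff_deriv]
    refine ⟨fun t => (hγ t).differentiableAt, by simp, ?_⟩
    rw [show deriv γ = f ∘ γ from funext fun t => (hγ t).deriv]
    exact (hf.of_le (by exact_mod_cast le_top)).comp ih

end GlobalFlow

/-! ### Dissipative dynamics and the spiralling ancient trajectory. -/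

/-- If a function converges and its derivative is Lipschitz near infinity, then the derivative
tends to zero. -/
theorem tendsto_deriv_zero_of_tendsto {l : Filter ℝ} (hl : ∀ h : ℝ, Tendsto (fun t => t + h) l l)
    {f f' : ℝ → ℝ} (hf : ∀ t, HasDerivAt f (f' t) t) {K L : ℝ} (hK0 : 0 ≤ K)
    (hK : ∀ᶠ t in l, ∀ h ∈ Icc (0 : ℝ) 1, |f' (t + h) - f' t| ≤ K * h)
    (hL : Tendsto f l (𝓝 L)) : Tendsto f' l (𝓝 0) := by
  rw [Metric.tendsto_nhds]
  intro ε hε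
  set h : ℝ := min 1 (ε / (2 * (K + 1))) with hh
  have h0 : 0 < h := lt_min one_pos (by positivity)
  have h1 : h ≤ 1 := min_le_left _ _
  have h2 : K * h < ε / 2 := by
    have : h * (2 * (K + 1)) ≤ ε := by
      rw [← le_div_iff₀ (by positivity)]; exact min_le_right _ _
    nlinarith
  have hd : Tendsto (fun t => f (t + h) - f t) l (𝓝 0) := by
    simpa using (hL.comp (hl h)).sub hL
  filter_upwards [hK, (Metric.tendsto_nhds.1 hd) (h * (ε / 2)) (by positivity)] with t ht hdt
  rw [Real.dist_eq, sub_zero] at hdt ⊢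
  -- The derivative at some c in (t, t + h) equals the difference quotient, which is less than ε/2
  -- because f converges; h is so short that the derivative varies by less than ε/2 between t and c.
  obtain ⟨c, hc, hc'⟩ := exists_hasDerivAt_eq_slope f f' (show t < t + h by linarith)
    (fun s _ => (hf s).continuousAt.continuousWithinAt) (fun s _ => hf s)
  have h3 := ht (c - t) ⟨by linarith [hc.1], by linarith [hc.2]⟩
  rw [add_sub_cancel] at h3
  have h4 : K * (c - t) ≤ K * h := by
    apply mul_le_mul_of_nonneg_left _ hK0; linarith [hc.2]
  have h5 : |f' c| < ε / 2 := by
    rw [hc', add_sub_cancel_left, abs_div, abs_of_pos h0, div_lt_iff₀ h0]; linarith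
  have h6 : |f' t| ≤ |f' c| + |f' c - f' t| := by
    have := abs_sub_abs_le_abs_sub (f' t) (f' c)
    rw [abs_sub_comm] at this; linarith
  linarith

section Dynamics

open scoped NNReal

/-- The phase space of the damped system, with coordinates `(x, y, x', y')`. -/
abbrev Phase : Type := ℝ × ℝ × ℝ × ℝ

/-- The vector field of the first order system equivalent to `u'' + u' + ∇V(u) = 0`. -/
noncomputable def field (z : Phase) : Phase :=
  (z.2.2.1, z.2.2.2, -z.2.2.1 - Vx z.1 z.2.1, -z.2.2.2 - Vy z.1 z.2.1)

/-- The physical energy of a state. -/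
noncomputable def energy (z : Phase) : ℝ := (1 / 2) * (z.2.2.1 ^ 2 + z.2.2.2 ^ 2) + V z.1 z.2.1

/-- Global solutions of the first order system. -/
def IsSol (z : ℝ → Phase) : Prop := ∀ t, HasDerivAt z (field (z t)) t

theorem contDiff_field : ContDiff ℝ ∞ field := by
  have h0 : ContDiff ℝ ∞ fun z : Phase => (z.1, z.2.1) :=
    contDiff_fst.prodMk (contDiff_fst.comp contDiff_snd)
  have h1 : ContDiff ℝ ∞ fun z : Phase => Vx z.1 z.2.1 :=
    ContDiff.comp (g := fun p : ℝ × ℝ => Vx p.1 p.2) (f := fun z : Phase => (z.1, z.2.1))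
      contDiff_Vx h0
  have h2 : ContDiff ℝ ∞ fun z : Phase => Vy z.1 z.2.1 :=
    ContDiff.comp (g := fun p : ℝ × ℝ => Vy p.1 p.2) (f := fun z : Phase => (z.1, z.2.1))
      contDiff_Vy h0
  have h3 : ContDiff ℝ ∞ fun z : Phase => z.2.2.1 :=
    contDiff_fst.comp (contDiff_snd.comp contDiff_snd)
  have h4 : ContDiff ℝ ∞ fun z : Phase => z.2.2.2 :=
    contDiff_snd.comp (contDiff_snd.comp contDiff_snd)
  exact h3.prodMk (h4.prodMk ((h3.neg.sub h1).prodMk (h4.neg.sub h2)))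

theorem continuous_energy : Continuous energy := by
  have h1 : Continuous fun z : Phase => V z.1 z.2.1 :=
    contDiff_V.continuous.comp (continuous_fst.prodMk (continuous_fst.comp continuous_snd))
  unfold energy
  fun_prop

theorem Phase.abs_sub_le_dist (z w : Phase) : |z.1 - w.1| ≤ dist z w ∧ |z.2.1 - w.2.1| ≤ dist z w ∧
    |z.2.2.1 - w.2.2.1| ≤ dist z w ∧ |z.2.2.2 - w.2.2.2| ≤ dist z w := by
  simp [Prod.dist_eq, Real.dist_eq]

theorem Phase.dist_le {z w : Phase} {D : ℝ} (h1 : |z.1 - w.1| ≤ D) (h2 : |z.2.1 - w.2.1| ≤ D)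
    (h3 : |z.2.2.1 - w.2.2.1| ≤ D) (h4 : |z.2.2.2 - w.2.2.2| ≤ D) : dist z w ≤ D := by
  simp [Prod.dist_eq, Real.dist_eq, *]

theorem exists_lipschitz_field : ∃ K : ℝ≥0, LipschitzWith K field := by
  obtain ⟨K, hK0, hK⟩ := exists_lipschitz_grad
  refine ⟨⟨1 + 2 * K, by positivity⟩, LipschitzWith.of_dist_le_mul fun z w => ?_⟩
  obtain ⟨h1, h2, h3, h4⟩ := Phase.abs_sub_le_dist z w
  obtain ⟨g1, g2⟩ := hK z.1 z.2.1 w.1 w.2.1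
  have hd : 0 ≤ dist z w := dist_nonneg
  have hKd : 0 ≤ K * dist z w := by positivity
  have hK2 : K * (|z.1 - w.1| + |z.2.1 - w.2.1|) ≤ K * (2 * dist z w) := by gcongr; linarith
  change dist (field z) (field w) ≤ (1 + 2 * K) * dist z w
  apply Phase.dist_le <;> simp only [field]
  · linarith
  · linarith
  · rw [abs_le] at *; constructor <;> linarith [h3.1, h3.2, g1.1, g1.2]
  · rw [abs_le] at *; constructor <;> linarith [h4.1, h4.2, g2.1, g2.2]

namespace IsSol

variable {z : ℝ → Phase} (hz : IsSol z)
include hz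

theorem d1 (t : ℝ) : HasDerivAt (fun t => (z t).1) (z t).2.2.1 t :=
  (ContinuousLinearMap.fst ℝ ℝ (ℝ × ℝ × ℝ)).hasFDerivAt.comp_hasDerivAt t (hz t)

theorem d2 (t : ℝ) : HasDerivAt (fun t => (z t).2.1) (z t).2.2.2 t :=
  ((ContinuousLinearMap.fst ℝ ℝ (ℝ × ℝ)).comp
    (ContinuousLinearMap.snd ℝ ℝ (ℝ × ℝ × ℝ))).hasFDerivAt.comp_hasDerivAt t (hz t)

theorem d3 (t : ℝ) :
    HasDerivAt (fun t => (z t).2.2.1) (-(z t).2.2.1 - Vx (z t).1 (z t).2.1) t :=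
  ((ContinuousLinearMap.fst ℝ ℝ ℝ).comp ((ContinuousLinearMap.snd ℝ ℝ (ℝ × ℝ)).comp
    (ContinuousLinearMap.snd ℝ ℝ (ℝ × ℝ × ℝ)))).hasFDerivAt.comp_hasDerivAt t (hz t)

theorem d4 (t : ℝ) :
    HasDerivAt (fun t => (z t).2.2.2) (-(z t).2.2.2 - Vy (z t).1 (z t).2.1) t :=
  ((ContinuousLinearMap.snd ℝ ℝ ℝ).comp ((ContinuousLinearMap.snd ℝ ℝ (ℝ × ℝ)).comp
    (ContinuousLinearMap.snd ℝ ℝ (ℝ × ℝ × ℝ)))).hasFDerivAt.comp_hasDerivAt t (hz t)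

theorem continuous : Continuous z := continuous_iff_continuousAt.2 fun t => (hz t).continuousAt

theorem hasDerivAt_energy (t : ℝ) : HasDerivAt (fun t => energy (z t))
    (-((z t).2.2.1 ^ 2 + (z t).2.2.2 ^ 2)) t := by
  have := ((((hz.d3 t).pow 2).add ((hz.d4 t).pow 2)).const_mul (1 / 2)).add
    (hasDerivAt_V_comp (hz.d1 t) (hz.d2 t))
  refine this.congr_deriv ?_
  simp
  ring

theorem antitone_energy : Antitone fun t => energy (z t) :=
  antitone_of_hasDerivAt_nonpos hz.hasDerivAt_energy fun t => by
    simp only [Pi.zero_apply]; nlinarith [sq_nonneg (z t).2.2.1, sq_nonneg (z t).2.2.2]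

theorem shift (s : ℝ) : IsSol fun t => z (t + s) := fun t => (hz (t + s)).comp_add_const t s

/-- The field is 2π-periodic in x. This brings the states at the hitting times into the compact set
`box`. -/
theorem translate (n : ℤ) : IsSol fun t => ((z t).1 + n * (2 * Real.pi), (z t).2) := fun t => by
  have h : field ((z t).1 + n * (2 * Real.pi), (z t).2) = field (z t) := by
    simp [field, Vx, Vy, Real.sin_add_int_mul_two_pi, Real.cos_add_int_mul_two_pi]
  rw [h]
  exact ((hz.d1 t).add_const _).prodMk ((ContinuousLinearMap.snd ℝ ℝ
    (ℝ × ℝ × ℝ)).hasFDerivAt.comp_hasDerivAt t (hz t))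

end IsSol

/-- The circle y = 0 consists of equilibria, since ζ and ζ' vanish at 0. Nearby solutions are slow
by comparison with these, and no other solution meets them. -/
theorem isSol_const (a : ℝ) : IsSol fun _ => (a, 0, 0, 0) := fun t => by
  have : field (a, 0, 0, 0) = 0 := by simp [field, Vx, Vy]
  rw [this]; exact hasDerivAt_const _ _

theorem exists_isSol (w : Phase) : ∃ z, z 0 = w ∧ IsSol z := by
  obtain ⟨K, hK⟩ := exists_lipschitz_field
  exact exists_global_solution hK (contDiff_field.of_le (by exact_mod_cast le_top)) w

/-- Since V ≥ -1, nonpositive energy bounds the squared speed by 2. -/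
theorem velocity_le_of_energy {w : Phase} (h : energy w ≤ 0) : |w.2.2.1| ≤ 2 ∧ |w.2.2.2| ≤ 2 := by
  have h1 := (abs_le.1 (abs_V_le_one w.1 w.2.1)).1
  unfold energy at h
  constructor <;> apply abs_le_of_sq_le_sq _ (by norm_num) <;>
    nlinarith [sq_nonneg w.2.2.1, sq_nonneg w.2.2.2]

theorem exists_bound_grad : ∃ G, 0 ≤ G ∧ ∀ x y, |Vx x y| ≤ G ∧ |Vy x y| ≤ G := by
  obtain ⟨B0, h00, h0⟩ := exists_bound_flat 1
  obtain ⟨B1, h10, h1⟩ := exists_bound_flat (flatDeriv 1)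
  refine ⟨2 * B0 + 2 * B1, by positivity, fun x y => ⟨?_, ?_⟩⟩
  · have := (trig_comb_le (z := zeta y) (h0 y) x).2
    rw [Vx, abs_neg]; linarith
  · have := (trig_comb_le (z := zeta' y) (h1 y) x).1
    rw [Vy, abs_neg]; linarith

theorem abs_sub_le_of_hasDerivAt {f f' : ℝ → ℝ} (hf : ∀ t, HasDerivAt f (f' t) t) {B t h : ℝ}
    (hB : ∀ s, t ≤ s → |f' s| ≤ B) (hh : 0 ≤ h) : |f (t + h) - f t| ≤ B * h := by
  have := Convex.norm_image_sub_le_of_norm_hasDerivWithin_le (s := Ici t) (f := f) (f' := f')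
    (fun x _ => (hf x).hasDerivWithinAt) (fun x hx => hB x hx) (convex_Ici t)
    (show t ∈ Ici t from self_mem_Ici) (show t + h ∈ Ici t by simpa using hh)
  simpa [abs_of_nonneg hh] using this

/-- Where the energy converges, the velocity and the gradient of the potential tend to zero. -/
theorem IsSol.tendsto_of_energy {z : ℝ → Phase} (hz : IsSol z) {l : Filter ℝ}
    (hl : ∀ h : ℝ, Tendsto (fun t => t + h) l l) (hE : ∀ᶠ t in l, energy (z t) ≤ 0) {L : ℝ}
    (hL : Tendsto (fun t => energy (z t)) l (𝓝 L)) :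
    Tendsto (fun t => (z t).2.2.1) l (𝓝 0) ∧ Tendsto (fun t => (z t).2.2.2) l (𝓝 0) ∧
    Tendsto (fun t => Vx (z t).1 (z t).2.1) l (𝓝 0) ∧
    Tendsto (fun t => Vy (z t).1 (z t).2.1) l (𝓝 0) := by
  obtain ⟨G, hG0, hG⟩ := exists_bound_grad
  obtain ⟨K, hK0, hK⟩ := exists_lipschitz_grad
  have hv : ∀ t, energy (z t) ≤ 0 → ∀ s, t ≤ s → |(z s).2.2.1| ≤ 2 ∧ |(z s).2.2.2| ≤ 2 :=
    fun t ht s hs => velocity_le_of_energy ((hz.antitone_energy hs).trans ht)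
  have i1 : ∀ t, energy (z t) ≤ 0 → ∀ h, 0 ≤ h → |(z (t + h)).1 - (z t).1| ≤ 2 * h :=
    fun t ht h hh => abs_sub_le_of_hasDerivAt hz.d1 (fun s hs => (hv t ht s hs).1) hh
  have i2 : ∀ t, energy (z t) ≤ 0 → ∀ h, 0 ≤ h → |(z (t + h)).2.1 - (z t).2.1| ≤ 2 * h :=
    fun t ht h hh => abs_sub_le_of_hasDerivAt hz.d2 (fun s hs => (hv t ht s hs).2) hh
  have i3 : ∀ t, energy (z t) ≤ 0 → ∀ h, 0 ≤ h →
      |(z (t + h)).2.2.1 - (z t).2.2.1| ≤ (2 + G) * h := fun t ht h hh =>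
    abs_sub_le_of_hasDerivAt hz.d3 (fun s hs => by
      have h1 := (hv t ht s hs).1
      have h2 := (hG (z s).1 (z s).2.1).1
      rw [abs_le] at *; constructor <;> linarith [h1.1, h1.2, h2.1, h2.2]) hh
  have i4 : ∀ t, energy (z t) ≤ 0 → ∀ h, 0 ≤ h →
      |(z (t + h)).2.2.2 - (z t).2.2.2| ≤ (2 + G) * h := fun t ht h hh =>
    abs_sub_le_of_hasDerivAt hz.d4 (fun s hs => by
      have h1 := (hv t ht s hs).2
      have h2 := (hG (z s).1 (z s).2.1).2
      rw [abs_le] at *; constructor <;> linarith [h1.1, h1.2, h2.1, h2.2]) hh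
  have sqd : ∀ {a b c : ℝ}, |a| ≤ 2 → |b| ≤ 2 → |a - b| ≤ c → |a ^ 2 - b ^ 2| ≤ 4 * c := by
    intro a b c ha hb hc
    rw [sq_sub_sq, abs_mul]
    have := abs_add_le a b
    nlinarith [abs_nonneg (a + b), abs_nonneg (a - b)]
  -- The derivative of the energy is -|u'|², which is Lipschitz in time because velocities and
  -- accelerations are bounded: each squared component varies by at most 4(2 + G)h.
  have hE' := tendsto_deriv_zero_of_tendsto hl hz.hasDerivAt_energy
    (K := 8 * (2 + G)) (by positivity) (by
      filter_upwards [hE] with t ht h hh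
      have v0 := hv t ht t le_rfl
      have v1 := hv t ht (t + h) (by linarith [hh.1])
      have a1 := sqd v1.1 v0.1 (i3 t ht h hh.1)
      have a2 := sqd v1.2 v0.2 (i4 t ht h hh.1)
      rw [abs_le] at *; constructor <;> linarith [a1.1, a1.2, a2.1, a2.2]) hL
  have hS : Tendsto (fun t => (z t).2.2.1 ^ 2 + (z t).2.2.2 ^ 2) l (𝓝 0) := by
    simpa using hE'.neg
  have hroot : ∀ {f : ℝ → ℝ}, (∀ t, f t ^ 2 ≤ (z t).2.2.1 ^ 2 + (z t).2.2.2 ^ 2) →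
      Tendsto f l (𝓝 0) := fun {f} hf => by
    have h1 : Tendsto (fun t => f t ^ 2) l (𝓝 0) :=
      squeeze_zero (fun t => sq_nonneg _) hf hS
    have h2 := (Real.continuous_sqrt.tendsto 0).comp h1
    rw [Real.sqrt_zero] at h2
    exact (tendsto_zero_iff_abs_tendsto_zero f).2
      (h2.congr fun t => by simp [Real.sqrt_sq_eq_abs])
  have hp := hroot (f := fun t => (z t).2.2.1) fun t => by nlinarith [sq_nonneg (z t).2.2.2]
  have hq := hroot (f := fun t => (z t).2.2.2) fun t => by nlinarith [sq_nonneg (z t).2.2.1]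
  -- The same principle applies to the velocity, which now tends to 0: the acceleration -u' - ∇V(u)
  -- tends to 0, and hence so does ∇V(u).
  have hp' := tendsto_deriv_zero_of_tendsto hl hz.d3 (K := 2 + G + 4 * K) (by positivity) (by
      filter_upwards [hE] with t ht h hh
      have a := i3 t ht h hh.1
      have b := (hK (z (t + h)).1 (z (t + h)).2.1 (z t).1 (z t).2.1).1
      have c : K * (|(z (t + h)).1 - (z t).1| + |(z (t + h)).2.1 - (z t).2.1|) ≤ K * (4 * h) := by
        gcongr; linarith [i1 t ht h hh.1, i2 t ht h hh.1]
      replace b := b.trans c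
      rw [abs_le] at *; constructor <;> linarith [a.1, a.2, b.1, b.2]) hp
  have hq' := tendsto_deriv_zero_of_tendsto hl hz.d4 (K := 2 + G + 4 * K) (by positivity) (by
      filter_upwards [hE] with t ht h hh
      have a := i4 t ht h hh.1
      have b := (hK (z (t + h)).1 (z (t + h)).2.1 (z t).1 (z t).2.1).2
      have c : K * (|(z (t + h)).1 - (z t).1| + |(z (t + h)).2.1 - (z t).2.1|) ≤ K * (4 * h) := by
        gcongr; linarith [i1 t ht h hh.1, i2 t ht h hh.1]
      replace b := b.trans c
      rw [abs_le] at *; constructor <;> linarith [a.1, a.2, b.1, b.2]) hq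
  exact ⟨hp, hq, by simpa using (hp'.add hp).neg, by simpa using (hq'.add hq).neg⟩

theorem tendsto_V_of_grad {l : Filter ℝ} {x y : ℝ → ℝ} (hy : ∀ᶠ t in l, y t ∈ Icc (0 : ℝ) 1)
    (h1 : Tendsto (fun t => Vx (x t) (y t)) l (𝓝 0))
    (h2 : Tendsto (fun t => Vy (x t) (y t)) l (𝓝 0)) :
    Tendsto (fun t => V (x t) (y t)) l (𝓝 0) := by
  have h3 : Tendsto (fun t => |Vx (x t) (y t)| + |Vy (x t) (y t)|) l (𝓝 0) := by
    simpa using h1.abs.add h2.abs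
  refine squeeze_zero_norm' ?_ h3
  filter_upwards [hy] with t ht
  have h4 := two_mul_V (x t) (y t)
  have h5 : |y t ^ 3 * Vy (x t) (y t)| ≤ |Vy (x t) (y t)| := by
    rw [abs_mul, abs_of_nonneg (pow_nonneg ht.1 3)]
    exact mul_le_of_le_one_left (abs_nonneg _) (pow_le_one₀ ht.1 ht.2)
  have h6 : |y t * Vx (x t) (y t)| ≤ |Vx (x t) (y t)| := by
    rw [abs_mul, abs_of_nonneg ht.1]
    exact mul_le_of_le_one_left (abs_nonneg _) ht.2
  have h7 : |2 * V (x t) (y t)| ≤ |Vx (x t) (y t)| + |Vy (x t) (y t)| := by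
    rw [h4]; exact (abs_add_le _ _).trans (by linarith)
  rw [abs_mul, abs_two] at h7
  rw [Real.norm_eq_abs]
  linarith [abs_nonneg (V (x t) (y t))]

/-- V vanishes at y = 0, so a curve along which V is negative cannot cross that circle. -/
theorem pos_of_V_neg {x y : ℝ → ℝ} (hy : Continuous y) {s : Set ℝ} (hs : IsPreconnected s)
    (hV : ∀ t ∈ s, V (x t) (y t) < 0) {t₀ : ℝ} (ht₀ : t₀ ∈ s) (h0 : 0 < y t₀) {t : ℝ} (ht : t ∈ s) :
    0 < y t := by
  by_contra hn
  obtain ⟨c, hc, hc'⟩ := hs.intermediate_value ht ht₀ hy.continuousOn ⟨not_lt.1 hn, h0.le⟩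
  have := hV c hc
  rw [hc', V_zero] at this
  exact lt_irrefl _ this

/-- A solution that rests at time `0` at a point of height less than `1` and of negative potential
energy reaches height `1`. -/
theorem IsSol.exists_hit {z : ℝ → Phase} (hz : IsSol z) (hE : energy (z 0) < 0)
    (h0 : 0 < (z 0).2.1) : ∃ T, 0 ≤ T ∧ 1 ≤ (z T).2.1 := by
  by_contra! hn
  have hy : Continuous fun t => (z t).2.1 := hz.continuous.snd.fst
  have hEt : ∀ t, 0 ≤ t → energy (z t) ≤ energy (z 0) := fun t ht => hz.antitone_energy ht
  have hVE : ∀ t, V (z t).1 (z t).2.1 ≤ energy (z t) := fun t => by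
    unfold energy; nlinarith [sq_nonneg (z t).2.2.1, sq_nonneg (z t).2.2.2]
  have hpos : ∀ t, 0 ≤ t → 0 < (z t).2.1 := fun t ht =>
    pos_of_V_neg (x := fun t => (z t).1) hy (isPreconnected_Ici (a := 0))
      (fun t ht => by linarith [hVE t, hEt t ht]) (self_mem_Ici) h0 ht
  have hlim : Tendsto (fun t => energy (z t)) atTop (𝓝 (⨅ t, energy (z t))) := by
    refine tendsto_atTop_ciInf hz.antitone_energy ⟨-1, ?_⟩
    rintro _ ⟨t, rfl⟩
    linarith [hVE t, (abs_le.1 (abs_V_le_one (z t).1 (z t).2.1)).1]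
  obtain ⟨-, -, h1, h2⟩ := hz.tendsto_of_energy (l := atTop)
    (fun h => tendsto_atTop_add_const_right _ _ tendsto_id)
    (by filter_upwards [eventually_ge_atTop 0] with t ht; linarith [hEt t ht]) hlim
  -- The trajectory is trapped in 0 < y < 1 with gradient tending to 0, so V tends to 0. But V is at
  -- most the energy, which is at most its negative initial value.
  have h3 := tendsto_V_of_grad (by
    filter_upwards [eventually_ge_atTop 0] with t ht; exact ⟨(hpos t ht).le, (hn t ht).le⟩) h1 h2
  have h4 : (0 : ℝ) ≤ energy (z 0) := le_of_tendsto h3 (by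
    filter_upwards [eventually_ge_atTop 0] with t ht; linarith [hVE t, hEt t ht])
  linarith

/-- The compact set of states from which the limit trajectory is selected. -/
def box : Set Phase := Icc 0 (2 * Real.pi) ×ˢ ({1} : Set ℝ) ×ˢ Icc (-2) 2 ×ˢ Icc (-2) 2

theorem isCompact_box : IsCompact box :=
  isCompact_Icc.prod (isCompact_singleton.prod (isCompact_Icc.prod isCompact_Icc))

/-- A particle released at rest at height δ starts within δ of an equilibrium, so Gronwall bounds
its escape time to height 1 from below. Time is then shifted so that the escape happens at time 0.
-/
theorem exists_long_solution (n : ℕ) : ∃ z, IsSol z ∧ z 0 ∈ box ∧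
    ∀ s ∈ Icc (-(n : ℝ)) 0, (z s).2.1 ∈ Icc (0 : ℝ) 1 ∧ energy (z s) ≤ 0 := by
  obtain ⟨K, hK⟩ := exists_lipschitz_field
  -- With this δ, reaching height 1 at time T requires exp(K(T - n)) ≥ 2. The factor 1/2 also makes
  -- δ < 1.
  set δ : ℝ := Real.exp (-(K * n)) / 2 with hδ
  have hδ0 : 0 < δ := by positivity
  have hδ1 : δ < 1 := by
    have : Real.exp (-(K * n)) ≤ 1 := Real.exp_le_one_iff.2 (by simp; positivity)
    linarith
  -- The phase a + 1/δ is π/2, the bottom of the valley, so the initial energy is -exp(-1/δ²).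
  set a : ℝ := Real.pi / 2 - 1 / δ with ha
  obtain ⟨z, h0, hz⟩ := exists_isSol (a, δ, 0, 0)
  have hE : energy (z 0) < 0 := by
    rw [h0]
    simp [energy, V, hδ0.ne', ha]
    positivity
  have hy : Continuous fun t => (z t).2.1 := hz.continuous.snd.fst
  -- the first hitting time of height one
  obtain ⟨T, ⟨hT0, hT1⟩, hTmin⟩ : ∃ T, (0 ≤ T ∧ 1 ≤ (z T).2.1) ∧
      ∀ t, 0 ≤ t → 1 ≤ (z t).2.1 → T ≤ t := by
    have hcl : IsClosed {t | 0 ≤ t ∧ 1 ≤ (z t).2.1} :=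
      (isClosed_Ici (a := (0:ℝ))).inter (isClosed_le continuous_const hy)
    have hne : {t | 0 ≤ t ∧ 1 ≤ (z t).2.1}.Nonempty := hz.exists_hit hE (by rw [h0]; exact hδ0)
    have hbd : BddBelow {t | 0 ≤ t ∧ 1 ≤ (z t).2.1} := ⟨0, fun t ht => ht.1⟩
    exact ⟨_, hcl.csInf_mem hne hbd, fun t h1 h2 => csInf_le hbd ⟨h1, h2⟩⟩
  have hle : ∀ t, 0 ≤ t → t ≤ T → (z t).2.1 ≤ 1 := by
    intro t ht htT
    by_contra! hn
    obtain ⟨c, hc, hc'⟩ := intermediate_value_Ico ht hy.continuousOn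
      (show (1 : ℝ) ∈ Ico _ _ from ⟨by rw [h0]; exact hδ1.le, hn⟩)
    linarith [hTmin c hc.1 hc'.ge, hc.2]
  have hVE : ∀ t, V (z t).1 (z t).2.1 ≤ energy (z t) := fun t => by
    unfold energy; nlinarith [sq_nonneg (z t).2.2.1, sq_nonneg (z t).2.2.2]
  have hpos : ∀ t, 0 ≤ t → 0 < (z t).2.1 := fun t ht =>
    pos_of_V_neg (x := fun t => (z t).1) hy (isPreconnected_Ici (a := 0))
      (fun t ht => by linarith [hVE t, hz.antitone_energy (mem_Ici.1 ht)]) (self_mem_Ici)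
      (by rw [h0]; exact hδ0) ht
  have hTn : (n : ℝ) ≤ T := by
    have h1 := dist_solution_le hK hz (isSol_const a) hT0
    rw [h0] at h1
    have h2 : dist ((a, δ, 0, 0) : Phase) (a, 0, 0, 0) = δ := by
      simp [Prod.dist_eq, abs_of_pos hδ0, hδ0.le]
    have h3 := (Phase.abs_sub_le_dist (z T) (a, 0, 0, 0)).2.1
    simp only [sub_zero] at h3
    rw [h2] at h1
    have h4 : 1 ≤ δ * Real.exp (K * T) := by linarith [le_abs_self (z T).2.1]
    have h5 : δ * Real.exp (K * T) = Real.exp (K * T - K * n) / 2 := by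
      rw [hδ, sub_eq_add_neg, Real.exp_add]; ring
    have h6 : 1 < Real.exp (K * T - K * n) := by linarith
    have h7 := Real.one_lt_exp_iff.1 h6
    by_contra! hn
    nlinarith [K.2]
  set m : ℤ := ⌊(z T).1 / (2 * Real.pi)⌋ with hm
  refine ⟨fun t => ((z (t + T)).1 + (-m : ℤ) * (2 * Real.pi), (z (t + T)).2),
    (hz.shift T).translate (-m), ?_, ?_⟩
  · have hp := Real.two_pi_pos
    have hv := velocity_le_of_energy ((hz.antitone_energy hT0).trans hE.le)
    have f1 := Int.floor_le ((z T).1 / (2 * Real.pi))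
    have f2 := Int.lt_floor_add_one ((z T).1 / (2 * Real.pi))
    rw [← hm, le_div_iff₀ hp] at f1
    rw [← hm, div_lt_iff₀ hp] at f2
    simp only [zero_add, box]
    refine ⟨⟨?_, ?_⟩, le_antisymm (hle T hT0 le_rfl) hT1, abs_le.1 hv.1, abs_le.1 hv.2⟩
    · push_cast; linarith
    · push_cast; linarith
  · intro s hs
    have hs0 : 0 ≤ s + T := by linarith [hs.1]
    refine ⟨⟨(hpos _ hs0).le, hle _ hs0 (by linarith [hs.2])⟩, ?_⟩
    have : energy ((z (s + T)).1 + (-m : ℤ) * (2 * Real.pi), (z (s + T)).2)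
        = energy (z (s + T)) := by
      simp only [energy, V_eq, Real.sin_add_int_mul_two_pi, Real.cos_add_int_mul_two_pi]
    show energy _ ≤ 0
    rw [this]
    exact (hz.antitone_energy hs0).trans hE.le

/-- There is an ancient solution of nonpositive energy that stays in `0 ≤ y ≤ 1` and ends at
height `1`. -/
theorem exists_ancient_solution : ∃ z, IsSol z ∧ (z 0).2.1 = 1 ∧
    ∀ s ≤ 0, (z s).2.1 ∈ Icc (0 : ℝ) 1 ∧ energy (z s) ≤ 0 := by
  obtain ⟨K, hK⟩ := exists_lipschitz_field
  choose Φ hΦ0 hΦ using exists_isSol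
  have hcont : ∀ s, Continuous fun w => Φ w s := fun s => by
    have : LipschitzWith ⟨Real.exp (K * |s|), (Real.exp_pos _).le⟩ fun w => Φ w s :=
      LipschitzWith.of_dist_le_mul fun v w => by
        have := dist_solution_le_abs hK (hΦ v) (hΦ w) s
        rw [hΦ0, hΦ0, mul_comm] at this
        exact this
    exact this.continuous
  -- The states in `box` whose past on [-n, 0] stays in the region form a decreasing sequence of
  -- compact sets, closed by continuous dependence on initial data and nonempty by
  -- `exists_long_solution`. A common point generates the ancient solution.
  set S : ℕ → Set Phase := fun n => box ∩ ⋂ s ∈ Icc (-(n : ℝ)) 0,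
    {w | (Φ w s).2.1 ∈ Icc (0 : ℝ) 1 ∧ energy (Φ w s) ≤ 0} with hS
  have hcl : ∀ n, IsClosed (S n) := fun n =>
    isCompact_box.isClosed.inter (isClosed_biInter fun s _ =>
      (isClosed_Icc.preimage (hcont s).snd.fst).inter
        (isClosed_le (continuous_energy.comp (hcont s)) continuous_const))
  have hanti : ∀ n, S (n + 1) ⊆ S n := fun n =>
    inter_subset_inter_right _ (biInter_subset_biInter_left (Icc_subset_Icc_left (by
      push_cast; linarith)))
  have hne : ∀ n, (S n).Nonempty := fun n => by
    obtain ⟨z, hz, hb, h⟩ := exists_long_solution n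
    have : z = Φ (z 0) := solution_unique hK hz (hΦ _) (t₀ := 0) (hΦ0 _).symm
    refine ⟨z 0, hb, mem_iInter₂.2 fun s hs => ?_⟩
    show (Φ (z 0) s).2.1 ∈ Icc (0 : ℝ) 1 ∧ energy (Φ (z 0) s) ≤ 0
    rw [← this]
    exact h s hs
  obtain ⟨w, hw⟩ := IsCompact.nonempty_iInter_of_sequence_nonempty_isCompact_isClosed S hanti hne
    (isCompact_box.of_isClosed_subset (hcl 0) inter_subset_left) hcl
  rw [mem_iInter] at hw
  refine ⟨Φ w, hΦ w, ?_, fun s hs => ?_⟩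
  · rw [hΦ0]; exact (hw 0).1.2.1
  · obtain ⟨n, hn⟩ := exists_nat_ge (-s)
    exact mem_iInter₂.1 (hw n).2 s ⟨by linarith, hs⟩

/-- If the energy is constant on an interval, the velocity and then the gradient vanish there.
Critical points of V lie on y = 0, so by uniqueness the solution rests on that circle, contrary to
its height at time 0. -/
theorem energy_strictAnti {z : ℝ → Phase} (hz : IsSol z) (h0 : (z 0).2.1 = 1) :
    StrictAnti fun t => energy (z t) := by
  intro a b hab
  refine lt_of_le_of_ne (hz.antitone_energy hab.le) fun he => ?_
  have hconst : ∀ t ∈ Ioo a b, energy (z t) = energy (z a) := fun t ht =>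
    le_antisymm (hz.antitone_energy ht.1.le) (by
      have := hz.antitone_energy ht.2.le
      simp only at this he
      linarith)
  have hv : ∀ t ∈ Ioo a b, (z t).2.2.1 = 0 ∧ (z t).2.2.2 = 0 := fun t ht => by
    have h1 : HasDerivAt (fun t => energy (z t)) 0 t :=
      (hasDerivAt_const t (energy (z a))).congr_of_eventuallyEq (by
        filter_upwards [Ioo_mem_nhds ht.1 ht.2] with s hs using hconst s hs)
    have h2 := h1.unique (hz.hasDerivAt_energy t)
    constructor <;> nlinarith [sq_nonneg (z t).2.2.1, sq_nonneg (z t).2.2.2]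
  set c := (a + b) / 2
  have hc : c ∈ Ioo a b := ⟨by simp only [c]; linarith, by simp only [c]; linarith⟩
  have hnh := Ioo_mem_nhds hc.1 hc.2
  have g1 : -(z c).2.2.1 - Vx (z c).1 (z c).2.1 = 0 := (hz.d3 c).unique
    ((hasDerivAt_const c (0 : ℝ)).congr_of_eventuallyEq (by
      filter_upwards [hnh] with s hs using (hv s hs).1))
  have g2 : -(z c).2.2.2 - Vy (z c).1 (z c).2.1 = 0 := (hz.d4 c).unique
    ((hasDerivAt_const c (0 : ℝ)).congr_of_eventuallyEq (by
      filter_upwards [hnh] with s hs using (hv s hs).2))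
  obtain ⟨v1, v2⟩ := hv c hc
  have hy := eq_zero_of_grad_eq_zero (x := (z c).1) (y := (z c).2.1) (by linarith) (by linarith)
  obtain ⟨K, hK⟩ := exists_lipschitz_field
  have := solution_unique hK hz (isSol_const (z c).1) (t₀ := c)
    (Prod.ext rfl (Prod.ext hy (Prod.ext v1 v2)))
  rw [this] at h0
  simp at h0

/-- The trajectory that spirals towards the circle `y = 0` backwards in time. -/
theorem exists_spiral : ∃ x y : ℝ → ℝ, IsTrajectory x y ∧ (∀ t, physicalEnergy x y t < 0) ∧
    StrictAnti (physicalEnergy x y) ∧ (∀ t, |deriv x t| ≤ 2 ∧ |deriv y t| ≤ 2) ∧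
    (∀ t ≤ 0, y t ∈ Icc (0 : ℝ) 1) ∧ Tendsto y atBot (𝓝 0) ∧ Tendsto x atBot atBot ∧
    Tendsto (deriv x) atBot (𝓝 0) ∧ Tendsto (deriv y) atBot (𝓝 0) := by
  obtain ⟨z, hz, h0, h⟩ := exists_ancient_solution
  set x := fun t => (z t).1 with hx
  set y := fun t => (z t).2.1 with hy
  have dx : deriv x = fun t => (z t).2.2.1 := funext fun t => (hz.d1 t).deriv
  have dy : deriv y = fun t => (z t).2.2.2 := funext fun t => (hz.d2 t).deriv
  have hE : physicalEnergy x y = fun t => energy (z t) := by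
    funext t; simp only [physicalEnergy, dx, dy, energy, x, y]
  have hanti := energy_strictAnti hz h0
  have hneg : ∀ t, energy (z t) < 0 := fun t => by
    rcases le_total t 0 with ht | ht
    · exact (hanti (show t - 1 < t by linarith)).trans_le (h _ (by linarith)).2
    · exact (hanti (show -1 < t by linarith)).trans_le (h _ (by norm_num)).2
  have hzs := contDiff_of_solution contDiff_field hz
  have hlim : Tendsto (fun t => energy (z t)) atBot (𝓝 (⨆ t, energy (z t))) :=
    tendsto_atBot_ciSup hz.antitone_energy ⟨0, by rintro _ ⟨t, rfl⟩; exact (hneg t).le⟩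
  obtain ⟨hp, hq, h1, h2⟩ := hz.tendsto_of_energy (l := atBot)
    (fun h => tendsto_atBot_add_const_right _ _ tendsto_id)
    (Eventually.of_forall fun t => (hneg t).le) hlim
  have hyc : Continuous y := hz.continuous.snd.fst
  have hxc : Continuous x := hz.continuous.fst
  have hVneg : ∀ t, V (x t) (y t) < 0 := fun t => by
    have := hneg t
    unfold energy at this
    simp only [x, y]
    nlinarith [sq_nonneg (z t).2.2.1, sq_nonneg (z t).2.2.2]
  have hpos : ∀ t, 0 < y t := fun t => pos_of_V_neg hyc isPreconnected_univ
    (fun t _ => hVneg t) (mem_univ 0) (by simp [y, h0]) (mem_univ t)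
  have hev : ∀ᶠ t in atBot, y t ∈ Icc (0 : ℝ) 1 := by
    filter_upwards [eventually_le_atBot 0] with t ht using (h t ht).1
  have hV := tendsto_V_of_grad hev h1 h2
  -- This is V² + V_x². Since ‖ζ(y)‖ = exp(-1/y²) increases with y > 0, it forces y → 0.
  have hnorm : Tendsto (fun t => ‖zeta (y t)‖ ^ 2) atBot (𝓝 0) := by
    have := (hV.pow 2).add (h1.pow 2)
    simpa [V_sq_add_Vx_sq, y] using this
  have hy0 : Tendsto y atBot (𝓝 0) := by
    rw [Metric.tendsto_nhds]
    intro ε hε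
    filter_upwards [hnorm.eventually_lt_const
      (show (0:ℝ) < Real.exp (-1 / ε ^ 2) ^ 2 by positivity)] with t ht
    rw [Real.dist_eq, sub_zero, abs_of_pos (hpos t)]
    by_contra! hn
    rw [norm_zeta (hpos t).ne'] at ht
    have h3 := lt_of_pow_lt_pow_left₀ 2 (Real.exp_pos _).le ht
    rw [Real.exp_lt_exp, div_lt_div_iff₀ (pow_pos (hpos t) 2) (by positivity)] at h3
    have := pow_le_pow_left₀ hε.le hn 2
    linarith
  -- the phase is bounded
  set θ : ℝ → ℝ := fun t => x t + 1 / y t with hθ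
  have hθc : Continuous θ := hxc.add (continuous_const.div hyc fun t => (hpos t).ne')
  have hθs : ∀ t, Real.sin (θ t) ≠ 0 := fun t hs => by
    have := hVneg t
    rw [V, if_neg (hpos t).ne'] at this
    simp only [hθ] at hs
    rw [hs] at this
    simp at this
  -- The bound is the first multiple of π above θ(0). By continuity θ would have to cross it, and
  -- there V would vanish.
  have hθb : ∀ t, θ t < (⌊θ 0 / Real.pi⌋ + 1) * Real.pi := fun t => by
    by_contra! hn
    have f2 := Int.lt_floor_add_one (θ 0 / Real.pi)
    rw [div_lt_iff₀ Real.pi_pos] at f2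
    obtain ⟨c, hc⟩ := mem_range_of_exists_le_of_exists_ge hθc ⟨0, f2.le⟩ ⟨t, hn⟩
    refine hθs c ?_
    rw [hc]
    exact_mod_cast Real.sin_int_mul_pi (⌊θ 0 / Real.pi⌋ + 1)
  -- x = θ - 1/y with θ bounded above and 1/y → +∞.
  have hxb : Tendsto x atBot atBot := by
    have hinv : Tendsto (fun t => (y t)⁻¹) atBot atTop :=
      (tendsto_nhdsWithin_iff.2 ⟨hy0, Eventually.of_forall hpos⟩).inv_tendsto_nhdsGT_zero
    refine tendsto_atBot_mono (fun t => ?_)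
      (tendsto_atBot_add_const_left _ ((⌊θ 0 / Real.pi⌋ + 1) * Real.pi)
        (tendsto_neg_atTop_atBot.comp hinv))
    have := hθb t
    have h3 : θ t = x t + (y t)⁻¹ := by simp only [hθ, one_div]
    simp only [Function.comp]
    linarith
  refine ⟨x, y, ⟨contDiff_fst.comp hzs, contDiff_fst.comp (contDiff_snd.comp hzs), fun t => ?_,
    fun t => ?_⟩, by rwa [hE], by rwa [hE], fun t => ?_, fun t ht => (h t ht).1, hy0, hxb,
    by rwa [dx], by rwa [dy]⟩
  · rw [dx, (hz.d3 t).deriv, (hasDerivAt_V_left (x t) (y t)).deriv]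
    simp only [x, y]; ring
  · rw [dy, (hz.d4 t).deriv, (hasDerivAt_V_right (x t) (y t)).deriv]
    simp only [x, y]; ring
  · rw [dx, dy]; exact velocity_le_of_energy (hneg t).le

end Dynamics

/-! ### Sobolev functions on a ball with a point singularity. -/

section Sobolev

/-- In polar coordinates of ℝ³ the density r² cancels the singularity r⁻². -/
theorem integrableOn_ball_inv_norm_sq (R : ℝ) :
    IntegrableOn (fun p : R3 => (‖p‖⁻¹) ^ 2) (Metric.ball 0 R) := by
  rw [← integrable_indicator_iff Metric.isOpen_ball.measurableSet]
  have h : (Metric.ball (0 : R3) R).indicator (fun p => (‖p‖⁻¹) ^ 2) =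
      fun p => (Iio R).indicator (fun r : ℝ => (r⁻¹) ^ 2) ‖p‖ := by
    funext p; simp [indicator]
  rw [h, integrable_fun_norm_addHaar volume (f := (Iio R).indicator (fun r : ℝ => (r⁻¹) ^ 2))]
  have h2 : IntegrableOn ((Iio R).indicator (fun _ => (1 : ℝ))) (Ioi 0) := by
    rw [IntegrableOn, integrable_indicator_iff measurableSet_Iio, IntegrableOn,
      Measure.restrict_restrict measurableSet_Iio, inter_comm, Ioi_inter_Iio]
    exact integrableOn_const (by simp)
  refine h2.congr_fun (fun r hr => ?_) measurableSet_Ioi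
  have hr0 : r ≠ 0 := (mem_Ioi.1 hr).ne'
  by_cases hrR : r < R
  · simp [hrR]; field_simp
  · simp [hrR]

theorem memLp_inv_norm (R : ℝ) :
    MemLp (fun p : R3 => ‖p‖⁻¹) 2 (volume.restrict (Metric.ball 0 R)) := by
  rw [memLp_two_iff_integrable_sq (by fun_prop)]
  exact integrableOn_ball_inv_norm_sq R

theorem integrableOn_ball_inv_norm (R : ℝ) :
    IntegrableOn (fun p : R3 => ‖p‖⁻¹) (Metric.ball 0 R) := by
  have : IsFiniteMeasure (volume.restrict (Metric.ball (0 : R3) R)) :=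
    ⟨by rw [Measure.restrict_apply_univ]; exact measure_ball_lt_top⟩
  exact (memLp_inv_norm R).integrable (by norm_num)

theorem ae_ne_zero (s : Set R3) : ∀ᵐ p ∂(volume.restrict s), p ≠ (0 : R3) :=
  ae_restrict_of_ae (by simp [ae_iff])

theorem aestronglyMeasurable_of_continuousOn_compl {β : Type*} [TopologicalSpace β]
    [TopologicalSpace.PseudoMetrizableSpace β] [SecondCountableTopology β] {w : R3 → β}
    (hw : ContinuousOn w {0}ᶜ) : AEStronglyMeasurable w volume := by
  have h := hw.aestronglyMeasurable (μ := (volume : Measure R3)) (measurableSet_singleton 0).compl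
  rwa [restrict_compl_singleton] at h

/-- A smooth function that vanishes on the unit ball and equals `1` far away. -/
theorem exists_cutoff : ∃ (χ : R3 → ℝ) (B : ℝ), ContDiff ℝ ∞ χ ∧ (∀ q, |χ q| ≤ 1) ∧
    (∀ q, ‖q‖ < 1 → χ q = 0) ∧ (∀ q, 2 < ‖q‖ → χ q = 1) ∧
    ∀ q, ‖q‖ * ‖fderiv ℝ χ q‖ ≤ B := by
  let b : ContDiffBump (0 : R3) := ⟨1, 2, one_pos, one_lt_two⟩
  have hs : ContDiff ℝ ∞ fun q => 1 - b q := contDiff_const.sub b.contDiff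
  have hfd : fderiv ℝ (fun q => 1 - b q) = fun q => -fderiv ℝ b q := by
    funext q; rw [fderiv_const_sub]
  have hcs : HasCompactSupport fun q : R3 => ‖q‖ * ‖fderiv ℝ (fun q => 1 - b q) q‖ := by
    rw [hfd]
    refine HasCompactSupport.mul_left ?_
    exact (b.hasCompactSupport.fderiv ℝ).comp_left (g := fun L => ‖-L‖) (by simp)
  have hc : Continuous fun q : R3 => ‖q‖ * ‖fderiv ℝ (fun q => 1 - b q) q‖ :=
    continuous_norm.mul (hs.continuous_fderiv (by simp)).norm
  obtain ⟨B, hB⟩ := hcs.exists_bound_of_continuous hc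
  refine ⟨fun q => 1 - b q, B, hs, fun q => ?_, fun q hq => ?_, fun q hq => ?_, fun q => ?_⟩
  · rw [abs_le]; constructor <;> linarith [b.nonneg (x := q), b.le_one (x := q)]
  · have := b.one_of_mem_closedBall (x := q) (by simpa [b] using hq.le)
    simp [this]
  · have := b.zero_of_le_dist (x := q) (by simpa [b] using hq.le)
    simp [this]
  · exact (le_abs_self _).trans (hB q)

/-- A bounded function that is `C¹` away from the origin, with gradient `O(1/|p|)`, is a Sobolev
function. -/
theorem isW12_ball {w : R3 → ℝ} {R C : ℝ} (hw : ContDiffOn ℝ 1 w {0}ᶜ)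
    (hb : ∀ p ∈ Metric.ball (0 : R3) R, p ≠ 0 → |w p| ≤ C)
    (hd : ∀ p ∈ Metric.ball (0 : R3) R, p ≠ 0 → ‖fderiv ℝ w p‖ ≤ C * ‖p‖⁻¹) :
    IsW12 (Metric.ball 0 R) w (gradient w) := by
  have hfin : IsFiniteMeasure (volume.restrict (Metric.ball (0 : R3) R)) :=
    ⟨by rw [Measure.restrict_apply_univ]; exact measure_ball_lt_top⟩
  have hdiff : ∀ p : R3, p ≠ 0 → DifferentiableAt ℝ w p := fun p hp =>
    (hw.differentiableOn one_ne_zero).differentiableAt (isOpen_ne.mem_nhds hp)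
  have hwm : AEStronglyMeasurable w volume :=
    aestronglyMeasurable_of_continuousOn_compl hw.continuousOn
  have hfc : ContinuousOn (fderiv ℝ w) {0}ᶜ :=
    hw.continuousOn_fderiv_of_isOpen isOpen_compl_singleton le_rfl
  have hgm : AEStronglyMeasurable (gradient w) volume :=
    aestronglyMeasurable_of_continuousOn_compl
      ((InnerProductSpace.toDual ℝ R3).symm.continuous.comp_continuousOn hfc)
  have hgn : ∀ p, ‖gradient w p‖ = ‖fderiv ℝ w p‖ := fun p => by simp [gradient]
  have hae : ∀ᵐ p ∂(volume.restrict (Metric.ball (0 : R3) R)), p ∈ Metric.ball (0 : R3) R ∧ p ≠ 0 :=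
    (ae_restrict_mem Metric.isOpen_ball.measurableSet).and (ae_ne_zero _)
  refine ⟨MemLp.of_bound hwm.restrict C (by filter_upwards [hae] with p hp using hb p hp.1 hp.2),
    ((memLp_inv_norm R).const_mul C).mono hgm.restrict (by
      filter_upwards [hae] with p hp
      rw [hgn]; exact (hd p hp.1 hp.2).trans (le_abs_self _)), ?_⟩
  intro ψ hψ hψc hψs e
  obtain ⟨χ, B, hχ, hχ1, hχ0, hχ2, hχB⟩ := exists_cutoff
  have hB0 : 0 ≤ B := by simpa using hχB 0
  obtain ⟨A, hA⟩ := hψc.exists_bound_of_continuous hψ.continuous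
  obtain ⟨A', hA'⟩ := (hψc.fderiv ℝ).exists_bound_of_continuous (hψ.continuous_fderiv (by simp))
  have hA0 : 0 ≤ A := (norm_nonneg _).trans (hA 0)
  have hA0' : 0 ≤ A' := (norm_nonneg _).trans (hA' 0)
  -- The cutoff removes a ball of radius 1/(k + 1). By scale invariance of ‖q‖‖Dχ(q)‖, its gradient
  -- is at most B/|p| uniformly in k, so all integrands below are dominated by a multiple of 1/|p|,
  -- which is integrable.
  set χk : ℕ → R3 → ℝ := fun k p => χ (((k : ℝ) + 1) • p) with hχk
  set g : ℕ → R3 → ℝ := fun k p => χk k p * ψ p with hg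
  have hk0 : ∀ k : ℕ, (0 : ℝ) < k + 1 := fun k => by positivity
  have hχks : ∀ k, ContDiff ℝ ∞ (χk k) := fun k => hχ.comp (contDiff_const_smul _)
  have hgs : ∀ k, ContDiff ℝ ∞ (g k) := fun k => (hχks k).mul hψ
  have hχd : ∀ k p, p ≠ 0 → ‖fderiv ℝ (χk k) p‖ ≤ B * ‖p‖⁻¹ := fun k p hp => by
    have h1 : fderiv ℝ (χk k) p = ((k : ℝ) + 1) • fderiv ℝ χ (((k : ℝ) + 1) • p) :=
      fderiv_comp_smul ..
    have h2 := hχB (((k : ℝ) + 1) • p)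
    have hp' : 0 < ‖p‖ := norm_pos_iff.2 hp
    rw [norm_smul, Real.norm_of_nonneg (hk0 k).le] at h2
    rw [h1, norm_smul, Real.norm_of_nonneg (hk0 k).le, ← div_eq_mul_inv, le_div_iff₀ hp']
    linarith
  have htend : ∀ p : R3, p ≠ 0 → ∀ᶠ k : ℕ in atTop, g k =ᶠ[𝓝 p] ψ := fun p hp => by
    have hp' : 0 < ‖p‖ := norm_pos_iff.2 hp
    have hlim : Tendsto (fun k : ℕ => ((k : ℝ) + 1) * ‖p‖) atTop atTop :=
      (tendsto_atTop_add_const_right _ _ tendsto_natCast_atTop_atTop).atTop_mul_const hp'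
    filter_upwards [hlim.eventually_gt_atTop 2] with k hk
    have hopen : ∀ᶠ q : R3 in 𝓝 p, 2 < ((k : ℝ) + 1) * ‖q‖ :=
      (continuous_const.mul continuous_norm).continuousAt.eventually_const_lt hk
    filter_upwards [hopen] with q hq
    have : χ (((k : ℝ) + 1) • q) = 1 := hχ2 _ (by
      rwa [norm_smul, Real.norm_of_nonneg (hk0 k).le])
    simp [hg, hχk, this]
  have hgsupp : ∀ k, tsupport (g k) ⊆ tsupport ψ := fun k => tsupport_mul_subset_right
  have hg0 : ∀ k, (0 : R3) ∉ tsupport (g k) := fun k => by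
    rw [notMem_tsupport_iff_eventuallyEq]
    have hopen : ∀ᶠ q : R3 in 𝓝 0, ((k : ℝ) + 1) * ‖q‖ < 1 :=
      (continuous_const.mul continuous_norm).continuousAt.eventually_lt_const (by simp)
    filter_upwards [hopen] with q hq
    have : χ (((k : ℝ) + 1) • q) = 0 := hχ0 _ (by
      rwa [norm_smul, Real.norm_of_nonneg (hk0 k).le])
    simp [hg, hχk, this]
  have hgb : ∀ k p, |g k p| ≤ A := fun k p => by
    have h1 : |ψ p| ≤ A := hA p
    simp only [hg, abs_mul]
    nlinarith [hχ1 (((k : ℝ) + 1) • p), abs_nonneg (ψ p)]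
  have hgd : ∀ k p, p ∈ Metric.ball (0 : R3) R → p ≠ 0 →
      |fderiv ℝ (g k) p e| ≤ (A' * R + A * B) * ‖e‖ * ‖p‖⁻¹ := fun k p hpR hp => by
    have hp' : 0 < ‖p‖ := norm_pos_iff.2 hp
    have hpR' : ‖p‖ < R := by simpa using hpR
    have h1 : fderiv ℝ (g k) p = χk k p • fderiv ℝ ψ p + ψ p • fderiv ℝ (χk k) p :=
      fderiv_mul ((hχks k).differentiable (by simp) p) (hψ.differentiable (by simp) p)
    have h2 : ‖fderiv ℝ (g k) p‖ ≤ A' + A * (B * ‖p‖⁻¹) := by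
      rw [h1]
      refine (norm_add_le _ _).trans (add_le_add ?_ ?_)
      · rw [norm_smul]
        have := hχ1 (((k : ℝ) + 1) • p)
        calc _ ≤ 1 * A' := mul_le_mul this (hA' p) (norm_nonneg _) zero_le_one
          _ = A' := one_mul _
      · rw [norm_smul]
        exact mul_le_mul (hA p) (hχd k p hp) (norm_nonneg _) hA0
    have h3 : A' ≤ A' * R * ‖p‖⁻¹ := by
      rw [← div_eq_mul_inv, le_div_iff₀ hp']; exact mul_le_mul_of_nonneg_left hpR'.le hA0'
    calc |fderiv ℝ (g k) p e| ≤ ‖fderiv ℝ (g k) p‖ * ‖e‖ := (fderiv ℝ (g k) p).le_opNorm e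
      _ ≤ (A' + A * (B * ‖p‖⁻¹)) * ‖e‖ := by gcongr
      _ ≤ (A' * R * ‖p‖⁻¹ + A * (B * ‖p‖⁻¹)) * ‖e‖ := by gcongr
      _ = _ := by ring
  have hC0 : ∀ p, p ∈ Metric.ball (0 : R3) R → p ≠ 0 → 0 ≤ C := fun p h1 h2 =>
    (abs_nonneg _).trans (hb p h1 h2)
  have bL : ∀ k p, p ∈ Metric.ball (0 : R3) R → p ≠ 0 → ‖w p * fderiv ℝ (g k) p e‖ ≤
      C * ((A' * R + A * B) * ‖e‖) * ‖p‖⁻¹ := fun k p h1 h2 => by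
    rw [Real.norm_eq_abs, abs_mul, mul_assoc C]
    exact mul_le_mul (hb p h1 h2) (hgd k p h1 h2) (abs_nonneg _) (hC0 p h1 h2)
  have bR : ∀ k p, p ∈ Metric.ball (0 : R3) R → p ≠ 0 → ‖fderiv ℝ w p e * g k p‖ ≤
      C * ‖e‖ * A * ‖p‖⁻¹ := fun k p h1 h2 => by
    rw [Real.norm_eq_abs, abs_mul]
    have h3 : |fderiv ℝ w p e| ≤ C * ‖p‖⁻¹ * ‖e‖ :=
      ((fderiv ℝ w p).le_opNorm e).trans (by gcongr; exact hd p h1 h2)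
    calc _ ≤ (C * ‖p‖⁻¹ * ‖e‖) * A := mul_le_mul h3 (hgb k p) (abs_nonneg _)
          ((abs_nonneg _).trans h3)
      _ = _ := by ring
  have mfe : AEStronglyMeasurable (fun p => fderiv ℝ w p e) volume :=
    aestronglyMeasurable_of_continuousOn_compl (hfc.clm_apply continuousOn_const)
  have mL : ∀ k, AEStronglyMeasurable (fun p => w p * fderiv ℝ (g k) p e) volume := fun k =>
    hwm.mul (((hgs k).continuous_fderiv (by simp)).clm_apply continuous_const).aestronglyMeasurable
  have mR : ∀ k, AEStronglyMeasurable (fun p => fderiv ℝ w p e * g k p) volume := fun k =>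
    mfe.mul (hgs k).continuous.aestronglyMeasurable
  have iinv : ∀ c : ℝ, IntegrableOn (fun p : R3 => c * ‖p‖⁻¹) (Metric.ball 0 R) := fun c =>
    (integrableOn_ball_inv_norm R).const_mul c
  have zL : ∀ k p, p ∉ Metric.ball (0 : R3) R → w p * fderiv ℝ (g k) p e = 0 := fun k p hp => by
    rw [fderiv_of_notMem_tsupport ℝ (fun h => hp (hψs (hgsupp k h)))]; simp
  have zg : ∀ k p, p ∉ Metric.ball (0 : R3) R → g k p = 0 := fun k p hp =>
    image_eq_zero_of_notMem_tsupport (fun h => hp (hψs (hgsupp k h)))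
  have zR : ∀ k p, p ∉ Metric.ball (0 : R3) R → fderiv ℝ w p e * g k p = 0 := fun k p hp => by
    rw [zg k p hp, mul_zero]
  have toInt : ∀ {F : R3 → ℝ}, (∀ p, p ∉ Metric.ball (0 : R3) R → F p = 0) →
      AEStronglyMeasurable F volume → ∀ c, (∀ p, p ∈ Metric.ball (0 : R3) R → p ≠ 0 →
      ‖F p‖ ≤ c * ‖p‖⁻¹) → Integrable F := fun {F} h0 hm c hc => by
    have : IntegrableOn F (Metric.ball 0 R) := (iinv c).mono' hm.restrict (by
      filter_upwards [hae] with p hp using hc p hp.1 hp.2)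
    exact (integrableOn_iff_integrable_of_support_subset (fun p hp => by
      by_contra h; exact hp (h0 p h))).1 this
  -- The test function `g k` vanishes near the origin, so only the classical derivative of w away
  -- from 0 enters.
  have parts : ∀ k, ∫ p in Metric.ball (0 : R3) R, w p * fderiv ℝ (g k) p e =
      -∫ p in Metric.ball (0 : R3) R, fderiv ℝ w p e * g k p := fun k => by
    rw [setIntegral_eq_integral_of_forall_compl_eq_zero (zL k),
      setIntegral_eq_integral_of_forall_compl_eq_zero (zR k)]
    refine integral_mul_fderiv_eq_neg_fderiv_mul_of_integrable (toInt (zR k) (mR k) _ (bR k))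
      (toInt (zL k) (mL k) _ (bL k)) (toInt (fun p hp => by rw [zg k p hp, mul_zero])
        (hwm.mul (hgs k).continuous.aestronglyMeasurable) (C * A * R) fun p h1 h2 => ?_)
      (fun p hp => hdiff p fun h => hg0 k (h ▸ hp))
      (fun p _ => (hgs k).differentiable (by simp) p)
    have hp' : 0 < ‖p‖ := norm_pos_iff.2 h2
    have hpR' : ‖p‖ ≤ R := by simpa using (Metric.mem_ball.1 h1).le
    rw [Real.norm_eq_abs, abs_mul, ← div_eq_mul_inv, le_div_iff₀ hp']
    exact mul_le_mul (mul_le_mul (hb p h1 h2) (hgb k p) (abs_nonneg _) (hC0 p h1 h2)) hpR'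
      (norm_nonneg _) (mul_nonneg (hC0 p h1 h2) hA0)
  have tL : Tendsto (fun k => ∫ p in Metric.ball (0 : R3) R, w p * fderiv ℝ (g k) p e) atTop
      (𝓝 (∫ p in Metric.ball (0 : R3) R, w p * fderiv ℝ ψ p e)) := by
    refine tendsto_integral_of_dominated_convergence _ (fun k => (mL k).restrict) (iinv _)
      (fun k => by filter_upwards [hae] with p hp using bL k p hp.1 hp.2) ?_
    filter_upwards [hae] with p hp
    refine tendsto_const_nhds.congr' ?_
    filter_upwards [htend p hp.2] with k hk
    rw [hk.fderiv_eq]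
  have tR : Tendsto (fun k => ∫ p in Metric.ball (0 : R3) R, fderiv ℝ w p e * g k p) atTop
      (𝓝 (∫ p in Metric.ball (0 : R3) R, fderiv ℝ w p e * ψ p)) := by
    refine tendsto_integral_of_dominated_convergence _ (fun k => (mR k).restrict) (iinv _)
      (fun k => by filter_upwards [hae] with p hp using bR k p hp.1 hp.2) ?_
    filter_upwards [hae] with p hp
    refine tendsto_const_nhds.congr' ?_
    filter_upwards [htend p hp.2] with k hk
    rw [hk.self_of_nhds]
  simp only [inner_gradient_left]
  exact tendsto_nhds_unique tL (tR.neg.congr fun k => (parts k).symm)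

/-- Pointwise convergence with uniform bounds implies weak convergence in `W^{1,2}`. -/
theorem tendstoWeaklyW12_ball {w : ℕ → R3 → ℝ} {w' : R3 → ℝ} {R C : ℝ}
    (hw : ∀ i, ContDiffOn ℝ 1 (w i) {0}ᶜ) (hw' : ContDiffOn ℝ 1 w' {0}ᶜ)
    (hb : ∀ᶠ i in atTop, ∀ p ∈ Metric.ball (0 : R3) R, p ≠ 0 →
      |w i p| ≤ C ∧ ‖fderiv ℝ (w i) p‖ ≤ C * ‖p‖⁻¹)
    (hlim : ∀ p : R3, p ≠ 0 → Tendsto (fun i => w i p) atTop (𝓝 (w' p)))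
    (hlimd : ∀ p : R3, p ≠ 0 → Tendsto (fun i => fderiv ℝ (w i) p) atTop (𝓝 (fderiv ℝ w' p))) :
    TendstoWeaklyW12 (Metric.ball 0 R) w w' := by
  have hae : ∀ᵐ p ∂(volume.restrict (Metric.ball (0 : R3) R)), p ∈ Metric.ball (0 : R3) R ∧ p ≠ 0 :=
    (ae_restrict_mem Metric.isOpen_ball.measurableSet).and (ae_ne_zero _)
  have hfin : IsFiniteMeasure (volume.restrict (Metric.ball (0 : R3) R)) :=
    ⟨by rw [Measure.restrict_apply_univ]; exact measure_ball_lt_top⟩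
  have hb' : ∀ p ∈ Metric.ball (0 : R3) R, p ≠ 0 → |w' p| ≤ C ∧ ‖fderiv ℝ w' p‖ ≤ C * ‖p‖⁻¹ :=
    fun p h1 h2 =>
      ⟨le_of_tendsto (hlim p h2).abs (by filter_upwards [hb] with i hi using (hi p h1 h2).1),
        le_of_tendsto (hlimd p h2).norm (by filter_upwards [hb] with i hi using (hi p h1 h2).2)⟩
  have hgrad : ∀ f : R3 → ℝ, ContDiffOn ℝ 1 f {0}ᶜ → AEStronglyMeasurable (gradient f) volume :=
    fun f hf => aestronglyMeasurable_of_continuousOn_compl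
      ((InnerProductSpace.toDual ℝ R3).symm.continuous.comp_continuousOn
        (hf.continuousOn_fderiv_of_isOpen isOpen_compl_singleton le_rfl))
  have hgn : ∀ (f : R3 → ℝ) p, ‖gradient f p‖ = ‖fderiv ℝ f p‖ := fun f p => by simp [gradient]
  refine ⟨fun i => gradient (w i), gradient w', ?_, isW12_ball hw' (fun p h1 h2 => (hb' p h1 h2).1)
    (fun p h1 h2 => (hb' p h1 h2).2), ?_, ?_⟩
  · filter_upwards [hb] with i hi
    exact isW12_ball (hw i) (fun p h1 h2 => (hi p h1 h2).1) (fun p h1 h2 => (hi p h1 h2).2)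
  · intro ψ hψ
    refine tendsto_integral_filter_of_dominated_convergence (fun p => C * ‖ψ p‖)
      (Eventually.of_forall fun i =>
        (aestronglyMeasurable_of_continuousOn_compl (hw i).continuousOn).restrict.mul hψ.1) ?_
      ((hψ.integrable (by norm_num)).norm.const_mul C) ?_
    · filter_upwards [hb] with i hi
      filter_upwards [hae] with p hp
      rw [norm_mul]
      exact mul_le_mul_of_nonneg_right (hi p hp.1 hp.2).1 (norm_nonneg _)
    · filter_upwards [hae] with p hp using (hlim p hp.2).mul_const _
  · intro Ψ hΨ
    -- The dominating function is integrable as a product of two L² functions.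
    refine tendsto_integral_filter_of_dominated_convergence (fun p => C * (‖p‖⁻¹ * ‖Ψ p‖))
      (Eventually.of_forall fun i => (hgrad _ (hw i)).restrict.inner hΨ.1) ?_
      (((memLp_inv_norm R).integrable_mul hΨ.norm).const_mul C) ?_
    · filter_upwards [hb] with i hi
      filter_upwards [hae] with p hp
      refine (norm_inner_le_norm _ _).trans ?_
      rw [hgn, ← mul_assoc]
      exact mul_le_mul_of_nonneg_right (hi p hp.1 hp.2).2 (norm_nonneg _)
    · filter_upwards [hae] with p hp
      have := ((InnerProductSpace.toDual ℝ R3).symm.continuous.tendsto _).comp (hlimd p hp.2)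
      exact Tendsto.inner this tendsto_const_nhds

end Sobolev

/-! ### Smoothness of pulled back inner products. -/

section PullbackForms

variable {E : Type*} [NormedAddCommGroup E] [NormedSpace ℝ E]
  {H : Type*} [TopologicalSpace H] {I : ModelWithCorners ℝ E H}
  {M : Type*} [TopologicalSpace M] [ChartedSpace H M]
  {P : Type*} [NormedAddCommGroup P] [InnerProductSpace ℝ P]

/-- The differential of a vector valued function. -/
noncomputable def vdiff (I : ModelWithCorners ℝ E H) (F : M → P) (p : M) :
    TangentSpace I p →L[ℝ] P :=
  mfderiv I 𝓘(ℝ, P) F p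

variable (P) in
/-- The real inner product as a bilinear map. -/
noncomputable def innerBilin : P →L[ℝ] P →L[ℝ] ℝ := innerSL ℝ

/-- The bilinear form `⟪L v, L w⟫`. -/
noncomputable def pullInner (L : E →L[ℝ] P) : E →L[ℝ] E →L[ℝ] ℝ :=
  (ContinuousLinearMap.flip ((ContinuousLinearMap.flip ((innerBilin P) ∘L L)) ∘L L))

theorem pullInner_apply (L : E →L[ℝ] P) (v w : E) : pullInner L v w = inner ℝ (L v) (L w) := rfl

theorem contDiff_pullInner [FiniteDimensional ℝ E] :
    ContDiff ℝ ∞ (pullInner : (E →L[ℝ] P) → E →L[ℝ] E →L[ℝ] ℝ) := by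
  rw [contDiff_clm_apply_iff]
  intro v
  rw [contDiff_clm_apply_iff]
  intro w
  exact (contDiff_id.clm_apply contDiff_const).inner ℝ (contDiff_id.clm_apply contDiff_const)

/-- The bilinear form `⟪dF v, dF w⟫`. -/
noncomputable def pullForm (I : ModelWithCorners ℝ E H) (F : M → P) (p : M) :
    TangentSpace I p →L[ℝ] TangentSpace I p →L[ℝ] ℝ :=
  pullInner (E := E) (vdiff I F p)

/-- In the trivialization of the tangent bundle at p₀, the form is `pullInner` of the coordinate
expression of dF. That expression is smooth, and `pullInner` is quadratic. -/
theorem contMDiff_pullForm [FiniteDimensional ℝ E] [IsManifold I ∞ M] {F : M → P}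
    (hF : ContMDiff I 𝓘(ℝ, P) ∞ F) {ρ : M → ℝ} (hρ : ContMDiff I 𝓘(ℝ, ℝ) ∞ ρ) :
    ContMDiff I (I.prod 𝓘(ℝ, E →L[ℝ] E →L[ℝ] ℝ)) ∞
      (fun p => Bundle.TotalSpace.mk' (E →L[ℝ] E →L[ℝ] ℝ)
        (E := fun p => TangentSpace I p →L[ℝ] TangentSpace I p →L[ℝ] ℝ) p
        (ρ p • pullForm I F p)) := by
  intro p₀
  rw [contMDiffAt_hom_bundle]
  refine ⟨contMDiffAt_id, ?_⟩
  have h1 := (hF p₀).mfderiv_const (m := ∞) (by simp)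
  have h2 : ContMDiffAt I 𝓘(ℝ, E →L[ℝ] E →L[ℝ] ℝ) ∞ (fun p => ρ p •
      pullInner (inTangentCoordinates I 𝓘(ℝ, P) id F (mfderiv I 𝓘(ℝ, P) F) p₀ p)) p₀ := by
    exact (hρ p₀).smul (contDiff_pullInner.contDiffAt.comp_contMDiffAt h1)
  refine h2.congr_of_eventuallyEq ?_
  filter_upwards [(trivializationAt E (TangentSpace I) p₀).open_baseSet.mem_nhds
    (FiberBundle.mem_baseSet_trivializationAt' p₀)] with p hp
  have hp' : p ∈ (trivializationAt (E →L[ℝ] ℝ) (fun b => TangentSpace I b →L[ℝ] ℝ) p₀).baseSet := by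
    rw [hom_trivializationAt_baseSet]
    exact ⟨hp, mem_univ _⟩
  ext v w
  simp only [ContinuousLinearMap.inCoordinates, inTangentCoordinates,
    ContinuousLinearMap.comp_apply, map_smul, smul_apply,
    Bundle.Trivialization.continuousLinearMapAt_apply]
  rw [Bundle.Trivialization.coe_linearMapAt_of_mem _ hp']
  simp [hom_trivializationAt_apply, ContinuousLinearMap.inCoordinates, pullInner_apply]
  left
  rfl
theorem contMDiff_sum_pullForm [FiniteDimensional ℝ E] [IsManifold I ∞ M]
    {P₁ P₂ P₃ : Type*} [NormedAddCommGroup P₁] [InnerProductSpace ℝ P₁]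
    [NormedAddCommGroup P₂] [InnerProductSpace ℝ P₂] [NormedAddCommGroup P₃]
    [InnerProductSpace ℝ P₃] {F₁ : M → P₁} {F₂ : M → P₂} {F₃ : M → P₃}
    (h₁ : ContMDiff I 𝓘(ℝ, P₁) ∞ F₁) (h₂ : ContMDiff I 𝓘(ℝ, P₂) ∞ F₂)
    (h₃ : ContMDiff I 𝓘(ℝ, P₃) ∞ F₃) {ρ : M → ℝ} (hρ : ContMDiff I 𝓘(ℝ, ℝ) ∞ ρ) :
    ContMDiff I (I.prod 𝓘(ℝ, E →L[ℝ] E →L[ℝ] ℝ)) ∞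
      (fun p => Bundle.TotalSpace.mk' (E →L[ℝ] E →L[ℝ] ℝ)
        (E := fun p => TangentSpace I p →L[ℝ] TangentSpace I p →L[ℝ] ℝ) p
        ((1 : ℝ) • pullForm I F₁ p + (1 : ℝ) • pullForm I F₂ p + ρ p • pullForm I F₃ p)) :=
  ((contMDiff_pullForm h₁ contMDiff_const).add_section
    (contMDiff_pullForm h₂ contMDiff_const)).add_section (contMDiff_pullForm h₃ hρ)

end PullbackForms

/-! ### The warped metric on the target. -/

section TargetMetric

/-- An injective linear map from a finite dimensional space is bounded below. This serves to show
that the unit balls of the metric are bounded. -/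
theorem isVonNBounded_of_injective {E F : Type*} [NormedAddCommGroup E] [NormedSpace ℝ E]
    [FiniteDimensional ℝ E] [NormedAddCommGroup F] [NormedSpace ℝ F] (J : E →L[ℝ] F)
    (hJ : ∀ v, J v = 0 → v = 0) {s : Set E} (hs : ∀ v ∈ s, ‖J v‖ ≤ 1) :
    Bornology.IsVonNBounded ℝ s := by
  obtain ⟨K, -, hK⟩ := LinearMap.exists_antilipschitzWith (J : E →ₗ[ℝ] F)
    (LinearMap.ker_eq_bot'.2 hJ)
  rw [NormedSpace.isVonNBounded_iff]
  refine (hK.isBounded_preimage (Metric.isBounded_closedBall (x := (0 : F)) (r := 1))).subset ?_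
  intro v hv
  simpa using hs v hv

attribute [local instance] finrank_real_complex_fact'

theorem finrank_R3 : Fact (Module.finrank ℝ R3 = 2 + 1) := ⟨by simp⟩

attribute [local instance] finrank_R3

theorem contMDiff_circle_coe : ContMDiff (𝓡 1) 𝓘(ℝ, ℂ) ∞ (fun c : Circle => (c : ℂ)) :=
  contMDiff_coe_sphere (E := ℂ) (n := 1)

theorem contMDiff_sphere_coe : ContMDiff (𝓡 2) 𝓘(ℝ, R3) ∞ (fun z : S2 => (z : R3)) :=
  contMDiff_coe_sphere (E := R3) (n := 2)

theorem mfderiv_circle_coe_injective (c : Circle) :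
    Function.Injective (mfderiv (𝓡 1) 𝓘(ℝ, ℂ) (fun c : Circle => (c : ℂ)) c) :=
  injective_mvfderiv_subtypeVal_sphere (E := ℂ) (n := 1) c

theorem mfderiv_sphere_coe_injective (z : S2) :
    Function.Injective (mfderiv (𝓡 2) 𝓘(ℝ, R3) (fun z : S2 => (z : R3)) z) :=
  injective_mvfderiv_subtypeVal_sphere (E := R3) (n := 2) z

theorem contMDiff_cx : ContMDiff targetModel 𝓘(ℝ, ℂ) ∞ (fun q : Target => (q.1 : ℂ)) :=
  contMDiff_circle_coe.comp contMDiff_fst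

theorem contMDiff_cy : ContMDiff targetModel 𝓘(ℝ, ℝ) ∞ (fun q : Target => q.2.1) :=
  contMDiff_fst.comp contMDiff_snd

theorem contMDiff_cz : ContMDiff targetModel 𝓘(ℝ, R3) ∞ (fun q : Target => (q.2.2 : R3)) :=
  contMDiff_sphere_coe.comp (contMDiff_snd.comp contMDiff_snd)

/-- The argument, which jumps on the circle, is eliminated in favour of the real and imaginary parts
of c; smoothness of V on the circle then becomes visible. -/
theorem circleV_eq (c : Circle) (y : ℝ) :
    circleV c y = -((c : ℂ).im * (zeta y).re + (c : ℂ).re * (zeta y).im) := by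
  rw [circleV, V_eq]
  have h := Complex.norm_mul_exp_arg_mul_I (c : ℂ)
  rw [Circle.norm_coe, Complex.ofReal_one, one_mul] at h
  rw [← Complex.exp_ofReal_mul_I_re, ← Complex.exp_ofReal_mul_I_im, h]

theorem contMDiff_circleV :
    ContMDiff targetModel 𝓘(ℝ, ℝ) ∞ (fun q : Target => circleV q.1 q.2.1) := by
  have h : ContDiff ℝ ∞ fun p : ℂ × ℝ => -(p.1.im * (zeta p.2).re + p.1.re * (zeta p.2).im) := by
    have hz := contDiff_zeta.comp (contDiff_snd : ContDiff ℝ ∞ (Prod.snd : ℂ × ℝ → ℝ))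
    have h1 : ContDiff ℝ ∞ fun p : ℂ × ℝ => (zeta p.2).re := Complex.reCLM.contDiff.comp hz
    have h2 : ContDiff ℝ ∞ fun p : ℂ × ℝ => (zeta p.2).im := Complex.imCLM.contDiff.comp hz
    have h3 : ContDiff ℝ ∞ fun p : ℂ × ℝ => p.1.re := Complex.reCLM.contDiff.comp contDiff_fst
    have h4 : ContDiff ℝ ∞ fun p : ℂ × ℝ => p.1.im := Complex.imCLM.contDiff.comp contDiff_fst
    exact ((h4.mul h1).add (h3.mul h2)).neg
  refine (h.comp_contMDiff (contMDiff_cx.prodMk_space contMDiff_cy)).congr fun q => ?_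
  exact circleV_eq _ _

theorem circleV_le_one (c : Circle) (y : ℝ) : circleV c y ≤ 1 := (abs_le.1 (abs_V_le_one _ y)).2
theorem neg_one_le_circleV (c : Circle) (y : ℝ) : -1 ≤ circleV c y :=
  (abs_le.1 (abs_V_le_one _ y)).1

theorem dx_apply (p : Target) (v : TangentSpace targetModel p) :
    dx p v = mfderiv (𝓡 1) 𝓘(ℝ, ℂ) (fun c : Circle => (c : ℂ)) p.1 v.1 := by
  have h := mfderiv_comp_apply (I := targetModel) (I' := 𝓡 1) (I'' := 𝓘(ℝ, ℂ)) p
    (f := (Prod.fst : Target → Circle)) (g := fun c : Circle => (c : ℂ))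
    (contMDiff_circle_coe.mdifferentiable (by simp) _) mdifferentiableAt_fst v
  rw [mfderiv_fst] at h
  exact h

theorem mfderiv_snd_target (p : Target) :
    mfderiv targetModel (𝓘(ℝ, ℝ).prod (𝓡 2)) (Prod.snd : Target → ℝ × S2) p =
      ContinuousLinearMap.snd ℝ (TangentSpace (𝓡 1) p.1) (TangentSpace (𝓘(ℝ, ℝ).prod (𝓡 2)) p.2) :=
  mfderiv_snd

theorem dy_apply (p : Target) (v : TangentSpace targetModel p) : dy p v = v.2.1 := by
  have h := mfderiv_comp_apply (I := targetModel) (I' := 𝓘(ℝ, ℝ).prod (𝓡 2)) (I'' := 𝓘(ℝ, ℝ)) p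
    (f := (Prod.snd : Target → ℝ × S2)) (g := (Prod.fst : ℝ × S2 → ℝ))
    mdifferentiableAt_fst mdifferentiableAt_snd v
  rw [mfderiv_fst, mfderiv_snd_target] at h
  exact h

theorem dz_apply (p : Target) (v : TangentSpace targetModel p) :
    dz p v = mfderiv (𝓡 2) 𝓘(ℝ, R3) (fun z : S2 => (z : R3)) p.2.2 v.2.2 := by
  have h1 := mfderiv_comp_apply (I := targetModel) (I' := 𝓘(ℝ, ℝ).prod (𝓡 2)) (I'' := 𝓡 2) p
    (f := (Prod.snd : Target → ℝ × S2)) (g := (Prod.snd : ℝ × S2 → S2))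
    mdifferentiableAt_snd mdifferentiableAt_snd v
  have h := mfderiv_comp_apply (I := targetModel) (I' := 𝓡 2) (I'' := 𝓘(ℝ, R3)) p
    (f := ((Prod.snd : ℝ × S2 → S2) ∘ (Prod.snd : Target → ℝ × S2))) (g := fun z : S2 => (z : R3))
    (contMDiff_sphere_coe.mdifferentiable (by simp) _)
    (mdifferentiableAt_snd.comp p mdifferentiableAt_snd) v
  rw [h1, mfderiv_snd, mfderiv_snd_target] at h
  exact h

theorem coord_differentials_injective (p : Target) (v : TangentSpace targetModel p)
    (h1 : dx p v = 0) (h2 : dy p v = 0) (h3 : dz p v = 0) : v = 0 := by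
  rw [dx_apply] at h1
  rw [dy_apply] at h2
  rw [dz_apply] at h3
  have e1 : v.1 = 0 := mfderiv_circle_coe_injective p.1 (h1.trans (map_zero _).symm)
  have e3 : v.2.2 = 0 := mfderiv_sphere_coe_injective p.2.2 (h3.trans (map_zero _).symm)
  exact Prod.ext e1 (Prod.ext h2 e3)

/-- Since V ≤ 1, the warping factor is at least 1. -/
theorem warpedForm_self_ge (p : Target) (v : TangentSpace targetModel p) :
    ‖dx p v‖ ^ 2 + dy p v ^ 2 + ‖dz p v‖ ^ 2 ≤ warpedForm p v v := by
  rw [warpedForm, real_inner_self_eq_norm_sq, real_inner_self_eq_norm_sq]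
  nlinarith [circleV_le_one p.1 p.2.1, sq_nonneg ‖dz p v‖]

/-- The bilinear form `dx² + dy² + (2 - V) dz²` as a continuous bilinear map. -/
noncomputable def warpedInner (p : Target) :
    TangentSpace targetModel p →L[ℝ] TangentSpace targetModel p →L[ℝ] ℝ :=
  (1 : ℝ) • pullForm targetModel (fun q : Target => (q.1 : ℂ)) p +
  (1 : ℝ) • pullForm targetModel (fun q : Target => q.2.1) p +
  (2 - circleV p.1 p.2.1) • pullForm targetModel (fun q : Target => (q.2.2 : R3)) p

theorem warpedInner_apply (p : Target) (v w : TangentSpace targetModel p) :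
    warpedInner p v w = warpedForm p v w := by
  have h : warpedInner p v w = (1 : ℝ) * inner ℝ (dx p v) (dx p w) +
    (1 : ℝ) * inner ℝ (dy p v) (dy p w) +
    (2 - circleV p.1 p.2.1) * inner ℝ (dz p v) (dz p w) := rfl
  rw [h, warpedForm, one_mul, one_mul,
    show inner ℝ (dy p v) (dy p w) = dy p w * dy p v from rfl, mul_comm (dy p w)]

/-- The Riemannian metric `dx² + dy² + (2 - V(x, y)) dz²`. -/
noncomputable def warpedMetric : Bundle.ContMDiffRiemannianMetric targetModel ∞
    (EuclideanSpace ℝ (Fin 1) × ℝ × EuclideanSpace ℝ (Fin 2))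
    (fun p : Target => TangentSpace targetModel p) where
  inner := warpedInner
  symm p v w := by
    rw [warpedInner_apply, warpedInner_apply, warpedForm, warpedForm,
      real_inner_comm (dx p w) (dx p v), real_inner_comm (dz p w) (dz p v), mul_comm (dy p v)]
  pos p v hv := by
    rw [warpedInner_apply]
    refine lt_of_lt_of_le ?_ (warpedForm_self_ge p v)
    by_contra! h
    refine hv (coord_differentials_injective p v (norm_eq_zero.1 ?_) ?_ (norm_eq_zero.1 ?_)) <;>
      nlinarith [sq_nonneg ‖dx p v‖, sq_nonneg ‖dz p v‖, sq_nonneg (dy p v)]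
  isVonNBounded p := by
    let J : (EuclideanSpace ℝ (Fin 1) × ℝ × EuclideanSpace ℝ (Fin 2)) →L[ℝ] ℂ × ℝ × R3 :=
      (dx p).prod ((dy p).prod (dz p))
    refine isVonNBounded_of_injective J (fun v hv => ?_) fun v hv => ?_
    · have h1 : dx p v = 0 := congrArg (fun x => x.1) hv
      have h2 : dy p v = 0 := congrArg (fun x => x.2.1) hv
      have h3 : dz p v = 0 := congrArg (fun x => x.2.2) hv
      exact coord_differentials_injective p v h1 h2 h3
    have hv' : warpedForm p v v < 1 := (warpedInner_apply p v v).symm.trans_lt hv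
    have hge := warpedForm_self_ge p v
    have e : J v = (dx p v, dy p v, dz p v) := rfl
    rw [e, Prod.norm_def, Prod.norm_def]
    refine max_le ?_ (max_le ?_ ?_)
    · nlinarith [sq_nonneg ‖dz p v‖, sq_nonneg (dy p v), norm_nonneg (dx p v)]
    · rw [Real.norm_eq_abs]; apply abs_le_one_iff_mul_self_le_one.2
      nlinarith [sq_nonneg ‖dz p v‖, sq_nonneg ‖dx p v‖]
    · nlinarith [sq_nonneg ‖dx p v‖, sq_nonneg (dy p v), norm_nonneg (dz p v)]
  contMDiff := contMDiff_sum_pullForm contMDiff_cx contMDiff_cy contMDiff_cz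
    (contMDiff_const.sub contMDiff_circleV)

end TargetMetric

/-! ### The radial projection onto the unit sphere. -/

section UnitVector

variable {E : Type*} [NormedAddCommGroup E] [InnerProductSpace ℝ E]

open Classical in
/-- The unit vector in the direction of `p`, with a prescribed value at the origin. -/
noncomputable def unitVec (z₀ : Metric.sphere (0 : E) 1) (p : E) : Metric.sphere (0 : E) 1 :=
  if h : p = 0 then z₀ else ⟨‖p‖⁻¹ • p, by
    rw [mem_sphere_zero_iff_norm, norm_smul, norm_inv, norm_norm,
      inv_mul_cancel₀ (norm_ne_zero_iff.2 h)]⟩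

theorem coe_unitVec (z₀ : Metric.sphere (0 : E) 1) {p : E} (hp : p ≠ 0) :
    (unitVec z₀ p : E) = ‖p‖⁻¹ • p := by
  rw [unitVec, dif_neg hp]

theorem unitVec_coe (z₀ z : Metric.sphere (0 : E) 1) : unitVec z₀ (z : E) = z := by
  have hz : ‖(z : E)‖ = 1 := norm_eq_of_mem_sphere z
  have h0 : (z : E) ≠ 0 := fun h => by rw [h, norm_zero] at hz; exact zero_ne_one hz
  exact Subtype.ext (by rw [coe_unitVec _ h0, hz, inv_one, one_smul])

theorem unitVec_smul (z₀ : Metric.sphere (0 : E) 1) {c : ℝ} (hc : 0 < c) (p : E) :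
    unitVec z₀ (c • p) = unitVec z₀ p := by
  by_cases hp : p = 0
  · rw [hp, smul_zero]
  · have h : c • p ≠ 0 := smul_ne_zero hc.ne' hp
    refine Subtype.ext ?_
    rw [coe_unitVec _ h, coe_unitVec _ hp, norm_smul, Real.norm_of_nonneg hc.le, smul_smul]
    congr 1
    field_simp

/-- Restricting the codomain to the sphere requires a map smooth on a whole manifold, so the
argument runs on the open submanifold E \ {0}. -/
theorem contMDiffAt_unitVec {n : ℕ} [Fact (Module.finrank ℝ E = n + 1)]
    (z₀ : Metric.sphere (0 : E) 1) {p : E} (hp : p ≠ 0) :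
    ContMDiffAt 𝓘(ℝ, E) (𝓡 n) ∞ (unitVec z₀) p := by
  let U : TopologicalSpace.Opens E := ⟨{0}ᶜ, isOpen_compl_singleton⟩
  have hs : ContMDiff 𝓘(ℝ, E) 𝓘(ℝ, E) ∞ fun q : U => (unitVec z₀ (q : E) : E) := by
    have h1 : ContMDiff 𝓘(ℝ, E) 𝓘(ℝ, E) ∞ fun q : U => ‖(q : E)‖⁻¹ • (q : E) := by
      intro q
      rw [contMDiffAt_subtype_iff (f := fun q : E => ‖q‖⁻¹ • q)]
      have hq : (q : E) ≠ 0 := q.2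
      exact (((contDiffAt_norm ℝ hq).inv (norm_ne_zero_iff.2 hq)).smul contDiffAt_id).contMDiffAt
    exact h1.congr fun q => coe_unitVec z₀ q.2
  have h := hs.codRestrict_sphere (n := n) (fun q => (unitVec z₀ (q : E)).2)
  have h' : ContMDiffAt 𝓘(ℝ, E) (𝓡 n) ∞ (fun q : U => unitVec z₀ (q : E)) ⟨p, hp⟩ := h _
  rwa [contMDiffAt_subtype_iff] at h'

end UnitVector

/-! ### Radial maps, their differentials, and compositions with test functions. -/

section Radial

attribute [local instance] finrank_R3 finrank_real_complex_fact'

/-- The differential of `log |p|`. -/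
noncomputable def ell (p : R3) : R3 →L[ℝ] ℝ := (‖p‖ ^ 2)⁻¹ • innerSL ℝ p

/-- The differential of `p / |p|`. -/
noncomputable def nu (p : R3) : R3 →L[ℝ] R3 :=
  ‖p‖⁻¹ • ContinuousLinearMap.id ℝ R3 - (ell p).smulRight (‖p‖⁻¹ • p)

theorem ell_apply (p e : R3) : ell p e = (‖p‖ ^ 2)⁻¹ * inner ℝ p e := rfl

theorem nu_apply (p e : R3) : nu p e = ‖p‖⁻¹ • e - ell p e • (‖p‖⁻¹ • p) := rfl

theorem hasFDerivAt_log_norm {p : R3} (hp : p ≠ 0) :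
    HasFDerivAt (fun p : R3 => Real.log ‖p‖) (ell p) p := by
  have h1 := (hasStrictFDerivAt_norm_sq p).hasFDerivAt
  have h0 : ‖p‖ ^ 2 ≠ 0 := by positivity
  have h2 := (h1.log h0).const_mul (1 / 2)
  refine (h2.congr_of_eventuallyEq (Eventually.of_forall fun q => ?_)).congr_fderiv ?_
  · simp only [Real.log_pow]; push_cast; ring
  · ext e
    simp [ell]
    ring

theorem hasFDerivAt_inv_norm {p : R3} (hp : p ≠ 0) :
    HasFDerivAt (fun p : R3 => ‖p‖⁻¹) (-(‖p‖⁻¹ • ell p)) p := by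
  have h := ((hasFDerivAt_log_norm hp).neg).exp
  have hp' : 0 < ‖p‖ := norm_pos_iff.2 hp
  refine (h.congr_of_eventuallyEq ?_).congr_fderiv ?_
  · filter_upwards [isOpen_ne.mem_nhds hp] with q hq
    simp [Real.exp_neg, Real.exp_log (norm_pos_iff.2 hq)]
  · simp [Real.exp_neg, Real.exp_log hp']

theorem hasFDerivAt_unit {p : R3} (hp : p ≠ 0) :
    HasFDerivAt (fun p : R3 => ‖p‖⁻¹ • p) (nu p) p := by
  refine ((hasFDerivAt_inv_norm hp).smul (hasFDerivAt_id p)).congr_fderiv ?_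
  ext1 e
  simp [nu_apply, smul_smul, sub_eq_add_neg, mul_comm]

theorem norm_ell_le (p : R3) : ‖ell p‖ ≤ ‖p‖⁻¹ := by
  refine ContinuousLinearMap.opNorm_le_bound _ (by positivity) fun e => ?_
  by_cases hp : p = 0
  · simp [hp, ell]
  have hp' : 0 < ‖p‖ := norm_pos_iff.2 hp
  rw [ell_apply, norm_mul, norm_inv, norm_pow, norm_norm]
  calc (‖p‖ ^ 2)⁻¹ * ‖(inner ℝ p e : ℝ)‖ ≤ (‖p‖ ^ 2)⁻¹ * (‖p‖ * ‖e‖) := by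
        gcongr; exact norm_inner_le_norm p e
    _ = ‖p‖⁻¹ * ‖e‖ := by field_simp

theorem norm_nu_le (p : R3) : ‖nu p‖ ≤ 2 * ‖p‖⁻¹ := by
  refine ContinuousLinearMap.opNorm_le_bound _ (by positivity) fun e => ?_
  by_cases hp : p = 0
  · simp [hp, nu]
  have hp' : 0 < ‖p‖ := norm_pos_iff.2 hp
  rw [nu_apply]
  refine (norm_sub_le _ _).trans ?_
  have h1 : ‖‖p‖⁻¹ • p‖ = 1 := by
    rw [norm_smul, norm_inv, norm_norm, inv_mul_cancel₀ hp'.ne']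
  have h2 : ‖ell p e‖ ≤ ‖p‖⁻¹ * ‖e‖ := (ell p).le_of_opNorm_le (norm_ell_le p) e
  rw [norm_smul, norm_smul, h1, norm_inv, norm_norm, mul_one]
  linarith

/-- The map `p ↦ (e^{iX(log |p|)}, Y(log |p|), p / |p|)` with values in `ℂ × ℝ × ℝ³`. -/
noncomputable def radialExt (X Y : ℝ → ℝ) (p : R3) : ℂ × ℝ × R3 :=
  ((Circle.exp (X (Real.log ‖p‖)) : ℂ), Y (Real.log ‖p‖), ‖p‖⁻¹ • p)

/-- The differential of `radialExt`. -/
noncomputable def radialDeriv (X Y : ℝ → ℝ) (p : R3) : R3 →L[ℝ] ℂ × ℝ × R3 :=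
  ((deriv X (Real.log ‖p‖) • ell p).smulRight
      (Complex.I * (Circle.exp (X (Real.log ‖p‖)) : ℂ))).prod
    ((deriv Y (Real.log ‖p‖) • ell p).prod (nu p))

theorem hasDerivAt_circleExp (t : ℝ) :
    HasDerivAt (fun t : ℝ => (Circle.exp t : ℂ)) (Complex.I * (Circle.exp t : ℂ)) t := by
  simp only [Circle.coe_exp]
  have := ((Complex.ofRealCLM.hasDerivAt (x := t)).mul_const Complex.I).cexp
  refine this.congr_deriv ?_
  simp [mul_comm]

theorem hasFDerivAt_radialExt {X Y : ℝ → ℝ} (hX : Differentiable ℝ X) (hY : Differentiable ℝ Y)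
    {p : R3} (hp : p ≠ 0) : HasFDerivAt (radialExt X Y) (radialDeriv X Y p) p := by
  have hl := hasFDerivAt_log_norm hp
  have h1 : HasFDerivAt (fun p : R3 => X (Real.log ‖p‖)) _ p :=
    (hX (Real.log ‖p‖)).hasDerivAt.comp_hasFDerivAt p hl
  have h2 : HasFDerivAt (fun p : R3 => Y (Real.log ‖p‖)) _ p :=
    (hY (Real.log ‖p‖)).hasDerivAt.comp_hasFDerivAt p hl
  have h3 : HasFDerivAt (fun p : R3 => (Circle.exp (X (Real.log ‖p‖)) : ℂ)) _ p :=
    HasFDerivAt.comp (g := fun t : ℝ => (Circle.exp t : ℂ)) p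
      (hasDerivAt_circleExp (X (Real.log ‖p‖))).hasFDerivAt h1
  have h4 : HasFDerivAt (radialExt X Y) _ p := h3.prodMk (h2.prodMk (hasFDerivAt_unit hp))
  refine h4.congr_fderiv ?_
  ext1 e
  simp [radialDeriv, mul_assoc]

theorem norm_radialDeriv_le {X Y : ℝ → ℝ} (p : R3) (hX : |deriv X (Real.log ‖p‖)| ≤ 2)
    (hY : |deriv Y (Real.log ‖p‖)| ≤ 2) : ‖radialDeriv X Y p‖ ≤ 2 * ‖p‖⁻¹ := by
  refine ContinuousLinearMap.opNorm_le_bound _ (by positivity) fun e => ?_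
  have h2 : |ell p e| ≤ ‖p‖⁻¹ * ‖e‖ := (ell p).le_of_opNorm_le (norm_ell_le p) e
  have h3 : ‖nu p e‖ ≤ 2 * ‖p‖⁻¹ * ‖e‖ := (nu p).le_of_opNorm_le (norm_nu_le p) e
  have hm : ∀ a : ℝ, |a| ≤ 2 → |a * ell p e| ≤ 2 * ‖p‖⁻¹ * ‖e‖ := fun a ha => by
    rw [abs_mul, mul_assoc]
    exact mul_le_mul ha h2 (abs_nonneg _) (by norm_num)
  have e1 : ‖(radialDeriv X Y p e).1‖ = |deriv X (Real.log ‖p‖) * ell p e| := by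
    simp [radialDeriv]
  have e2 : ‖(radialDeriv X Y p e).2.1‖ = |deriv Y (Real.log ‖p‖) * ell p e| := by
    simp [radialDeriv]
  rw [Prod.norm_def, Prod.norm_def, e1, e2]
  exact max_le (hm _ hX) (max_le (hm _ hY) h3)

theorem contDiffAt_radialExt {X Y : ℝ → ℝ} (hX : ContDiff ℝ ∞ X) (hY : ContDiff ℝ ∞ Y) {p : R3}
    (hp : p ≠ 0) : ContDiffAt ℝ ∞ (radialExt X Y) p := by
  have hn := contDiffAt_norm ℝ (n := ∞) hp
  have hp' := norm_ne_zero_iff.2 hp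
  have hl : ContDiffAt ℝ ∞ (fun p : R3 => Real.log ‖p‖) p := hn.log hp'
  have hE : ContDiff ℝ ∞ fun t : ℝ => (Circle.exp t : ℂ) :=
    (contMDiff_circle_coe.comp contMDiff_circleExp).contDiff
  exact (hE.contDiffAt.comp p (hX.contDiffAt.comp p hl)).prodMk
    ((hY.contDiffAt.comp p hl).prodMk ((hn.inv hp').smul contDiffAt_id))

/-- A point of the sphere. -/
noncomputable def basePoint : S2 := ⟨EuclideanSpace.single 0 1, by simp⟩

/-- The map `p ↦ (e^{iX(log |p|)}, Y(log |p|), p / |p|)` with values in `S¹ × ℝ × S²`. -/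
noncomputable def radialMap (X Y : ℝ → ℝ) (p : R3) : Target :=
  (Circle.exp (X (Real.log ‖p‖)), Y (Real.log ‖p‖), unitVec basePoint p)

/-- The inclusion of the target in `ℂ × ℝ × ℝ³`. -/
noncomputable def targetCoe (q : Target) : ℂ × ℝ × R3 := ((q.1 : ℂ), q.2.1, (q.2.2 : R3))

/-- The retraction of `(ℂ \ 0) × ℝ × (ℝ³ \ 0)` onto the target. -/
noncomputable def retract (w : ℂ × ℝ × R3) : Target :=
  ((unitVec (1 : Circle) w.1 : Circle), w.2.1, unitVec basePoint w.2.2)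

/-- A test function η on the target thus extends to η ∘ `retract` on an open set of the linear space
ℂ × ℝ × ℝ³, where ordinary derivatives are available. -/
theorem retract_targetCoe (q : Target) : retract (targetCoe q) = q :=
  Prod.ext (unitVec_coe (E := ℂ) _ _) (Prod.ext rfl (unitVec_coe _ _))

theorem targetCoe_radialMap (X Y : ℝ → ℝ) {p : R3} (hp : p ≠ 0) :
    targetCoe (radialMap X Y p) = radialExt X Y p := by
  simp only [targetCoe, radialMap, radialExt, coe_unitVec _ hp]

theorem contMDiffAt_retract {w : ℂ × ℝ × R3} (h1 : w.1 ≠ 0) (h2 : w.2.2 ≠ 0) :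
    ContMDiffAt 𝓘(ℝ, ℂ × ℝ × R3) targetModel ∞ retract w := by
  have a : ContMDiffAt 𝓘(ℝ, ℂ × ℝ × R3) 𝓘(ℝ, ℂ) ∞ (fun w : ℂ × ℝ × R3 => w.1) w :=
    contDiff_fst.contMDiff.contMDiffAt
  have b : ContMDiffAt 𝓘(ℝ, ℂ × ℝ × R3) 𝓘(ℝ, ℝ) ∞ (fun w : ℂ × ℝ × R3 => w.2.1) w :=
    (contDiff_fst.comp contDiff_snd).contMDiff.contMDiffAt
  have c : ContMDiffAt 𝓘(ℝ, ℂ × ℝ × R3) 𝓘(ℝ, R3) ∞ (fun w : ℂ × ℝ × R3 => w.2.2) w :=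
    (contDiff_snd.comp contDiff_snd).contMDiff.contMDiffAt
  have a' : ContMDiffAt 𝓘(ℝ, ℂ × ℝ × R3) (𝓡 1) ∞
      (fun w : ℂ × ℝ × R3 => (unitVec (1 : Circle) w.1 : Circle)) w :=
    (contMDiffAt_unitVec (E := ℂ) (n := 1) (1 : Circle) h1).comp w a
  have c' := (contMDiffAt_unitVec (n := 2) basePoint h2).comp w c
  exact a'.prodMk (b.prodMk c')

theorem contMDiffAt_radialMap {X Y : ℝ → ℝ} (hX : ContDiff ℝ ∞ X) (hY : ContDiff ℝ ∞ Y) {p : R3}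
    (hp : p ≠ 0) : ContMDiffAt 𝓘(ℝ, R3) targetModel ∞ (radialMap X Y) p := by
  have h0 : (radialExt X Y p).1 ≠ 0 := by simp [radialExt]
  have h2 : (radialExt X Y p).2.2 ≠ 0 := by
    simp [radialExt, hp]
  have h := (contMDiffAt_retract h0 h2).comp p (contDiffAt_radialExt hX hY hp).contMDiffAt
  refine h.congr_of_eventuallyEq ?_
  filter_upwards [isOpen_ne.mem_nhds hp] with q hq
  rw [Function.comp_apply, ← targetCoe_radialMap X Y hq, retract_targetCoe]

/-- A compact set that contains the values of the maps `radialExt`. -/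
def valueSet : Set (ℂ × ℝ × R3) := Metric.sphere 0 1 ×ˢ Icc 0 1 ×ˢ Metric.sphere 0 1

theorem isCompact_valueSet : IsCompact valueSet :=
  (isCompact_sphere _ _).prod (isCompact_Icc.prod (isCompact_sphere _ _))

theorem radialExt_mem {X Y : ℝ → ℝ} {p : R3} (hp : p ≠ 0) (hY : Y (Real.log ‖p‖) ∈ Icc (0 : ℝ) 1) :
    radialExt X Y p ∈ valueSet := by
  refine ⟨by simp [radialExt], hY, ?_⟩
  have hp' := norm_ne_zero_iff.2 hp
  simp [radialExt, norm_smul, hp']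

theorem contDiffAt_comp_retract {η : Target → ℝ} (hη : ContMDiff targetModel 𝓘(ℝ, ℝ) ∞ η)
    {w : ℂ × ℝ × R3} (h1 : w.1 ≠ 0) (h2 : w.2.2 ≠ 0) :
    ContDiffAt ℝ ∞ (fun w => η (retract w)) w :=
  ((hη _).comp w (contMDiffAt_retract h1 h2)).contDiffAt

theorem ne_zero_of_mem_valueSet {w : ℂ × ℝ × R3} (hw : w ∈ valueSet) : w.1 ≠ 0 ∧ w.2.2 ≠ 0 :=
  ⟨ne_zero_of_mem_unit_sphere ⟨_, hw.1⟩, ne_zero_of_mem_unit_sphere ⟨_, hw.2.2⟩⟩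

/-- By compactness of `valueSet`, one constant serves all radial maps with heights in [0, 1], in
particular all dilations of a given one. -/
theorem exists_bound_comp_retract {η : Target → ℝ} (hη : ContMDiff targetModel 𝓘(ℝ, ℝ) ∞ η) :
    ∃ C, 0 ≤ C ∧ ∀ w ∈ valueSet, |η (retract w)| ≤ C ∧
      ‖fderiv ℝ (fun w => η (retract w)) w‖ ≤ C := by
  have hc : ∀ w ∈ valueSet, ContDiffAt ℝ ∞ (fun w => η (retract w)) w := fun w hw =>
    contDiffAt_comp_retract hη (ne_zero_of_mem_valueSet hw).1 (ne_zero_of_mem_valueSet hw).2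
  obtain ⟨C₁, h₁⟩ := isCompact_valueSet.exists_bound_of_continuousOn
    (f := fun w => η (retract w)) fun w hw => (hc w hw).continuousAt.continuousWithinAt
  obtain ⟨C₂, h₂⟩ := isCompact_valueSet.exists_bound_of_continuousOn
    (f := fderiv ℝ fun w => η (retract w)) fun w hw =>
      ((hc w hw).continuousAt_fderiv (by simp)).continuousWithinAt
  refine ⟨max 0 (max C₁ C₂), le_max_left _ _, fun w hw => ⟨(h₁ w hw).trans ?_, (h₂ w hw).trans ?_⟩⟩
  · exact (le_max_left _ _).trans (le_max_right _ _)
  · exact (le_max_right _ _).trans (le_max_right _ _)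

variable {X Y : ℝ → ℝ} {η : Target → ℝ}

theorem retract_radialExt (X Y : ℝ → ℝ) {p : R3} (hp : p ≠ 0) :
    retract (radialExt X Y p) = radialMap X Y p := by
  rw [← targetCoe_radialMap X Y hp, retract_targetCoe]

theorem comp_radialMap_eventuallyEq (η : Target → ℝ) {p : R3} (hp : p ≠ 0) :
    (fun p => η (radialMap X Y p)) =ᶠ[𝓝 p] fun p => η (retract (radialExt X Y p)) := by
  filter_upwards [isOpen_ne.mem_nhds hp] with q hq
  rw [retract_radialExt X Y hq]

theorem fderiv_comp_radialMap (hη : ContMDiff targetModel 𝓘(ℝ, ℝ) ∞ η) (hX : ContDiff ℝ ∞ X)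
    (hY : ContDiff ℝ ∞ Y) {p : R3} (hp : p ≠ 0) :
    fderiv ℝ (fun p => η (radialMap X Y p)) p =
      (fderiv ℝ (fun w => η (retract w)) (radialExt X Y p)).comp (radialDeriv X Y p) := by
  rw [(comp_radialMap_eventuallyEq η hp).fderiv_eq]
  have h0 : (radialExt X Y p).1 ≠ 0 := by simp [radialExt]
  have h2 : (radialExt X Y p).2.2 ≠ 0 := by simp [radialExt, hp]
  exact (((contDiffAt_comp_retract hη h0 h2).differentiableAt (by simp)).hasFDerivAt.comp p
    (hasFDerivAt_radialExt (hX.differentiable (by simp)) (hY.differentiable (by simp)) hp)).fderiv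

theorem contDiffOn_comp_radialMap (hη : ContMDiff targetModel 𝓘(ℝ, ℝ) ∞ η) (hX : ContDiff ℝ ∞ X)
    (hY : ContDiff ℝ ∞ Y) : ContDiffOn ℝ 1 (fun p => η (radialMap X Y p)) {0}ᶜ := fun p hp =>
  ((((hη _).comp p (contMDiffAt_radialMap hX hY hp)).contDiffAt).of_le
    (by exact_mod_cast le_top)).contDiffWithinAt

/-- Chain rule with ‖`radialDeriv`‖ ≤ 2/|p|. The bound on the values is weakened to 2C so that one
constant serves both estimates. -/
theorem bound_comp_radialMap (hη : ContMDiff targetModel 𝓘(ℝ, ℝ) ∞ η) (hX : ContDiff ℝ ∞ X)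
    (hY : ContDiff ℝ ∞ Y) {C : ℝ} (hC0 : 0 ≤ C) (hC : ∀ w ∈ valueSet, |η (retract w)| ≤ C ∧
      ‖fderiv ℝ (fun w => η (retract w)) w‖ ≤ C) {p : R3} (hp : p ≠ 0)
    (hYp : Y (Real.log ‖p‖) ∈ Icc (0 : ℝ) 1) (hX' : |deriv X (Real.log ‖p‖)| ≤ 2)
    (hY' : |deriv Y (Real.log ‖p‖)| ≤ 2) :
    |η (radialMap X Y p)| ≤ 2 * C ∧
      ‖fderiv ℝ (fun p => η (radialMap X Y p)) p‖ ≤ 2 * C * ‖p‖⁻¹ := by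
  have hm := radialExt_mem (X := X) hp hYp
  constructor
  · rw [← retract_radialExt X Y hp]
    linarith [(hC _ hm).1]
  · rw [fderiv_comp_radialMap hη hX hY hp]
    calc _ ≤ C * (2 * ‖p‖⁻¹) := (ContinuousLinearMap.opNorm_comp_le _ _).trans
          (mul_le_mul (hC _ hm).2 (norm_radialDeriv_le p hX' hY') (norm_nonneg _) hC0)
      _ = _ := by ring

theorem isW12_comp_radialMap (hη : ContMDiff targetModel 𝓘(ℝ, ℝ) ∞ η) (hX : ContDiff ℝ ∞ X)
    (hY : ContDiff ℝ ∞ Y) (hY1 : ∀ t ≤ 0, Y t ∈ Icc (0 : ℝ) 1)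
    (hd : ∀ t, |deriv X t| ≤ 2 ∧ |deriv Y t| ≤ 2) :
    ∃ G, IsW12 (Metric.ball 0 1) (fun p => η (radialMap X Y p)) G := by
  obtain ⟨C, hC0, hC⟩ := exists_bound_comp_retract hη
  have hb : ∀ p ∈ Metric.ball (0 : R3) 1, p ≠ 0 → |η (radialMap X Y p)| ≤ 2 * C ∧
      ‖fderiv ℝ (fun p => η (radialMap X Y p)) p‖ ≤ 2 * C * ‖p‖⁻¹ := fun p h1 h2 =>
    bound_comp_radialMap hη hX hY hC0 hC h2
      (hY1 _ (Real.log_nonpos (norm_nonneg _) (by simpa using (Metric.mem_ball.1 h1).le)))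
      (hd _).1 (hd _).2
  exact ⟨_, isW12_ball (contDiffOn_comp_radialMap hη hX hY) (fun p h1 h2 => (hb p h1 h2).1)
    fun p h1 h2 => (hb p h1 h2).2⟩

/-- Dilation by r is translation of the trajectory by the time log r. -/
theorem radialMap_smul {r : ℝ} (hr : 0 < r) {p : R3} (hp : p ≠ 0) : radialMap X Y (r • p) =
    radialMap (fun t => X (Real.log r + t)) (fun t => Y (Real.log r + t)) p := by
  simp only [radialMap, norm_smul, Real.norm_of_nonneg hr.le, unitVec_smul _ hr,
    Real.log_mul hr.ne' (norm_ne_zero_iff.2 hp)]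

/-- In finite dimension, an operator is a finite sum depending continuously on its values at a
basis. -/
theorem tendsto_clm_of_tendsto_apply {ι F : Type*} [NormedAddCommGroup F] [NormedSpace ℝ F]
    {l : Filter ι} {L : ι → R3 →L[ℝ] F} {L' : R3 →L[ℝ] F}
    (h : ∀ e, Tendsto (fun i => L i e) l (𝓝 (L' e))) : Tendsto L l (𝓝 L') := by
  have key : ∀ M : R3 →L[ℝ] F, M = ∑ α : Fin 3, ContinuousLinearMap.smulRightL ℝ R3 F
      (EuclideanSpace.proj α) (M (EuclideanSpace.single α 1)) := fun M => by
    ext e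
    conv_lhs => rw [← (EuclideanSpace.basisFun (Fin 3) ℝ).sum_repr e]
    simp
  rw [key L', funext fun i => key (L i)]
  exact tendsto_finsetSum _ fun α _ =>
    ((ContinuousLinearMap.continuous _).tendsto _).comp (h (EuclideanSpace.single α 1))

theorem tendsto_radial_comp_of_tendsto (hη : ContMDiff targetModel 𝓘(ℝ, ℝ) ∞ η) {Xs Ys : ℕ → ℝ → ℝ}
    (hXs : ∀ i, ContDiff ℝ ∞ (Xs i)) (hYs : ∀ i, ContDiff ℝ ∞ (Ys i)) (hX : ContDiff ℝ ∞ X)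
    (hY : ContDiff ℝ ∞ Y) {p : R3} (hp : p ≠ 0)
    (h1 : Tendsto (fun i => (Circle.exp (Xs i (Real.log ‖p‖)) : ℂ)) atTop
      (𝓝 (Circle.exp (X (Real.log ‖p‖)))))
    (h2 : Tendsto (fun i => Ys i (Real.log ‖p‖)) atTop (𝓝 (Y (Real.log ‖p‖))))
    (h3 : Tendsto (fun i => deriv (Xs i) (Real.log ‖p‖)) atTop (𝓝 (deriv X (Real.log ‖p‖))))
    (h4 : Tendsto (fun i => deriv (Ys i) (Real.log ‖p‖)) atTop (𝓝 (deriv Y (Real.log ‖p‖)))) :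
    Tendsto (fun i => η (radialMap (Xs i) (Ys i) p)) atTop (𝓝 (η (radialMap X Y p))) ∧
    Tendsto (fun i => fderiv ℝ (fun p => η (radialMap (Xs i) (Ys i) p)) p) atTop
      (𝓝 (fderiv ℝ (fun p => η (radialMap X Y p)) p)) := by
  have n0 : (radialExt X Y p).1 ≠ 0 := by simp [radialExt]
  have n2 : (radialExt X Y p).2.2 ≠ 0 := by simp [radialExt, hp]
  have hc := contDiffAt_comp_retract hη n0 n2
  have hE : Tendsto (fun i => radialExt (Xs i) (Ys i) p) atTop (𝓝 (radialExt X Y p)) :=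
    h1.prodMk_nhds (h2.prodMk_nhds tendsto_const_nhds)
  have hD : Tendsto (fun i => radialDeriv (Xs i) (Ys i) p) atTop (𝓝 (radialDeriv X Y p)) :=
    tendsto_clm_of_tendsto_apply fun e =>
      ((h3.mul_const (ell p e)).smul (h1.const_mul Complex.I)).prodMk_nhds
        ((h4.mul_const (ell p e)).prodMk_nhds tendsto_const_nhds)
  constructor
  · simp only [← retract_radialExt _ _ hp]
    exact hc.continuousAt.tendsto.comp hE
  · rw [fderiv_comp_radialMap hη hX hY hp]
    simp only [fderiv_comp_radialMap hη (hXs _) (hYs _) hp]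
    exact (isBoundedBilinearMap_comp.continuous.tendsto (_, _)).comp
      (((hc.continuousAt_fderiv (by simp)).tendsto.comp hE).prodMk_nhds hD)

end Radial

/-! ### Tangent maps at the origin. -/

section TangentMaps

variable {X Y : ℝ → ℝ}

theorem tendsto_sub_atBot_of_tendsto_deriv (hX : Differentiable ℝ X)
    (h : Tendsto (deriv X) atBot (𝓝 0)) (s : ℝ) :
    Tendsto (fun t => X (t + s) - X t) atBot (𝓝 0) := by
  rw [Metric.tendsto_nhds]
  intro ε hε
  have hδ : 0 < ε / (|s| + 1) := by positivity
  obtain ⟨M, hM⟩ := eventually_atBot.1 ((Metric.tendsto_nhds.1 h) _ hδ)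
  filter_upwards [eventually_le_atBot (M - |s|)] with t ht
  have h1 : t ∈ Iic M := by
    have := abs_nonneg s
    simp only [mem_Iic]; linarith
  have h2 : t + s ∈ Iic M := by
    have := le_abs_self s
    simp only [mem_Iic]; linarith
  have h3 := (convex_Iic M).norm_image_sub_le_of_norm_deriv_le (fun u _ => hX u)
    (fun u hu => (by simpa [dist_zero_right] using (hM u hu).le : ‖deriv X u‖ ≤ ε / (|s| + 1)))
    h1 h2
  rw [dist_zero_right]
  refine h3.trans_lt ?_
  rw [add_sub_cancel_left, Real.norm_eq_abs, div_mul_eq_mul_div, div_lt_iff₀ (by positivity)]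
  nlinarith [abs_nonneg s]

/-- By the intermediate value theorem X takes the value arg c - 2πm before time M, once m is so
large that this lies below X(M). -/
theorem exists_le_circleExp_eq (hX : Continuous X) (h : Tendsto X atBot atBot) (c : Circle)
    (M : ℝ) : ∃ t ≤ M, Circle.exp (X t) = c := by
  obtain ⟨m, hm⟩ := exists_nat_ge ((Complex.arg (c : ℂ) - X M) / (2 * Real.pi))
  rw [div_le_iff₀ Real.two_pi_pos] at hm
  obtain ⟨s, hs, hsM⟩ := ((h.eventually (eventually_le_atBot
    (Complex.arg (c : ℂ) - m * (2 * Real.pi)))).and (eventually_le_atBot M)).exists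
  obtain ⟨t, ht, htX⟩ := intermediate_value_Icc hsM hX.continuousOn
    (⟨hs, by linarith⟩ : Complex.arg (c : ℂ) - m * (2 * Real.pi) ∈ Icc (X s) (X M))
  refine ⟨t, ht.2, ?_⟩
  rw [htX, ← Circle.exp_arg c, Circle.exp_eq_exp]
  exact ⟨-m, by rw [Circle.exp_arg]; push_cast; ring⟩

theorem exists_seq_circleExp_eq (hX : Continuous X) (h : Tendsto X atBot atBot) (c : Circle) :
    ∃ t : ℕ → ℝ, Tendsto t atTop atBot ∧ ∀ i, Circle.exp (X (t i)) = c := by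
  choose t ht hc using fun i : ℕ => exists_le_circleExp_eq hX h c (-i)
  exact ⟨t, tendsto_atBot_mono ht (tendsto_neg_atTop_atBot.comp tendsto_natCast_atTop_atTop), hc⟩

/-- The map `p ↦ (c, 0, p / |p|)`. -/
noncomputable def coneMap (c : Circle) : R3 → Target :=
  radialMap (fun _ => Complex.arg (c : ℂ)) fun _ => 0

theorem coneMap_apply (c : Circle) {p : R3} (hp : p ≠ 0) :
    (coneMap c p).1 = c ∧ (coneMap c p).2.1 = 0 ∧ ((coneMap c p).2.2 : R3) = ‖p‖⁻¹ • p :=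
  ⟨Circle.exp_arg c, rfl, coe_unitVec _ hp⟩

/-- The scales are r_i = e^{t_i}, where t_i → -∞ and e^{iX(t_i)} = c. Since the velocity tends to 0,
translating by the fixed time log|p| changes the phase by o(1), so the limit does not depend on |p|.
-/
theorem isTangentMap_coneMap (hX : ContDiff ℝ ∞ X) (hY : ContDiff ℝ ∞ Y)
    (hd : ∀ t, |deriv X t| ≤ 2 ∧ |deriv Y t| ≤ 2) (hY1 : ∀ t ≤ 0, Y t ∈ Icc (0 : ℝ) 1)
    (hY0 : Tendsto Y atBot (𝓝 0)) (hXbot : Tendsto X atBot atBot)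
    (hdX : Tendsto (deriv X) atBot (𝓝 0)) (hdY : Tendsto (deriv Y) atBot (𝓝 0)) (c : Circle) :
    IsTangentMap targetModel (radialMap X Y) 0 (coneMap c) := by
  refine ⟨fun a p ha => by simp only [coneMap, radialMap, unitVec_smul _ ha], ?_⟩
  obtain ⟨t, ht, hc⟩ := exists_seq_circleExp_eq hX.continuous hXbot c
  refine ⟨fun i => Real.exp (t i), fun i => Real.exp_pos _, Real.tendsto_exp_atBot.comp ht,
    fun η hη _ R hR => ?_⟩
  have hXi : ∀ i, ContDiff ℝ ∞ fun s => X (t i + s) := fun i =>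
    hX.comp (contDiff_const.add contDiff_id)
  have hYi : ∀ i, ContDiff ℝ ∞ fun s => Y (t i + s) := fun i =>
    hY.comp (contDiff_const.add contDiff_id)
  have heq : ∀ i, ∀ p : R3, p ≠ 0 → η (radialMap X Y (0 + Real.exp (t i) • p)) =
      η (radialMap (fun s => X (t i + s)) (fun s => Y (t i + s)) p) := fun i p hp => by
    rw [zero_add, radialMap_smul (Real.exp_pos _) hp, Real.log_exp]
  have hfd : ∀ i, ∀ p : R3, p ≠ 0 →
      fderiv ℝ (fun p => η (radialMap X Y (0 + Real.exp (t i) • p))) p =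
      fderiv ℝ (fun p => η (radialMap (fun s => X (t i + s)) (fun s => Y (t i + s)) p)) p :=
    fun i p hp => Filter.EventuallyEq.fderiv_eq
      (by filter_upwards [isOpen_ne.mem_nhds hp] with q hq using heq i q hq)
  obtain ⟨C, hC0, hC⟩ := exists_bound_comp_retract hη
  have hlim : ∀ p : R3, p ≠ 0 → _ := fun p hp => tendsto_radial_comp_of_tendsto hη hXi hYi
    (contDiff_const (c := Complex.arg (c : ℂ))) (contDiff_const (c := (0 : ℝ))) hp
    (by
      have h1 := ((tendsto_sub_atBot_of_tendsto_deriv (hX.differentiable (by simp)) hdX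
        (Real.log ‖p‖)).comp ht)
      have h2 := (Circle.exp.continuous.tendsto _).comp h1
      have h3 := (h2.mul_const c)
      rw [Circle.exp_zero, one_mul] at h3
      have h4 := (continuous_subtype_val.tendsto c).comp h3
      rw [Circle.exp_arg]
      refine h4.congr fun i => ?_
      have h5 : Circle.exp (X (t i + Real.log ‖p‖) - X (t i)) * c =
          Circle.exp (X (t i + Real.log ‖p‖)) := by
        rw [← hc i, ← Circle.exp_add, sub_add_cancel]
      exact congrArg Subtype.val h5)
    (hY0.comp (tendsto_atBot_add_const_right _ _ ht))
    (by
      simp only [deriv_comp_const_add, deriv_const]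
      exact hdX.comp (tendsto_atBot_add_const_right _ _ ht))
    (by
      simp only [deriv_comp_const_add, deriv_const]
      exact hdY.comp (tendsto_atBot_add_const_right _ _ ht))
  refine tendstoWeaklyW12_ball (C := 2 * C)
    (fun i => (contDiffOn_comp_radialMap hη (hXi i) (hYi i)).congr fun p hp => heq i p hp)
    (contDiffOn_comp_radialMap hη contDiff_const contDiff_const) ?_
    (fun p hp => (hlim p hp).1.congr fun i => (heq i p hp).symm)
    (fun p hp => (hlim p hp).2.congr fun i => (hfd i p hp).symm)
  -- For such i the dilated ball e^{t_i} B_R lies in the unit ball, where the height is in [0, 1].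
  filter_upwards [ht.eventually (eventually_le_atBot (-Real.log R))] with i hi p hpR hp
  rw [heq i p hp, hfd i p hp]
  have hle : t i + Real.log ‖p‖ ≤ 0 := by
    have := Real.log_le_log (norm_pos_iff.2 hp) (by simpa using (Metric.mem_ball.1 hpR).le)
    linarith
  exact bound_comp_radialMap hη (hXi i) (hYi i) hC0 hC hp (hY1 _ hle)
    (by rw [deriv_comp_const_add]; exact (hd _).1) (by rw [deriv_comp_const_add]; exact (hd _).2)

theorem coneMap_not_ae_eq {c c' : Circle} (h : c ≠ c') : ¬ coneMap c =ᵐ[volume] coneMap c' := by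
  intro hae
  obtain ⟨p, hp⟩ := hae.exists
  exact h (by simpa [coneMap, radialMap] using congrArg Prod.fst hp)

theorem mapClusterPt_circleExp (hX : Continuous X) (hXbot : Tendsto X atBot atBot)
    (hY0 : Tendsto Y atBot (𝓝 0)) (c : Circle) :
    MapClusterPt (c, (0 : ℝ)) atBot fun t => (Circle.exp (X t), Y t) := by
  obtain ⟨t, ht, hc⟩ := exists_seq_circleExp_eq hX hXbot c
  refine MapClusterPt.of_comp ht (Tendsto.mapClusterPt ?_)
  simp only [Function.comp_def, hc]
  exact tendsto_const_nhds.prodMk_nhds (hY0.comp ht)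

/-- On the ray through z the sphere component is constantly z, so a limit would equal both
`basePoint` and its antipode. -/
theorem not_tendsto_radialMap (X Y : ℝ → ℝ) :
    ¬ ∃ q : Target, Tendsto (radialMap X Y) (𝓝[≠] 0) (𝓝 q) := by
  rintro ⟨q, hq⟩
  have hz : Tendsto (fun p => ((radialMap X Y p).2.2 : R3)) (𝓝[≠] 0) (𝓝 (q.2.2 : R3)) :=
    ((continuous_subtype_val.comp (continuous_snd.comp continuous_snd)).tendsto q).comp hq
  have key : ∀ z : S2, (q.2.2 : R3) = z := fun z => by
    have hz0 : (z : R3) ≠ 0 := ne_zero_of_mem_unit_sphere z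
    have h1 : Tendsto (fun r : ℝ => r • (z : R3)) (𝓝[>] 0) (𝓝[≠] 0) := by
      refine tendsto_nhdsWithin_iff.2 ⟨?_, ?_⟩
      · have : Tendsto (fun r : ℝ => r • (z : R3)) (𝓝 0) (𝓝 ((0 : ℝ) • (z : R3))) :=
          (continuous_id.smul continuous_const).tendsto 0
        rw [zero_smul] at this
        exact this.mono_left nhdsWithin_le_nhds
      · filter_upwards [self_mem_nhdsWithin] with r hr
        exact smul_ne_zero (ne_of_gt hr) hz0
    refine tendsto_nhds_unique ((hz.comp h1).congr' ?_) (tendsto_const_nhds (x := (z : R3)))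
    filter_upwards [self_mem_nhdsWithin] with r hr
    simp only [Function.comp_apply, radialMap]
    rw [unitVec_smul _ hr, unitVec_coe]
  have h1 := key basePoint
  have h2 := key (-basePoint)
  rw [h1, coe_neg_sphere, eq_neg_iff_add_eq_zero, ← two_smul ℝ, smul_eq_zero] at h2
  exact ne_zero_of_mem_unit_sphere basePoint (h2.resolve_left two_ne_zero)

end TangentMaps

/-! ### Finiteness of the energy. -/

section Energy

attribute [local instance] finrank_R3 finrank_real_complex_fact'

variable {X Y : ℝ → ℝ}

/-- The coordinate κ is the restriction of a linear map P, so κ ∘ `radialMap` is differentiated as P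
∘ `radialExt`. -/
theorem mfderiv_radialMap_apply {F : Type*} [NormedAddCommGroup F] [NormedSpace ℝ F]
    (hX : ContDiff ℝ ∞ X) (hY : ContDiff ℝ ∞ Y) {p : R3} (hp : p ≠ 0)
    {κ : Target → F} (hκ : ContMDiff targetModel 𝓘(ℝ, F) ∞ κ) {P : ℂ × ℝ × R3 →L[ℝ] F}
    (hP : ∀ q, κ q = P (targetCoe q)) (e : R3) :
    mfderiv targetModel 𝓘(ℝ, F) κ (radialMap X Y p)
      (mfderiv 𝓘(ℝ, R3) targetModel (radialMap X Y) p e) = P (radialDeriv X Y p e) := by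
  have h0 := ((hκ.mdifferentiable (by simp)) (radialMap X Y p)).hasMFDerivAt.comp p
    ((contMDiffAt_radialMap hX hY hp).mdifferentiableAt (by simp)).hasMFDerivAt
  have h1 := h0.hasFDerivAt
  have h2 : HasFDerivAt (κ ∘ radialMap X Y) (P.comp (radialDeriv X Y p)) p := by
    refine (P.hasFDerivAt.comp p (hasFDerivAt_radialExt (hX.differentiable (by simp))
      (hY.differentiable (by simp)) hp)).congr_of_eventuallyEq ?_
    filter_upwards [isOpen_ne.mem_nhds hp] with q hq
    simp only [Function.comp_apply, hP, targetCoe_radialMap X Y hq]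
  exact congrArg (fun L : R3 →L[ℝ] F => L e) (HasFDerivAt.unique h1 h2)

/-- Each component of the differential is at most 2/|p| and the warping factor is at most 3. This
gives 4 + 4 + 3·4 = 20 per direction, and 60 for three directions. -/
theorem energyDensity_radialMap_le (hX : ContDiff ℝ ∞ X) (hY : ContDiff ℝ ∞ Y)
    (hd : ∀ t, |deriv X t| ≤ 2 ∧ |deriv Y t| ≤ 2) {p : R3} (hp : p ≠ 0) :
    energyDensity warpedMetric (radialMap X Y) p ≤ 60 * (‖p‖⁻¹) ^ 2 := by
  have hb : ∀ e : R3, ‖e‖ = 1 → ‖radialDeriv X Y p e‖ ≤ 2 * ‖p‖⁻¹ := fun e he => by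
    have := (radialDeriv X Y p).le_of_opNorm_le (norm_radialDeriv_le p (hd _).1 (hd _).2) e
    rwa [he, mul_one] at this
  have key : ∀ e : R3, ‖e‖ = 1 → warpedForm (radialMap X Y p)
      (mfderiv 𝓘(ℝ, R3) targetModel (radialMap X Y) p e)
      (mfderiv 𝓘(ℝ, R3) targetModel (radialMap X Y) p e) ≤ 20 * (‖p‖⁻¹) ^ 2 := fun e he => by
    have e1 := mfderiv_radialMap_apply hX hY hp contMDiff_cx
      (P := ContinuousLinearMap.fst ℝ ℂ (ℝ × R3)) (fun _ => rfl) e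
    have e2 := mfderiv_radialMap_apply hX hY hp contMDiff_cy
      (P := (ContinuousLinearMap.fst ℝ ℝ R3).comp (ContinuousLinearMap.snd ℝ ℂ (ℝ × R3)))
      (fun _ => rfl) e
    have e3 := mfderiv_radialMap_apply hX hY hp contMDiff_cz
      (P := (ContinuousLinearMap.snd ℝ ℝ R3).comp (ContinuousLinearMap.snd ℝ ℂ (ℝ × R3)))
      (fun _ => rfl) e
    have f1 : dx (radialMap X Y p) (mfderiv 𝓘(ℝ, R3) targetModel (radialMap X Y) p e) =
      (radialDeriv X Y p e).1 := e1
    have f2 : dy (radialMap X Y p) (mfderiv 𝓘(ℝ, R3) targetModel (radialMap X Y) p e) =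
      (radialDeriv X Y p e).2.1 := e2
    have f3 : dz (radialMap X Y p) (mfderiv 𝓘(ℝ, R3) targetModel (radialMap X Y) p e) =
      (radialDeriv X Y p e).2.2 := e3
    have hn := hb e he
    have g1 := (norm_fst_le (radialDeriv X Y p e)).trans hn
    have g2 := ((norm_fst_le (radialDeriv X Y p e).2).trans (norm_snd_le _)).trans hn
    have g3 := ((norm_snd_le (radialDeriv X Y p e).2).trans (norm_snd_le _)).trans hn
    rw [warpedForm, f1, f2, f3, real_inner_self_eq_norm_sq, real_inner_self_eq_norm_sq]
    have hV := neg_one_le_circleV (radialMap X Y p).1 (radialMap X Y p).2.1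
    have q1 := pow_le_pow_left₀ (norm_nonneg _) g1 2
    have q2 := pow_le_pow_left₀ (norm_nonneg _) g2 2
    have q3 := pow_le_pow_left₀ (norm_nonneg _) g3 2
    rw [Real.norm_eq_abs, sq_abs] at q2
    have q4 : (2 - circleV (radialMap X Y p).1 (radialMap X Y p).2.1) *
        ‖(radialDeriv X Y p e).2.2‖ ^ 2 ≤ 3 * (2 * ‖p‖⁻¹) ^ 2 :=
      mul_le_mul (by linarith) q3 (by positivity) (by norm_num)
    nlinarith
  unfold energyDensity
  calc _ ≤ ∑ _α : Fin 3, 20 * (‖p‖⁻¹) ^ 2 := Finset.sum_le_sum fun α _ => by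
        have := key (EuclideanSpace.single α 1) (by simp)
        rwa [← warpedInner_apply] at this
    _ = _ := by rw [Finset.sum_const, Finset.card_univ, Fintype.card_fin]; ring

theorem lintegral_energyDensity_radialMap_lt_top (hX : ContDiff ℝ ∞ X) (hY : ContDiff ℝ ∞ Y)
    (hd : ∀ t, |deriv X t| ≤ 2 ∧ |deriv Y t| ≤ 2) :
    ∫⁻ p in Metric.ball (0 : R3) 1,
      ENNReal.ofReal (energyDensity warpedMetric (radialMap X Y) p) < ⊤ := by
  refine lt_of_le_of_lt (lintegral_mono_ae ?_)
    ((integrableOn_ball_inv_norm_sq 1).const_mul 60).lintegral_lt_top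
  filter_upwards [ae_ne_zero (Metric.ball (0 : R3) 1)] with p hp
  exact ENNReal.ofReal_le_ofReal (energyDensity_radialMap_le hX hY hd hp)

end Energy

/-! ### The Euler-Lagrange operator of a weighted pullback. -/

section EulerLagrange

variable {D E P : Type*} [NormedAddCommGroup D] [NormedSpace ℝ D]
  [NormedAddCommGroup E] [NormedSpace ℝ E] [NormedAddCommGroup P] [InnerProductSpace ℝ P]

/-- The Euler-Lagrange operator of the pulled back quadratic form `ρ |dA|²`, in terms of
`a = A ∘ h` and `β = ρ ∘ h`. -/
theorem exists_hasFDerivAt_weighted {A : E → P} {ρ : E → ℝ} {h : D → E} {a : D → P} {β : D → ℝ}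
    {a' : D → D →L[ℝ] P} {a'' : D →L[ℝ] P} {β' : D →L[ℝ] ℝ} {x : D} {e : D} {v : P} {ρ' : ℝ}
    (hA : ContDiffAt ℝ ∞ A (h x)) (hρ : DifferentiableAt ℝ ρ (h x)) (hh : ContDiffAt ℝ ∞ h x)
    (hAa : ∀ᶠ x' in 𝓝 x, A (h x') = a x') (hρβ : ∀ᶠ x' in 𝓝 x, ρ (h x') = β x')
    (ha : ∀ᶠ x' in 𝓝 x, HasFDerivAt a (a' x') x') (ha' : HasFDerivAt (fun x' => a' x' e) a'' x)
    (hβ : HasFDerivAt β β' x) {k : E} (hv : fderiv ℝ A (h x) k = v)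
    (hρ' : fderiv ℝ ρ (h x) k = ρ') :
    ∃ (L₁ : D →L[ℝ] ℝ) (L₂ : E →L[ℝ] ℝ),
      HasFDerivAt (fun x' => ρ (h x') *
        inner ℝ (fderiv ℝ A (h x') k) (fderiv ℝ A (h x') (fderiv ℝ h x' e))) L₁ x ∧
      HasFDerivAt (fun q => ρ q * inner ℝ (fderiv ℝ A q (fderiv ℝ h x e))
        (fderiv ℝ A q (fderiv ℝ h x e))) L₂ (h x) ∧
      L₁ e - 1 / 2 * L₂ k = β' e * inner ℝ v (a' x e) + β x * inner ℝ v (a'' e) -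
        1 / 2 * ρ' * ‖a' x e‖ ^ 2 := by
  have hchain : ∀ᶠ x' in 𝓝 x, fderiv ℝ A (h x') (fderiv ℝ h x' e) = a' x' e := by
    have h1 : ∀ᶠ x' in 𝓝 x, ContDiffAt ℝ 1 A (h x') :=
      hh.continuousAt.eventually ((hA.of_le (by exact_mod_cast le_top)).eventually (by simp))
    have h2 : ∀ᶠ x' in 𝓝 x, ContDiffAt ℝ 1 h x' :=
      (hh.of_le (by exact_mod_cast le_top)).eventually (by simp)
    filter_upwards [h1, h2, ha, hAa.eventually_nhds] with x' h1 h2 h3 h4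
    have h5 := (h1.differentiableAt one_ne_zero).hasFDerivAt.comp x'
      (h2.differentiableAt one_ne_zero).hasFDerivAt
    exact congrArg (fun L : D →L[ℝ] P => L e) (h5.unique (h3.congr_of_eventuallyEq h4))
  have hA2 : HasFDerivAt (fderiv ℝ A) (fderiv ℝ (fderiv ℝ A) (h x)) (h x) :=
    ((hA.fderiv_right (m := ∞) (by simp)).differentiableAt (by simp)).hasFDerivAt
  have hh1 := (hh.differentiableAt (by simp)).hasFDerivAt
  -- The second derivative of A enters L₁ e through D²A(∂_e h, k) and half of L₂ k through D²A(k,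
  -- ∂_e h). By symmetry these terms cancel, and only derivatives of a and β and the number ρ'
  -- remain.
  have hsymm : ∀ u w, fderiv ℝ (fderiv ℝ A) (h x) u w = fderiv ℝ (fderiv ℝ A) (h x) w u :=
    fun u w => (hA.isSymmSndFDerivAt (by simpa using ENat.LEInfty.out)) u w
  have hc := hchain.self_of_nhds
  refine ⟨_, _, ((hβ.mul (((hA2.comp x hh1).clm_apply (hasFDerivAt_const k x)).inner ℝ
    ha')).congr_of_eventuallyEq ?_), (hρ.hasFDerivAt.mul
      ((hA2.clm_apply (hasFDerivAt_const (fderiv ℝ h x e) (h x))).inner ℝ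
        (hA2.clm_apply (hasFDerivAt_const (fderiv ℝ h x e) (h x))))), ?_⟩
  · filter_upwards [hchain, hρβ] with x' h1 h2
    rw [h1, h2]
    rfl
  · have hβx := hρβ.self_of_nhds
    simp [hc, hβx, hv, hρ', hsymm k, real_inner_comm (a' x e)]
    ring

end EulerLagrange

/-! ### Second derivatives and traces of log|p| and p/|p|. -/

section RadialDerivatives

variable {P : Type*} [NormedAddCommGroup P] [NormedSpace ℝ P]

theorem hasFDerivAt_ell_apply {p : R3} (hp : p ≠ 0) (e : R3) :
    HasFDerivAt (fun q => ell q e) ((‖p‖ ^ 2)⁻¹ • innerSL ℝ e - (2 * ell p e) • ell p) p := by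
  have hp' := norm_ne_zero_iff.2 hp
  have h1 := ((hasFDerivAt_inv_norm hp).pow 2).mul ((innerSL ℝ e).hasFDerivAt (x := p))
  refine (h1.congr_of_eventuallyEq (Eventually.of_forall fun q => ?_)).congr_fderiv ?_
  · simp [ell_apply, real_inner_comm]
  · ext1 w
    simp [ell_apply, real_inner_comm]
    field_simp
    ring

theorem hasFDerivAt_comp_log_norm {F : ℝ → P} {F' : P} {p : R3} (hp : p ≠ 0)
    (hF : HasDerivAt F F' (Real.log ‖p‖)) :
    HasFDerivAt (fun q : R3 => F (Real.log ‖q‖)) ((ell p).smulRight F') p := by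
  have h : HasFDerivAt (fun q : R3 => F (Real.log ‖q‖)) _ p :=
    HasFDerivAt.comp (g := F) p hF.hasFDerivAt (hasFDerivAt_log_norm hp)
  exact h.congr_fderiv (by ext1 e; simp)

theorem hasFDerivAt_fderiv_comp_log_norm {F' : ℝ → P} {F'' : P} {p : R3} (hp : p ≠ 0)
    (hF : HasDerivAt F' F'' (Real.log ‖p‖)) (e : R3) :
    HasFDerivAt (fun q : R3 => (ell q).smulRight (F' (Real.log ‖q‖)) e)
      ((ell p e) • (ell p).smulRight F'' +
        ((‖p‖ ^ 2)⁻¹ • innerSL ℝ e - (2 * ell p e) • ell p).smulRight (F' (Real.log ‖p‖))) p :=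
  (hasFDerivAt_ell_apply hp e).smul (hasFDerivAt_comp_log_norm hp hF)

theorem hasFDerivAt_nu_apply {p : R3} (hp : p ≠ 0) (e : R3) :
    HasFDerivAt (fun q => nu q e) ((-(‖p‖⁻¹ • ell p)).smulRight e -
      (ell p e • nu p + ((‖p‖ ^ 2)⁻¹ • innerSL ℝ e - (2 * ell p e) • ell p).smulRight
        (‖p‖⁻¹ • p))) p :=
  ((hasFDerivAt_inv_norm hp).smul_const e).sub
    ((hasFDerivAt_ell_apply hp e).smul (hasFDerivAt_unit hp))

/-- |p| `nu p` is the orthogonal projection onto the complement of p. -/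
theorem norm_nu_apply_sq {p : R3} (hp : p ≠ 0) (e : R3) :
    ‖nu p e‖ ^ 2 = (‖p‖ ^ 2)⁻¹ * ‖e‖ ^ 2 - ell p e ^ 2 := by
  have hp' := norm_ne_zero_iff.2 hp
  rw [nu_apply, norm_sub_sq_real, norm_smul, norm_smul, norm_smul, real_inner_smul_left,
    real_inner_smul_right, real_inner_smul_right, real_inner_comm p e, ell_apply]
  simp only [norm_mul, norm_inv, norm_pow, mul_pow, Real.norm_eq_abs, sq_abs, abs_norm]
  field_simp
  ring

theorem sum_ell_sq (p : R3) : ∑ α, ell p (EuclideanSpace.single α 1) ^ 2 = (‖p‖ ^ 2)⁻¹ := by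
  by_cases hp : p = 0
  · simp [hp, ell_apply]
  have hp' := norm_ne_zero_iff.2 hp
  have h : ∑ α, p α ^ 2 = ‖p‖ ^ 2 := by simp [EuclideanSpace.norm_sq_eq]
  simp only [ell_apply, mul_pow, ← Finset.mul_sum, EuclideanSpace.inner_single_right]
  simp [h]
  field_simp

theorem sum_ell_mul_inner (p z : R3) :
    ∑ α, ell p (EuclideanSpace.single α 1) * inner ℝ z (EuclideanSpace.single α (1 : ℝ)) =
      (‖p‖ ^ 2)⁻¹ * inner ℝ z p := by
  simp only [ell_apply, PiLp.inner_apply, Finset.mul_sum]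
  simp
  exact Finset.sum_congr rfl fun _ _ => by ring

end RadialDerivatives

/-! ### The metric and the potential in a chart. -/

section ChartComputations

attribute [local instance] finrank_R3 finrank_real_complex_fact'

variable {F : Type*} [NormedAddCommGroup F] [NormedSpace ℝ F]
  {φ : OpenPartialHomeomorph Target
    (ModelProd (EuclideanSpace ℝ (Fin 1)) (ModelProd ℝ (EuclideanSpace ℝ (Fin 2))))}

theorem contMDiffAt_extend_symm (hφ : φ ∈ IsManifold.maximalAtlas targetModel ∞ Target)
    {q : EuclideanSpace ℝ (Fin 1) × ℝ × EuclideanSpace ℝ (Fin 2)}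
    (hq : q ∈ (φ.extend targetModel).target) :
    ContMDiffAt 𝓘(ℝ, EuclideanSpace ℝ (Fin 1) × ℝ × EuclideanSpace ℝ (Fin 2)) targetModel ∞
      (φ.extend targetModel).symm q := by
  refine (contMDiffOn_extend_symm hφ).contMDiffAt ?_
  rw [← φ.extend_target']
  exact φ.isOpen_extend_target.mem_nhds hq

theorem contDiffAt_comp_extend_symm (hφ : φ ∈ IsManifold.maximalAtlas targetModel ∞ Target)
    {q : EuclideanSpace ℝ (Fin 1) × ℝ × EuclideanSpace ℝ (Fin 2)}
    (hq : q ∈ (φ.extend targetModel).target) {κ : Target → F}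
    (hκ : ContMDiff targetModel 𝓘(ℝ, F) ∞ κ) :
    ContDiffAt ℝ ∞ (fun q => κ ((φ.extend targetModel).symm q)) q :=
  ((hκ _).comp q (contMDiffAt_extend_symm hφ hq)).contDiffAt

theorem mfderiv_comp_extend_symm (hφ : φ ∈ IsManifold.maximalAtlas targetModel ∞ Target)
    {q : EuclideanSpace ℝ (Fin 1) × ℝ × EuclideanSpace ℝ (Fin 2)}
    (hq : q ∈ (φ.extend targetModel).target) {κ : Target → F}
    (hκ : ContMDiff targetModel 𝓘(ℝ, F) ∞ κ)
    (a : EuclideanSpace ℝ (Fin 1) × ℝ × EuclideanSpace ℝ (Fin 2)) :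
    mfderiv targetModel 𝓘(ℝ, F) κ ((φ.extend targetModel).symm q)
      (mfderiv 𝓘(ℝ, EuclideanSpace ℝ (Fin 1) × ℝ × EuclideanSpace ℝ (Fin 2)) targetModel
        (φ.extend targetModel).symm q a) =
      fderiv ℝ (fun q => κ ((φ.extend targetModel).symm q)) q a := by
  have h := mfderiv_comp_apply q ((hκ.mdifferentiable (by simp)) ((φ.extend targetModel).symm q))
    ((contMDiffAt_extend_symm hφ hq).mdifferentiableAt (by simp)) a
  rw [mfderiv_eq_fderiv] at h
  exact h.symm

/-- This exhibits the metric as a sum of three forms ρ⟪dA, dA⟫; the factors 1 keep the shape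
required by `exists_hasFDerivAt_weighted`. -/
theorem metricInChart_warpedMetric (hφ : φ ∈ IsManifold.maximalAtlas targetModel ∞ Target)
    {q : EuclideanSpace ℝ (Fin 1) × ℝ × EuclideanSpace ℝ (Fin 2)}
    (hq : q ∈ (φ.extend targetModel).target)
    (a b : EuclideanSpace ℝ (Fin 1) × ℝ × EuclideanSpace ℝ (Fin 2)) :
    metricInChart warpedMetric φ q a b =
      1 * inner ℝ (fderiv ℝ (fun q => (((φ.extend targetModel).symm q).1 : ℂ)) q a)
        (fderiv ℝ (fun q => (((φ.extend targetModel).symm q).1 : ℂ)) q b) +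
      1 * inner ℝ (fderiv ℝ (fun q => ((φ.extend targetModel).symm q).2.1) q a)
        (fderiv ℝ (fun q => ((φ.extend targetModel).symm q).2.1) q b) +
      (2 - circleV ((φ.extend targetModel).symm q).1 ((φ.extend targetModel).symm q).2.1) *
        inner ℝ (fderiv ℝ (fun q => (((φ.extend targetModel).symm q).2.2 : R3)) q a)
          (fderiv ℝ (fun q => (((φ.extend targetModel).symm q).2.2 : R3)) q b) := by
  rw [← mfderiv_comp_extend_symm hφ hq contMDiff_cx, ← mfderiv_comp_extend_symm hφ hq contMDiff_cx,
    ← mfderiv_comp_extend_symm hφ hq contMDiff_cy, ← mfderiv_comp_extend_symm hφ hq contMDiff_cy,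
    ← mfderiv_comp_extend_symm hφ hq contMDiff_cz, ← mfderiv_comp_extend_symm hφ hq contMDiff_cz,
    one_mul, one_mul]
  refine (warpedInner_apply _ _ _).trans ?_
  rw [warpedForm]
  congr 2
  exact mul_comm _ _

theorem inner_fderiv_eq_zero_of_norm_eq_one {E P : Type*} [NormedAddCommGroup E] [NormedSpace ℝ E]
    [NormedAddCommGroup P] [InnerProductSpace ℝ P] {A : E → P} {q : E}
    (hA : DifferentiableAt ℝ A q) (h1 : ∀ q, ‖A q‖ = 1) (k : E) :
    inner ℝ (fderiv ℝ A q k) (A q) = 0 := by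
  have h := hA.hasFDerivAt.norm_sq
  simp only [h1, one_pow] at h
  have h2 := congrArg (fun L : E →L[ℝ] ℝ => L k) (h.unique (hasFDerivAt_const 1 q))
  rw [real_inner_comm]
  simpa using h2

theorem fderiv_circleV_comp {E : Type*} [NormedAddCommGroup E] [NormedSpace ℝ E] {A : E → Circle}
    {B : E → ℝ} {q : E} (hA : DifferentiableAt ℝ (fun q => (A q : ℂ)) q)
    (hB : DifferentiableAt ℝ B q) {s : ℝ} (hs : A q = Circle.exp s) (k : E) :
    fderiv ℝ (fun q => circleV (A q) (B q)) q k =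
      Vx s (B q) * inner ℝ (fderiv ℝ (fun q => (A q : ℂ)) q k) (Complex.I * (A q : ℂ)) +
        Vy s (B q) * fderiv ℝ B q k := by
  have hre := Complex.reCLM.hasFDerivAt.comp q hA.hasFDerivAt
  have him := Complex.imCLM.hasFDerivAt.comp q hA.hasFDerivAt
  have hzr := (hasDerivAt_zeta_re (B q)).comp_hasFDerivAt q hB.hasFDerivAt
  have hzi := (hasDerivAt_zeta_im (B q)).comp_hasFDerivAt q hB.hasFDerivAt
  have h := ((him.mul hzr).add (hre.mul hzi)).neg
  have h' : HasFDerivAt (fun q => circleV (A q) (B q)) _ q := h.congr_of_eventuallyEq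
    (Eventually.of_forall fun q => circleV_eq (A q) (B q))
  have horth := inner_fderiv_eq_zero_of_norm_eq_one hA (fun q => Circle.norm_coe (A q)) k
  have hre' : (A q : ℂ).re = Real.cos s := by rw [hs, Circle.coe_exp, Complex.exp_ofReal_mul_I_re]
  have him' : (A q : ℂ).im = Real.sin s := by rw [hs, Circle.coe_exp, Complex.exp_ofReal_mul_I_im]
  rw [h'.fderiv]
  set α := fderiv ℝ (fun q => (A q : ℂ)) q k with hα
  rw [Complex.inner] at horth ⊢
  simp only [Complex.mul_re, Complex.mul_im, Complex.conj_re, Complex.conj_im, hre', him',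
    Complex.I_re, Complex.I_im] at horth ⊢
  simp only [neg_apply, add_apply, smul_apply, ContinuousLinearMap.comp_apply, Function.comp_apply,
    Complex.reCLM_apply, Complex.imCLM_apply, ← hα, hre', him', smul_eq_mul, Vx, Vy]
  have hcs := Real.sin_sq_add_cos_sq s
  -- As α is tangent to the circle at e^{is}, it equals its component along i e^{is} times i e^{is};
  -- these are the two coordinates of that relation.
  have e1 : α.re = -(α.im * Real.cos s - α.re * Real.sin s) * Real.sin s := by
    linear_combination (-α.re) * hcs + Real.cos s * horth
  have e2 : α.im = (α.im * Real.cos s - α.re * Real.sin s) * Real.cos s := by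
    linear_combination (-α.im) * hcs + Real.sin s * horth
  linear_combination (-(zeta (B q)).re) * e2 + (-(zeta (B q)).im) * e1

end ChartComputations

/-! ### The Euler-Lagrange equations of a radial map. -/

section EulerLagrangeRadial

attribute [local instance] finrank_R3 finrank_real_complex_fact'

variable {X Y : ℝ → ℝ}
  {φ : OpenPartialHomeomorph Target
    (ModelProd (EuclideanSpace ℝ (Fin 1)) (ModelProd ℝ (EuclideanSpace ℝ (Fin 2))))}

theorem hasDerivAt_circleExp_comp {X' : ℝ} {t : ℝ} (hX : HasDerivAt X X' t) :
    HasDerivAt (fun t => (Circle.exp (X t) : ℂ)) (X' • (Complex.I * (Circle.exp (X t) : ℂ))) t :=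
  HasDerivAt.scomp t (hasDerivAt_circleExp (X t)) hX

/-- The directional contribution of `e` to the Euler-Lagrange operator of a radial map, for a
variation with components `θ`, `κ` and `z` on the three factors of the target. -/
noncomputable def radialTerm (X Y : ℝ → ℝ) (p : R3) (θ κ c : ℝ) (z e : R3) : ℝ :=
  (ell p e ^ 2 * deriv (deriv X) (Real.log ‖p‖) +
    ((‖p‖ ^ 2)⁻¹ - 2 * ell p e ^ 2) * deriv X (Real.log ‖p‖)) * θ +
  (ell p e ^ 2 * deriv (deriv Y) (Real.log ‖p‖) +
    ((‖p‖ ^ 2)⁻¹ - 2 * ell p e ^ 2) * deriv Y (Real.log ‖p‖)) * κ +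
  c * (ell p e * inner ℝ z e) +
  1 / 2 * (Vx (X (Real.log ‖p‖)) (Y (Real.log ‖p‖)) * θ +
    Vy (X (Real.log ‖p‖)) (Y (Real.log ‖p‖)) * κ) * ((‖p‖ ^ 2)⁻¹ - ell p e ^ 2)

/-- The squares `ell p e`² sum to |p|⁻² over the three basis vectors. So |p|⁻² - 2ell² sums to (3 -
2)|p|⁻², which gives friction coefficient 1, and half of |p|⁻² - ell² also sums to |p|⁻², the
coefficient of ∇V. The sphere term vanishes because z is orthogonal to p. -/
theorem sum_radialTerm {p z : R3} {θ κ c : ℝ}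
    (hx : deriv (deriv X) (Real.log ‖p‖) + deriv X (Real.log ‖p‖) +
      Vx (X (Real.log ‖p‖)) (Y (Real.log ‖p‖)) = 0)
    (hy : deriv (deriv Y) (Real.log ‖p‖) + deriv Y (Real.log ‖p‖) +
      Vy (X (Real.log ‖p‖)) (Y (Real.log ‖p‖)) = 0) (hz : inner ℝ z p = 0) :
    ∑ α, radialTerm X Y p θ κ c z (EuclideanSpace.single α 1) = 0 := by
  have h1 := sum_ell_sq p
  have h2 := sum_ell_mul_inner p z
  rw [hz, mul_zero] at h2
  simp only [Fin.sum_univ_three] at h1 h2 ⊢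
  simp only [radialTerm]
  linear_combination
    ((deriv (deriv X) (Real.log ‖p‖) - 2 * deriv X (Real.log ‖p‖)) * θ +
      (deriv (deriv Y) (Real.log ‖p‖) - 2 * deriv Y (Real.log ‖p‖)) * κ -
      1 / 2 * (Vx (X (Real.log ‖p‖)) (Y (Real.log ‖p‖)) * θ +
        Vy (X (Real.log ‖p‖)) (Y (Real.log ‖p‖)) * κ)) * h1 + c * h2 +
      (‖p‖ ^ 2)⁻¹ * (θ * hx + κ * hy)

theorem eulerLagrangeAt_radialMap (hX : ContDiff ℝ ∞ X) (hY : ContDiff ℝ ∞ Y)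
    (hx : ∀ t, deriv (deriv X) t + deriv X t + Vx (X t) (Y t) = 0)
    (hy : ∀ t, deriv (deriv Y) t + deriv Y t + Vy (X t) (Y t) = 0) {p : R3} (hp : p ≠ 0)
    (hφ : φ ∈ IsManifold.maximalAtlas targetModel ∞ Target) (hs : radialMap X Y p ∈ φ.source) :
    EulerLagrangeAt warpedMetric φ (radialMap X Y) p := by
  unfold EulerLagrangeAt
  intro h ε k
  have hf := contMDiffAt_radialMap hX hY hp
  have hh : ContDiffAt ℝ ∞ h p := ((φ.contMDiffAt_extend hφ hs).comp p hf).contDiffAt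
  have hq : h p ∈ (φ.extend targetModel).target :=
    (φ.extend targetModel).map_source (by rwa [φ.extend_source])
  have hmem : ∀ᶠ q in 𝓝 (h p), q ∈ (φ.extend targetModel).target :=
    φ.isOpen_extend_target.mem_nhds hq
  have hσ : ∀ᶠ x' in 𝓝 p, x' ≠ 0 ∧ (φ.extend targetModel).symm (h x') = radialMap X Y x' := by
    filter_upwards [isOpen_ne.mem_nhds hp,
      hf.continuousAt.preimage_mem_nhds (φ.open_source.mem_nhds hs)] with x' h1 h2
    exact ⟨h1, (φ.extend targetModel).left_inv (by rwa [φ.extend_source])⟩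
  have hg := fun q hq => metricInChart_warpedMetric hφ (q := q) hq
  have dX : ∀ t, HasDerivAt X (deriv X t) t := fun t => (hX.differentiable (by simp) t).hasDerivAt
  have dY : ∀ t, HasDerivAt Y (deriv Y t) t := fun t => (hY.differentiable (by simp) t).hasDerivAt
  have dX' : ∀ t, HasDerivAt (deriv X) (deriv (deriv X) t) t := fun t =>
    (((contDiff_infty_iff_deriv.1 hX).2).differentiable (by simp) t).hasDerivAt
  have dY' : ∀ t, HasDerivAt (deriv Y) (deriv (deriv Y) t) t := fun t =>
    (((contDiff_infty_iff_deriv.1 hY).2).differentiable (by simp) t).hasDerivAt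
  have hA := contDiffAt_comp_extend_symm hφ hq contMDiff_cx
  have hB := contDiffAt_comp_extend_symm hφ hq contMDiff_cy
  have hZ := contDiffAt_comp_extend_symm hφ hq contMDiff_cz
  have hW := (contDiffAt_comp_extend_symm hφ hq contMDiff_circleV).differentiableAt (by simp)
  -- From here on the chart enters only through the facts already collected about its inverse.
  generalize (φ.extend targetModel).symm = σ at *
  have hσp := hσ.self_of_nhds.2
  have ortA := inner_fderiv_eq_zero_of_norm_eq_one (hA.differentiableAt (by simp))
    (fun q => Circle.norm_coe _) k
  have ortZ := inner_fderiv_eq_zero_of_norm_eq_one (hZ.differentiableAt (by simp))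
    (fun q => norm_eq_of_mem_sphere _) k
  have hV' := fderiv_circleV_comp (A := fun q => (σ q).1) (B := fun q => (σ q).2.1)
    (hA.differentiableAt (by simp)) (hB.differentiableAt (by simp))
    (s := X (Real.log ‖p‖)) (by simp only [hσp, radialMap]) k
  have hW' : fderiv ℝ (fun q => 2 - circleV (σ q).1 (σ q).2.1) (h p) k =
      -fderiv ℝ (fun q => circleV (σ q).1 (σ q).2.1) (h p) k := by
    rw [fderiv_const_sub, neg_apply]
  rw [hV'] at hW'
  set v₁ := fderiv ℝ (fun q => ((σ q).1 : ℂ)) (h p) k with hv₁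
  set v₂ := fderiv ℝ (fun q => (σ q).2.1) (h p) k with hv₂
  set v₃ := fderiv ℝ (fun q => ((σ q).2.2 : R3)) (h p) k with hv₃
  simp only [hσp, radialMap] at ortA ortZ hW'
  rw [coe_unitVec _ hp, real_inner_smul_right, mul_eq_zero, inv_eq_zero] at ortZ
  replace ortZ := ortZ.resolve_left (norm_ne_zero_iff.2 hp)
  set θ := inner ℝ v₁ (Complex.I * (Circle.exp (X (Real.log ‖p‖)) : ℂ)) with hθ
  obtain ⟨c, hc⟩ : ∃ c, HasDerivAt (fun t => 2 - V (X t) (Y t)) c (Real.log ‖p‖) :=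
    ⟨_, (hasDerivAt_V_comp (dX _) (dY _)).const_sub 2⟩
  -- The total coefficient of `ell p e` times ⟪v₃, e⟫: the first summand comes from differentiating
  -- the weight, the second from differentiating `nu`.
  set c' := c * ‖p‖⁻¹ - 2 * (2 - V (X (Real.log ‖p‖)) (Y (Real.log ‖p‖))) * ‖p‖⁻¹ with hc'
  have key : ∀ e : R3, ‖e‖ = 1 → ∃ (L₁ : R3 →L[ℝ] ℝ)
      (L₂ : (EuclideanSpace ℝ (Fin 1) × ℝ × EuclideanSpace ℝ (Fin 2)) →L[ℝ] ℝ),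
      HasFDerivAt (fun x' => metricInChart warpedMetric φ (h x') k (fderiv ℝ h x' e)) L₁ p ∧
      HasFDerivAt (fun q => metricInChart warpedMetric φ q (fderiv ℝ h p e) (fderiv ℝ h p e)) L₂
        (h p) ∧ L₁ e - 1 / 2 * L₂ k = radialTerm X Y p θ v₂ c' v₃ e := by
    intro e he
    obtain ⟨L₁, M₁, hL₁, hM₁, e₁⟩ := exists_hasFDerivAt_weighted (e := e) (k := k)
      (ρ := fun _ => 1) (β := fun _ => 1) hA (differentiableAt_const _) hh
      (a := fun x' => (Circle.exp (X (Real.log ‖x'‖)) : ℂ))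
      (hσ.mono fun x' hx' => by simp only [hx'.2, radialMap])
      (Eventually.of_forall fun _ => rfl)
      (hσ.mono fun x' hx' => hasFDerivAt_comp_log_norm hx'.1 (hasDerivAt_circleExp_comp (dX _)))
      (hasFDerivAt_fderiv_comp_log_norm hp
        ((dX' _).smul ((hasDerivAt_circleExp_comp (dX _)).const_mul Complex.I)) e)
      (hasFDerivAt_const _ _) hv₁.symm rfl
    obtain ⟨L₂, M₂, hL₂, hM₂, e₂⟩ := exists_hasFDerivAt_weighted (e := e) (k := k)
      (ρ := fun _ => 1) (β := fun _ => 1) hB (differentiableAt_const _) hh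
      (a := fun x' => Y (Real.log ‖x'‖))
      (hσ.mono fun x' hx' => by simp only [hx'.2, radialMap])
      (Eventually.of_forall fun _ => rfl)
      (hσ.mono fun x' hx' => hasFDerivAt_comp_log_norm hx'.1 (dY _))
      (hasFDerivAt_fderiv_comp_log_norm hp (dY' _) e)
      (hasFDerivAt_const _ _) hv₂.symm rfl
    obtain ⟨L₃, M₃, hL₃, hM₃, e₃⟩ := exists_hasFDerivAt_weighted (e := e) (k := k)
      (ρ := fun q => 2 - circleV (σ q).1 (σ q).2.1)
      (β := fun x' => 2 - V (X (Real.log ‖x'‖)) (Y (Real.log ‖x'‖))) hZ (hW.const_sub 2) hh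
      (a := fun x' => ‖x'‖⁻¹ • x')
      (hσ.mono fun x' hx' => by simp only [hx'.2, radialMap, coe_unitVec _ hx'.1])
      (hσ.mono fun x' hx' => by simp only [hx'.2, radialMap, circleV_exp])
      (hσ.mono fun x' hx' => hasFDerivAt_unit hx'.1)
      (hasFDerivAt_nu_apply hp e) (hasFDerivAt_comp_log_norm hp hc) hv₃.symm hW'
    refine ⟨L₁ + L₂ + L₃, M₁ + M₂ + M₃, ((hL₁.add hL₂).add hL₃).congr_of_eventuallyEq ?_,
      ((hM₁.add hM₂).add hM₃).congr_of_eventuallyEq ?_, ?_⟩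
    · filter_upwards [hh.continuousAt.eventually hmem] with x' hx'
      exact hg _ hx' _ _
    · filter_upwards [hmem] with q hq
      exact hg _ hq _ _
    · have e₄ : (L₁ + L₂ + L₃) e - 1 / 2 * (M₁ + M₂ + M₃) k = (L₁ e - 1 / 2 * M₁ k) +
          (L₂ e - 1 / 2 * M₂ k) + (L₃ e - 1 / 2 * M₃ k) := by
        simp only [add_apply]; ring
      rw [e₄, e₁, e₂, e₃, norm_nu_apply_sq hp]
      -- The centripetal part of the acceleration on the circle is normal, so it pairs to 0 with the
      -- tangent vector v₁.
      have hEE : inner ℝ v₁ (Complex.I * deriv X (Real.log ‖p‖) •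
          (Complex.I * (Circle.exp (X (Real.log ‖p‖)) : ℂ))) = 0 := by
        rw [mul_smul_comm, ← mul_assoc, Complex.I_mul_I, neg_one_mul, real_inner_smul_right,
          inner_neg_right, ortA, neg_zero, mul_zero]
      have hR : ∀ y : ℝ, inner ℝ v₂ y = y * v₂ := fun y => rfl
      simp only [zero_apply, zero_mul, fderiv_fun_const, Pi.zero_apply, add_apply, sub_apply,
        neg_apply, ContinuousLinearMap.smulRight_apply, smul_apply, innerSL_apply_apply,
        nu_apply, inner_add_right, inner_sub_right, real_inner_smul_right, smul_eq_mul,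
        hEE, hR, ← hθ, ortZ, real_inner_self_eq_norm_sq, he,
        mul_zero, radialTerm, Pi.smul_apply', hc']
      ring
  choose! L₁ L₂ hL₁ hL₂ hL using key
  have hε : ∀ α, ‖ε α‖ = 1 := fun α => by simp [ε]
  simp only [fun α => (hL₁ _ (hε α)).fderiv, fun α => (hL₂ _ (hε α)).fderiv]
  rw [← sub_eq_zero, Finset.mul_sum, ← Finset.sum_sub_distrib]
  simp only [fun α => hL _ (hε α)]
  exact sum_radialTerm (hx _) (hy _) ortZ

end EulerLagrangeRadial

/-! ### Assembly of the harmonic map and the main theorem. -/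

variable {X Y : ℝ → ℝ}

theorem IsTrajectory.eq_Vx (h : IsTrajectory X Y) (t : ℝ) :
    deriv (deriv X) t + deriv X t + Vx (X t) (Y t) = 0 := by
  rw [← (hasDerivAt_V_left (X t) (Y t)).deriv]
  exact h.eq_x t

theorem IsTrajectory.eq_Vy (h : IsTrajectory X Y) (t : ℝ) :
    deriv (deriv Y) t + deriv Y t + Vy (X t) (Y t) = 0 := by
  rw [← (hasDerivAt_V_right (X t) (Y t)).deriv]
  exact h.eq_y t

theorem isHarmonicMap_radialMap (h : IsTrajectory X Y) (hY1 : ∀ t ≤ 0, Y t ∈ Icc (0 : ℝ) 1)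
    (hd : ∀ t, |deriv X t| ≤ 2 ∧ |deriv Y t| ≤ 2) :
    IsHarmonicMap warpedMetric (Metric.ball 0 1) {0} (radialMap X Y) where
  isOpen := Metric.isOpen_ball
  sing_subset := by simp
  smooth p hp := (contMDiffAt_radialMap h.smooth_x h.smooth_y
    (by simpa using hp.2)).contMDiffWithinAt
  discontinuous p hp := by
    rw [Finset.mem_singleton.1 hp]
    exact not_tendsto_radialMap X Y
  sobolev η hη _ := isW12_comp_radialMap hη h.smooth_x h.smooth_y hY1 hd
  finite_energy := lintegral_energyDensity_radialMap_lt_top h.smooth_x h.smooth_y hd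
  eulerLagrange p hp φ hφ hs := eulerLagrangeAt_radialMap h.smooth_x h.smooth_y h.eq_Vx h.eq_Vy
    (by simpa using hp.2) hφ hs

theorem exists_isCompact_radialMap_mem (hY1 : ∀ t ≤ 0, Y t ∈ Icc (0 : ℝ) 1) :
    ∃ K : Set Target, IsCompact K ∧ ∀ p ∈ Metric.closedBall 0 1, radialMap X Y p ∈ K :=
  ⟨univ ×ˢ Icc 0 1 ×ˢ univ, isCompact_univ.prod (isCompact_Icc.prod isCompact_univ), fun p hp =>
    ⟨mem_univ _, hY1 _ (Real.log_nonpos (norm_nonneg _) (by simpa using hp)), mem_univ _⟩⟩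

end NonuniqueTangent

theorem theorem2 :
    -- the formula defines a smooth Riemannian metric `g` on `S¹ × ℝ × S²`
    ∃ g : Bundle.ContMDiffRiemannianMetric NonuniqueTangent.targetModel ∞
        (EuclideanSpace ℝ (Fin 1) × ℝ × EuclideanSpace ℝ (Fin 2))
        (fun p : NonuniqueTangent.Target => TangentSpace NonuniqueTangent.targetModel p),
      (∀ (p : NonuniqueTangent.Target) (v w : TangentSpace NonuniqueTangent.targetModel p),
        g.inner p v w = NonuniqueTangent.warpedForm p v w) ∧
      ∃ f : NonuniqueTangent.R3 → NonuniqueTangent.Target,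
        -- `f` is harmonic on the unit ball, with `0` as its only singularity
        NonuniqueTangent.IsHarmonicMap g (Metric.ball 0 1) {0} f ∧
        -- `f` is smooth up to the boundary, and its image is relatively compact
        ContMDiffOn 𝓘(ℝ, NonuniqueTangent.R3) NonuniqueTangent.targetModel ∞ f
          (Metric.closedBall 0 1 \ {0}) ∧
        (∃ K : Set NonuniqueTangent.Target, IsCompact K ∧ ∀ p ∈ Metric.closedBall 0 1, f p ∈ K) ∧
        -- a continuum of distinct tangent maps at `0`
        (∃ T : Circle → NonuniqueTangent.R3 → NonuniqueTangent.Target,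
          (∀ c, NonuniqueTangent.IsTangentMap NonuniqueTangent.targetModel f 0 (T c)) ∧
          (∀ c c', c ≠ c' → ¬ T c =ᵐ[volume] T c') ∧
          (∀ c y, y ≠ 0 → (T c y).1 = c ∧ (T c y).2.1 = 0 ∧
            ((T c y).2.2 : NonuniqueTangent.R3) = ‖y‖⁻¹ • y)) ∧
        -- `f` is the equivariant map given by a trajectory of the damped system
        (∃ x y : ℝ → ℝ, NonuniqueTangent.IsTrajectory x y ∧
          (∀ p : NonuniqueTangent.R3, p ≠ 0 → ‖p‖ ≤ 1 →
            (f p).1 = Circle.exp (x (Real.log ‖p‖)) ∧ (f p).2.1 = y (Real.log ‖p‖) ∧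
            ((f p).2.2 : NonuniqueTangent.R3) = ‖p‖⁻¹ • p) ∧
          (∀ t, NonuniqueTangent.physicalEnergy x y t < 0) ∧
          StrictAnti (NonuniqueTangent.physicalEnergy x y) ∧
          Tendsto y atBot (𝓝 0) ∧
          (∀ c : Circle, MapClusterPt (c, (0 : ℝ)) atBot (fun t => (Circle.exp (x t), y t)))) := by
  obtain ⟨x, y, h, henergy, hanti, hd, hy1, hy0, hx, hdx, hdy⟩ := NonuniqueTangent.exists_spiral
  refine ⟨NonuniqueTangent.warpedMetric, fun p v w => NonuniqueTangent.warpedInner_apply p v w,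
    NonuniqueTangent.radialMap x y, NonuniqueTangent.isHarmonicMap_radialMap h hy1 hd,
    fun p hp => (NonuniqueTangent.contMDiffAt_radialMap h.smooth_x h.smooth_y
      hp.2).contMDiffWithinAt,
    NonuniqueTangent.exists_isCompact_radialMap_mem hy1,
    ⟨NonuniqueTangent.coneMap, fun c => NonuniqueTangent.isTangentMap_coneMap h.smooth_x h.smooth_y
      hd hy1 hy0 hx hdx hdy c, fun c c' => NonuniqueTangent.coneMap_not_ae_eq,
      fun c p => NonuniqueTangent.coneMap_apply c⟩,
    x, y, h, fun p hp _ => ⟨rfl, rfl, NonuniqueTangent.coe_unitVec _ hp⟩, henergy, hanti, hy0,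
    NonuniqueTangent.mapClusterPt_circleExp h.smooth_x.continuous hx hy0⟩
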